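/- **Setting.** Let $X$ be a (real or complex) Banach space, $1\le p\le\infty$, and let $I=(a,b]$ with $-\infty<a<b<\infty$, or $I=\mathbb R$. Put $D_I=\{(t,s)\in I^2: t\ge s\}$. Let $C_0(I,X)$ be the space of continuous functions $I\to X$ that vanish at infinity (if $I=\mathbb R$), respectively at $a$ (if $I=(a,b]$), with the sup-norm. Put $E_p=L^p(I,X)$ for $p<\infty$ and $E_\infty=C_0(I,X)$. Let $W^{1,p}_0(I,X)$ be the set of $f\in E_p\cap C_0(I,X)$ with (weak) derivative $\dot f\in E_p$. For linear operators $A(t)$, $t\in I$, on $X$ with domains $D(A(t))$ let $$F_p=\{f\in W^{1,p}_0(I,X): f(t)\in D(A(t))\text{ for a.e. }t\in I,\ A(\cdot)f(\cdot)\in E_p\},\qquad G_0f=-\dot f+A(\cdot)f,\quad D(G_0)=F_p .$$ **Evolution families.** An evolution family is a family $U(t,s)\in\mathcal B(X)$, $(t,s)\in D_I$, with $U(t,r)U(r,s)=U(t,s)$ for $t\ge r\ge s$, $U(t,t)=1$, $(t,s)\mapsto U(t,s)$ strongly continuous, and $\|U(t,s)\|\le Ce^{\omega(t-s)}$ for some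 constants $C,\omega$. The evolution semigroup on $E_p$ given by $U$ is $(T(\sigma)f)(t)=U(t,t-\sigma)f(t-\sigma)$ if $t-\sigma\in I$ and $(T(\sigma)f)(t)=0$ otherwise ($\sigma\ge0$). If $I=\mathbb R$, $U$ is called invertible if every $U(t,s)$, $t\ge s$, has a bounded inverse, and then $U(t,s):=U(s,t)^{-1}$ for $t<s$. **Mild solutions.** Consider the nonautonomous Cauchy problem $\dot u(t)=A(t)u(t)$, $u(s)=x$. (a) Let $I=(a,b]$, $a<s<b$. A function $u\in C([s,b],X)$ is an $(E_p)$-mild solution if $u(s)=x$ and there are $u_n\in W^{1,p}((s,b),X)$ (if $p=\infty$: $u_n\in C^1((s,b),X)$ with bounded derivative, continuous on $[s,b]$) such that $u_n(t)\in D(A(t))$ for a.e. $t\in[s,b]$, $A(\cdot)u_n\in L^p([s,b],X)$ (if $p=\infty$: $A(\cdot)u_n\in C([s,b],X)$), $u_n\to u$ uniformly on $[s,b]$, and $-\dot u_n+A(\cdot)u_n\to0$ in $L^p([s,b],X)$. (b) Let $I=\mathbb R$. A function $u\in C(\mathbb R,X)$ is an $(E_p)$-mild solution on $\mathbb R$ if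 $u(s)=x$ and for each $d>|s|$ there are $u_n\in W^{1,p}((-d,d),X)$ (if $p=\infty$: $u_n\in C^1([-d,d],X)$) such that $u_n(t)\in D(A(t))$ for a.e. $t\in[-d,d]$, $A(\cdot)u_n\in L^p([-d,d],X)$ (if $p=\infty$: $A(\cdot)u_n\in C([-d,d],X)$), $u_n\to u$ uniformly on $[-d,d]$, and $-\dot u_n+A(\cdot)u_n\to0$ in $L^p([-d,d],X)$. **Assumptions.** Let $A(t)$, $t\in I$, be generators of strongly continuous semigroups on $X$ which are Kato-stable with constants $(M,w)$: $(w,\infty)\subset\rho(A(t))$ for all $t\in I$, and for all $k\in\mathbb N$, all $t_1\le\dots\le t_k$ in $I$ and all $\lambda>w$, $$\|R(\lambda,A(t_k))\cdots R(\lambda,A(t_1))\|\le M(\lambda-w)^{-k}.$$ Suppose that for some $w'>w$ the map $t\mapsto R(w',A(t))$ is strongly continuous on $I$ and $(w'-G_0)F_p$ is dense in $E_p$, and that $F_p$ is dense in $E_p$ and in $E_\infty$. **Theorem.** Then $G_0$ is closable in $E_p$, and its closure $G$ generates an evolution semigroup on $E_p$ given by an evolution family $U$. Moreover, for every such $U$,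 every $s\in I$ and every $x\in X$ the following holds. (i) Let $I=(a,b]$ and $s<b$. Then $u=U(\cdot,s)x\in C([s,b],X)$ is the unique $(E_p)$-mild solution, and the approximating functions $u_n$ may be taken to be (restrictions of) functions in $F_p$. Moreover, for $\varepsilon\in(0,b-s]$ let $\varphi_\varepsilon\in C^1_c((a,b])$ be any functions with $0\le\varphi_\varepsilon\le1$, $\varphi_\varepsilon=0$ on $(a,s]$ and $\varphi_\varepsilon=1$ on $[s+\varepsilon,b]$. Then $u$ is the only function in $C([s,b],X)$ such that $u(s)=x$, $\varphi_\varepsilon u\in D(G)$ and $G(\varphi_\varepsilon u)=0$ a.e. on $[s+\varepsilon,b]$ for all $\varepsilon\in(0,b-s]$. (Here $\varphi_\varepsilon u$ is extended by $0$ to $(a,s]$.) (ii) Let $I=\mathbb R$ and let $U$ be invertible. Then $u=U(\cdot,s)x\in C(\mathbb R,X)$ is the unique $(E_p)$-mild solution on $\mathbb R$. Moreover, for $d>|s|$ let $\psi_d\in C^1_c(\mathbb R)$ be any functions with $0\le\psi_d\le1$ and $\psi_d=1$ on $[-d,d]$. Then $u$ is the only function in $C(\mathbb R,X)$ such that $u(s)=x$,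 $\psi_du\in D(G)$ and $G(\psi_du)=0$ a.e. on $[-d,d]$ for all $d>|s|$. -/

import Mathlib

open Set Filter Topology MeasureTheory
open scoped ENNReal

noncomputable section

namespace EvolutionSemigroup

/-! ### Semigroups, generators, resolvents, Kato stability -/

section Abstract

variable {𝕜 : Type*} [RCLike 𝕜] {E : Type*} [NormedAddCommGroup E] [NormedSpace 𝕜 E]

/-- A strongly continuous semigroup of bounded operators; only `T t` with `0 ≤ t` matters. -/
structure IsC0Semigroup (T : ℝ → E →L[𝕜] E) : Prop where
  zero : T 0 = 1
  add : ∀ s t : ℝ, 0 ≤ s → 0 ≤ t → T (s + t) = T s ∘L T t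
  cont : ∀ x : E, ContinuousOn (fun t => T t x) (Ici 0)

/-- The linear operator `B` (with its domain) is the generator of `T`:
`x ∈ D(B)` and `B x = y` iff `(T t x - x) / t → y` as `t ↓ 0`. -/
def IsGeneratorOf (B : E →ₗ.[𝕜] E) (T : ℝ → E →L[𝕜] E) : Prop :=
  ∀ x y : E, (x, y) ∈ B.graph ↔
    Tendsto (fun t : ℝ => ((t⁻¹ : ℝ) : 𝕜) • (T t x - x)) (𝓝[>] 0) (𝓝 y)

/-- The bounded operator `R` is the inverse of `l - B : D(B) → E`. -/
def IsResolventAt (B : E →ₗ.[𝕜] E) (l : 𝕜) (R : E →L[𝕜] E) : Prop :=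
  ∀ x y : E, R x = y ↔ (y, l • y - x) ∈ B.graph

/-- `l ∈ ρ(B)`. -/
def InResolventSet (B : E →ₗ.[𝕜] E) (l : 𝕜) : Prop :=
  ∃ R : E →L[𝕜] E, IsResolventAt B l R

open scoped Classical in
/-- The resolvent `R(l, B) = (l - B)⁻¹` for `l ∈ ρ(B)` (and `0` otherwise). -/
def resolventOp (B : E →ₗ.[𝕜] E) (l : 𝕜) : E →L[𝕜] E :=
  if h : InResolventSet B l then h.choose else 0

/-- The family `A t`, `t ∈ I`, consists of generators of strongly continuous semigroups and is
Kato-stable with constants `M, w`. In the time-ordered product the latest time stands on the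
left; the list `ts` of times is therefore decreasing. -/
structure IsKatoStable (I : Set ℝ) (A : ℝ → E →ₗ.[𝕜] E) (M w : ℝ) : Prop where
  generator : ∀ t ∈ I, ∃ T : ℝ → E →L[𝕜] E, IsC0Semigroup T ∧ IsGeneratorOf (A t) T
  resolvent : ∀ t ∈ I, ∀ l : ℝ, w < l → InResolventSet (A t) (l : 𝕜)
  bound : ∀ ts : List ℝ, ts.Pairwise (· ≥ ·) → (∀ t ∈ ts, t ∈ I) → ∀ l : ℝ, w < l →
    ‖(ts.map fun t => resolventOp (A t) (l : 𝕜)).prod‖ ≤ M * ((l - w) ^ ts.length)⁻¹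

/-- A strongly continuous, exponentially bounded evolution family `U t s`, where only the
pairs `s ≤ t` in `I` matter. -/
structure IsEvolutionFamily (I : Set ℝ) (U : ℝ → ℝ → E →L[𝕜] E) : Prop where
  comp : ∀ s ∈ I, ∀ r ∈ I, ∀ t ∈ I, s ≤ r → r ≤ t → U t r ∘L U r s = U t s
  refl : ∀ t ∈ I, U t t = 1
  cont : ∀ x : E, ContinuousOn (fun q : ℝ × ℝ => U q.1 q.2 x)
    {q | q.1 ∈ I ∧ q.2 ∈ I ∧ q.2 ≤ q.1}
  bound : ∃ M w : ℝ, ∀ s ∈ I, ∀ t ∈ I, s ≤ t → ‖U t s‖ ≤ M * Real.exp (w * (t - s))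

/-- For `I = ℝ`: every `U t s`, `s ≤ t`, has a bounded inverse. -/
def IsInvertibleFamily (U : ℝ → ℝ → E →L[𝕜] E) : Prop :=
  ∀ s t : ℝ, s ≤ t → IsUnit (U t s)

/-- The extension of an invertible family to all pairs of times: `U(t, s) = U(s, t)⁻¹` for
`t < s`. -/
def twoSided (U : ℝ → ℝ → E →L[𝕜] E) (t s : ℝ) : E →L[𝕜] E :=
  if s ≤ t then U t s else Ring.inverse (U s t)

end Abstract

/-! ### The spaces `E_p` and the operator `G_0 = -d/dt + A(·)` -/

section Spaces

variable {𝕜 : Type*} [RCLike 𝕜] {X : Type*} [NormedAddCommGroup X]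

/-- `v ∈ C_0(I, X)`: continuous on `I`, vanishing at infinity in the locally compact space `I`,
that is, at `±∞` where `I` is unbounded and at finite end points which are not in `I`. -/
def MemC0 (I : Set ℝ) (v : ℝ → X) : Prop :=
  ContinuousOn v I ∧ Tendsto (I.domRestrict v) (cocompact I) (𝓝 0)

/-- The function `v` represents an element of `E_p`, where `E_p = L^p(I, X)` if `p < ∞` and
`E_∞ = C_0(I, X)`. -/
def MemE (I : Set ℝ) (p : ℝ≥0∞) (v : ℝ → X) : Prop :=
  MemLp v p (volume.restrict I) ∧ (p = ∞ → MemC0 I v)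

theorem MemC0.zero (I : Set ℝ) : MemC0 I (0 : ℝ → X) :=
  ⟨continuousOn_const, tendsto_const_nhds⟩

theorem MemC0.add {I : Set ℝ} {v u : ℝ → X} (hv : MemC0 I v) (hu : MemC0 I u) :
    MemC0 I (v + u) :=
  ⟨hv.1.add hu.1, by simpa using! hv.2.add hu.2⟩

theorem MemE.zero (I : Set ℝ) (p : ℝ≥0∞) : MemE I p (0 : ℝ → X) :=
  ⟨MemLp.zero, fun _ => MemC0.zero I⟩

theorem MemE.add {I : Set ℝ} {p : ℝ≥0∞} {v u : ℝ → X} (hv : MemE I p v) (hu : MemE I p u) :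
    MemE I p (v + u) :=
  ⟨hv.1.add hu.1, fun hp => (hv.2 hp).add (hu.2 hp)⟩

variable [NormedSpace 𝕜 X]

theorem MemC0.smul {I : Set ℝ} {v : ℝ → X} (c : 𝕜) (hv : MemC0 I v) : MemC0 I (c • v) :=
  ⟨hv.1.const_smul c, by simpa using! hv.2.const_smul c⟩

theorem MemE.smul {I : Set ℝ} {p : ℝ≥0∞} {v : ℝ → X} (c : 𝕜) (hv : MemE I p v) :
    MemE I p (c • v) :=
  ⟨hv.1.const_smul c, fun hp => (hv.2 hp).smul c⟩

variable (𝕜 X) in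
/-- The Banach space `E_p` of `X`-valued functions on `I`: all of `L^p(I, X)` if `p < ∞`, and
`C_0(I, X)` with the supremum norm if `p = ∞`, the latter realised as the subspace of
`L^∞(I, X)` of the classes that have a representative in `C_0(I, X)`. -/
def Ep (I : Set ℝ) (p : ℝ≥0∞) [Fact (1 ≤ p)] : Submodule 𝕜 (Lp X p (volume.restrict I)) where
  carrier := {f | p = ∞ → ∃ v : ℝ → X, MemC0 I v ∧ f =ᵐ[volume.restrict I] v}
  zero_mem' := fun _ => ⟨0, MemC0.zero I, Lp.coeFn_zero _ _ _⟩
  add_mem' := by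
    intro f g hf hg hp
    obtain ⟨v, hv, hfv⟩ := hf hp
    obtain ⟨u, hu, hgu⟩ := hg hp
    exact ⟨v + u, hv.add hu, (Lp.coeFn_add f g).trans (hfv.add hgu)⟩
  smul_mem' := by
    intro c f hf hp
    obtain ⟨v, hv, hfv⟩ := hf hp
    exact ⟨c • v, hv.smul c, (Lp.coeFn_smul c f).trans (hfv.const_smul c)⟩

/-- A function representing an element of `E_p`; it is determined almost everywhere on `I`. -/
def fn {I : Set ℝ} {p : ℝ≥0∞} [Fact (1 ≤ p)] (f : Ep 𝕜 X I p) : ℝ → X :=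
  ((f : Lp X p (volume.restrict I)) : ℝ → X)

theorem fn_add {I : Set ℝ} {p : ℝ≥0∞} [Fact (1 ≤ p)] (f g : Ep 𝕜 X I p) :
    fn (f + g) =ᵐ[volume.restrict I] fn f + fn g :=
  Lp.coeFn_add _ _

theorem fn_smul {I : Set ℝ} {p : ℝ≥0∞} [Fact (1 ≤ p)] (c : 𝕜) (f : Ep 𝕜 X I p) :
    fn (c • f) =ᵐ[volume.restrict I] c • fn f :=
  Lp.coeFn_smul _ _

theorem fn_zero {I : Set ℝ} {p : ℝ≥0∞} [Fact (1 ≤ p)] :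
    fn (0 : Ep 𝕜 X I p) =ᵐ[volume.restrict I] 0 :=
  Lp.coeFn_zero _ _ _

theorem fn_ext {I : Set ℝ} {p : ℝ≥0∞} [Fact (1 ≤ p)] {f g : Ep 𝕜 X I p}
    (h : fn f =ᵐ[volume.restrict I] fn g) : f = g :=
  Subtype.ext (Lp.ext h)

/-- The evolution semigroup on `E_p` given by `U`: `(T(σ) f)(t) = U(t, t - σ) f(t - σ)` if
`t - σ ∈ I`, and `0` otherwise. -/
def IsEvolutionSemigroupOf (I : Set ℝ) (p : ℝ≥0∞) [Fact (1 ≤ p)]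
    (T : ℝ → Ep 𝕜 X I p →L[𝕜] Ep 𝕜 X I p) (U : ℝ → ℝ → X →L[𝕜] X) : Prop :=
  ∀ σ : ℝ, 0 ≤ σ → ∀ f : Ep 𝕜 X I p, ∀ᵐ t ∂(volume.restrict I),
    (t - σ ∈ I → fn (T σ f) t = U t (t - σ) (fn f (t - σ))) ∧ (t - σ ∉ I → fn (T σ f) t = 0)

theorem MemE.intervalIntegrable {I : Set ℝ} [I.OrdConnected] {p : ℝ≥0∞} [hp : Fact (1 ≤ p)]
    {v : ℝ → X} (hv : MemE I p v) {r t : ℝ} (hr : r ∈ I) (ht : t ∈ I) :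
    IntervalIntegrable v volume r t := by
  have hsub : uIcc r t ⊆ I := Set.OrdConnected.uIcc_subset ‹_› hr ht
  have h1 : MemLp v p (volume.restrict (uIcc r t)) :=
    hv.1.mono_measure (Measure.restrict_mono hsub le_rfl)
  have h2 : IsFiniteMeasure (volume.restrict (uIcc r t)) :=
    ⟨by simp⟩
  exact IntegrableOn.intervalIntegrable (h1.integrable hp.out)

variable [NormedSpace ℝ X] [IsScalarTower ℝ 𝕜 X]

/-- `v ∈ W^{1,p}_0(I, X)` with derivative `v'`: both are in `E_p`, `v` is a primitive of `v'` and
belongs to `C_0(I, X)`. (For `p = ∞` this means that `v` is continuously differentiable with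
`v, v' ∈ C_0(I, X)`.) -/
structure IsW10 (I : Set ℝ) (p : ℝ≥0∞) (v v' : ℝ → X) : Prop where
  memE : MemE I p v
  memC0 : MemC0 I v
  memE' : MemE I p v'
  primitive : ∀ r ∈ I, ∀ t ∈ I, v t - v r = ∫ τ in r..t, v' τ

/-- `v ∈ F_p`, with derivative `v'` and with `A(·)v = g`:
`v ∈ W^{1,p}_0(I, X)`, `v(t) ∈ D(A(t))` for a.e. `t ∈ I`, and `A(·)v ∈ E_p`. -/
structure IsFp (I : Set ℝ) (p : ℝ≥0∞) (A : ℝ → X →ₗ.[𝕜] X) (v v' g : ℝ → X) : Prop where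
  w10 : IsW10 I p v v'
  memE : MemE I p g
  apply_ae : ∀ᵐ t ∂(volume.restrict I), (v t, g t) ∈ (A t).graph

theorem IsW10.add {I : Set ℝ} [I.OrdConnected] {p : ℝ≥0∞} [Fact (1 ≤ p)] {v v' u u' : ℝ → X}
    (hv : IsW10 I p v v') (hu : IsW10 I p u u') : IsW10 I p (v + u) (v' + u') where
  memE := hv.memE.add hu.memE
  memC0 := hv.memC0.add hu.memC0
  memE' := hv.memE'.add hu.memE'
  primitive := by
    intro r hr t ht
    have h := intervalIntegral.integral_add (hv.memE'.intervalIntegrable hr ht)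
      (hu.memE'.intervalIntegrable hr ht)
    simp only [Pi.add_apply]
    rw [h, ← hv.primitive r hr t ht, ← hu.primitive r hr t ht]
    abel

theorem IsW10.smul {I : Set ℝ} {p : ℝ≥0∞} {v v' : ℝ → X} (c : 𝕜)
    (hv : IsW10 I p v v') : IsW10 I p (c • v) (c • v') where
  memE := hv.memE.smul c
  memC0 := hv.memC0.smul c
  memE' := hv.memE'.smul c
  primitive := by
    intro r hr t ht
    have : SMulCommClass ℝ 𝕜 X := IsScalarTower.to_smulCommClass
    simp only [Pi.smul_apply]
    rw [intervalIntegral.integral_smul, ← hv.primitive r hr t ht, smul_sub]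

/-- The graph of `G_0 = -d/dt + A(·)` with domain `F_p`, as a subspace of `E_p × E_p`. -/
def G0graph (I : Set ℝ) [I.OrdConnected] (p : ℝ≥0∞) [Fact (1 ≤ p)] (A : ℝ → X →ₗ.[𝕜] X) :
    Submodule 𝕜 (Ep 𝕜 X I p × Ep 𝕜 X I p) where
  carrier := {q | ∃ v v' g : ℝ → X, IsFp I p A v v' g ∧
    fn q.1 =ᵐ[volume.restrict I] v ∧ fn q.2 =ᵐ[volume.restrict I] -v' + g}
  zero_mem' := by
    refine ⟨0, 0, 0, ⟨⟨MemE.zero I p, MemC0.zero I, MemE.zero I p, ?_⟩, MemE.zero I p, ?_⟩,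
      fn_zero, ?_⟩
    · simp
    · exact Eventually.of_forall fun t => (A t).graph.zero_mem
    · simpa using fn_zero
  add_mem' := by
    rintro q q' ⟨v, v', g, h, h1, h2⟩ ⟨u, u', k, h', h1', h2'⟩
    refine ⟨v + u, v' + u', g + k, ⟨h.w10.add h'.w10, h.memE.add h'.memE, ?_⟩,
      (fn_add _ _).trans (h1.add h1'), ?_⟩
    · filter_upwards [h.apply_ae, h'.apply_ae] with t ht ht'
      exact (A t).graph.add_mem ht ht'
    · refine (fn_add _ _).trans ((h2.add h2').trans (Eventually.of_forall fun t => ?_))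
      simp only [Pi.add_apply, Pi.neg_apply]
      abel
  smul_mem' := by
    rintro c q ⟨v, v', g, h, h1, h2⟩
    refine ⟨c • v, c • v', c • g, ⟨h.w10.smul c, h.memE.smul c, ?_⟩,
      (fn_smul _ _).trans (h1.const_smul c), ?_⟩
    · filter_upwards [h.apply_ae] with t ht
      exact (A t).graph.smul_mem c ht
    · refine (fn_smul _ _).trans ((h2.const_smul c).trans (Eventually.of_forall fun t => ?_))
      simp only [Pi.add_apply, Pi.neg_apply, Pi.smul_apply, smul_add, smul_neg]

/-- The operator `G_0 = -d/dt + A(·)` in `E_p` with domain `D(G_0) = F_p`. -/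
def G0 (I : Set ℝ) [I.OrdConnected] (p : ℝ≥0∞) [Fact (1 ≤ p)] (A : ℝ → X →ₗ.[𝕜] X) :
    Ep 𝕜 X I p →ₗ.[𝕜] Ep 𝕜 X I p :=
  (G0graph I p A).toLinearPMap

/-- `G_0` is well defined: its graph is the set of pairs `(v, -v' + A(·)v)`, `v ∈ F_p`. -/
theorem G0_graph [CompleteSpace X] (I : Set ℝ) [I.OrdConnected] (p : ℝ≥0∞) [Fact (1 ≤ p)]
    (A : ℝ → X →ₗ.[𝕜] X) : (G0 I p A).graph = G0graph I p A := by
  refine Submodule.toLinearPMap_graph_eq _ ?_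
  rintro ⟨f, h⟩ ⟨v, v', g, hF, hf, hh⟩ hf0
  have hI : MeasurableSet I := Set.OrdConnected.measurableSet ‹_›
  dsimp only at hf hh hf0 ⊢
  subst hf0
  have hv : v =ᵐ[volume.restrict I] 0 := hf.symm.trans fn_zero
  have hv' : ∀ᵐ t ∂(volume : Measure ℝ), t ∈ I → v' t = 0 := by
    refine ae_of_mem_of_ae_of_mem_inter_Ioo ?_
    intro c d hc hd hcd
    have hsub : Icc c d ⊆ I := Set.OrdConnected.out ‹_› hc hd
    have hz : EqOn v 0 (Icc c d) :=
      Measure.eqOn_Icc_of_ae_eq volume hcd.ne (ae_restrict_of_ae_restrict_of_subset hsub hv)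
        (hF.w10.memC0.1.mono hsub) continuousOn_const
    have hder := (hF.w10.memE'.intervalIntegrable hc hd).ae_hasDerivAt_integral
    filter_upwards [hder] with x hx hxI
    have hx1 : x ∈ uIcc c d := by
      rw [uIcc_of_le hcd.le]; exact Ioo_subset_Icc_self hxI.2
    have h1 := hx hx1 c left_mem_uIcc
    have h2 : (fun y => ∫ τ in c..y, v' τ) =ᶠ[𝓝 x] fun _ => (0 : X) := by
      filter_upwards [isOpen_Ioo.mem_nhds hxI.2] with y hy
      have hy' := Ioo_subset_Icc_self hy
      rw [← hF.w10.primitive c hc y (hsub hy'), hz hy', hz (left_mem_Icc.2 hcd.le)]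
      simp
    exact (h1.congr_of_eventuallyEq h2.symm).unique (hasDerivAt_const x (0 : X))
  refine fn_ext (hh.trans (EventuallyEq.trans ?_ fn_zero.symm))
  filter_upwards [hv, (ae_restrict_iff' hI).2 hv', hF.apply_ae] with t h1 h2 h3
  have h4 : g t = 0 := (A t).graph_fst_eq_zero_snd h3 (by simpa using h1)
  simp [h2, h4]

/-- `B` generates the evolution semigroup on `E_p` that is given by the family `U`. -/
def GeneratesEvolutionSemigroup (I : Set ℝ) (p : ℝ≥0∞) [Fact (1 ≤ p)]
    (B : Ep 𝕜 X I p →ₗ.[𝕜] Ep 𝕜 X I p) (U : ℝ → ℝ → X →L[𝕜] X) : Prop :=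
  ∃ T : ℝ → Ep 𝕜 X I p →L[𝕜] Ep 𝕜 X I p,
    IsC0Semigroup T ∧ IsGeneratorOf B T ∧ IsEvolutionSemigroupOf I p T U

/-- `f ∈ D(B)` and `B f = 0` on `J ⊆ I` (as an element of a function space, that is, almost
everywhere on `J`). -/
def InDomainAndVanishesOn {I : Set ℝ} {p : ℝ≥0∞} [Fact (1 ≤ p)]
    (B : Ep 𝕜 X I p →ₗ.[𝕜] Ep 𝕜 X I p) (f : ℝ → X) (J : Set ℝ) : Prop :=
  ∃ F H : Ep 𝕜 X I p, (F, H) ∈ B.graph ∧ fn F =ᵐ[volume.restrict I] f ∧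
    fn H =ᵐ[volume.restrict J] 0

/-! ### Mild solutions -/

/-- For a bounded interval `J`: `u ∈ W^{1,p}(J, X)` with derivative `u'` if `p < ∞`, and
`u ∈ C^1(J, X)` (with bounded derivative `u'`) if `p = ∞`. As usual `u` denotes the representative
that is continuous on the closure of `J`. -/
structure IsW1 (J : Set ℝ) (p : ℝ≥0∞) (u u' : ℝ → X) : Prop where
  cont : ContinuousOn u (closure J)
  memLp' : MemLp u' p (volume.restrict J)
  cont' : p = ∞ → ContinuousOn u' J
  primitive : ∀ r ∈ closure J, ∀ t ∈ closure J, u t - u r = ∫ τ in r..t, u' τ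

/-- The sequence `uₙ` approximates `u` on the closure of the bounded interval `J`, as required in
the definition of a mild solution: `uₙ ∈ W^{1,p}(J, X)` (resp. `C^1(J, X)`), `uₙ(t) ∈ D(A(t))`
for a.e. `t`, `A(·)uₙ = gₙ ∈ L^p` (resp. continuous), `uₙ → u` uniformly and
`-uₙ' + A(·)uₙ → 0` in `L^p`. -/
def IsMildApprox (A : ℝ → X →ₗ.[𝕜] X) (p : ℝ≥0∞) (J : Set ℝ) (u : ℝ → X) (un : ℕ → ℝ → X) :
    Prop :=
  ∃ un' gn : ℕ → ℝ → X,
    (∀ n, IsW1 J p (un n) (un' n)) ∧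
    (∀ n, ∀ᵐ t ∂(volume.restrict (closure J)), (un n t, gn n t) ∈ (A t).graph) ∧
    (∀ n, MemLp (gn n) p (volume.restrict (closure J))) ∧
    (p = ∞ → ∀ n, ContinuousOn (gn n) (closure J)) ∧
    TendstoUniformlyOn un u atTop (closure J) ∧
    Tendsto (fun n => eLpNorm (-(un' n) + gn n) p (volume.restrict (closure J))) atTop (𝓝 0)

/-- `u` is an `(E_p)`-mild solution on `[s, b]` of `u' = A(t)u`, `u(s) = x` (time interval
`(a, b]`). -/
def IsMildSolution (A : ℝ → X →ₗ.[𝕜] X) (p : ℝ≥0∞) (s b : ℝ) (x : X) (u : ℝ → X) : Prop :=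
  ContinuousOn u (Icc s b) ∧ u s = x ∧ ∃ un : ℕ → ℝ → X, IsMildApprox A p (Ioo s b) u un

/-- `u` is an `(E_p)`-mild solution on `ℝ` of `u' = A(t)u`, `u(s) = x`. -/
def IsMildSolutionReal (A : ℝ → X →ₗ.[𝕜] X) (p : ℝ≥0∞) (s : ℝ) (x : X) (u : ℝ → X) : Prop :=
  Continuous u ∧ u s = x ∧
    ∀ d : ℝ, |s| < d → ∃ un : ℕ → ℝ → X, IsMildApprox A p (Icc (-d) d) u un

end Spaces

/-! ### Cut-off functions -/

/-- `φ ∈ C^1_c((a, b])` with `0 ≤ φ ≤ 1`, `φ = 0` on `(a, s]` and `φ = 1` on `[s + ε, b]`, where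
`a < s < b`. (The compact support in `(a, b]` is automatic, since `φ = 0` on `(a, s]`.) -/
structure IsStepCutoff (a b s ε : ℝ) (φ : ℝ → ℝ) : Prop where
  contDiff : ContDiffOn ℝ 1 φ (Ioc a b)
  mem_Icc : ∀ t ∈ Ioc a b, φ t ∈ Icc (0 : ℝ) 1
  eq_zero : ∀ t ∈ Ioc a s, φ t = 0
  eq_one : ∀ t ∈ Icc (s + ε) b, φ t = 1

/-- `ψ ∈ C^1_c(ℝ)` with `0 ≤ ψ ≤ 1` and `ψ = 1` on `[-d, d]`. -/
structure IsPlateauCutoff (d : ℝ) (ψ : ℝ → ℝ) : Prop where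
  contDiff : ContDiff ℝ 1 ψ
  compact : HasCompactSupport ψ
  mem_Icc : ∀ t, ψ t ∈ Icc (0 : ℝ) 1
  eq_one : ∀ t ∈ Icc (-d) d, ψ t = 1

end EvolutionSemigroup

end

/-! Everything rests on one stability estimate, `IsStableFamily.norm_le`. If `u` is absolutely
continuous on `[s, t]`, `u(τ) ∈ D(A(τ))` almost everywhere and `A(·)u` is integrable, then for `ω >
w` the norm of `u(t)` is at most `M e^{ω(t-s)}` times `‖u(s)‖` plus a weighted `L^1`-norm of the
residual `u' - A(·)u`. To see this, replace `A` by its Yosida approximation `l² R(l, A) - l`. Once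
the factor `e^{l(τ-s)}` has removed the term `-l`, Volterra iteration produces time-ordered products
of resolvents, and Kato stability bounds exactly these (`norm_le_of_ordered_products`). Density of
`F_p` makes the Yosida error disappear as `l → ∞`.

Existence needs approximate solutions in `F_p` with any prescribed initial value
(`IsStableFamily.exists_isFp_approx`). Take `v₀ ∈ F_p` with `v₀(s)` near `x`. Its residual is
corrected by `e^{w'τ} v`, where `(w' - G_0) v` is close to `e^{-w'τ}` times the residual, cut off
shortly before `s`; such `v` exists because the range is dense. The estimate shows that `v(s)` is
small, so the correction hardly changes the initial value.

By stability these approximations converge, and their limit defines `U(t, s)x`. It satisfies the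
propagator inequality `‖u(t) - U(t, s)x‖ ≤ K (‖u(s) - x‖ + ∫ ‖u' - A u‖)` for all regular `u`
(`IsPropagator`). The remaining assertions are consequences. Comparing one approximation at several
times gives the evolution law and strong continuity. Inserting `v + (τ - (t - σ)) q` with `q` near
`G_0 v` gives a first-order Taylor estimate for the evolution semigroup, so its generator extends
`G_0`; the dense range of `w' - G_0` makes `F_p` a core. A semigroup is determined by its generator,
so every admissible `U` satisfies the inequality.

Finally, a mild solution is a limit of functions whose residuals tend to zero, as is a function
annihilated by the closure `G`. In the limit the propagator inequality becomes `u(t) = U(t, r)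
u(r)`. The converse follows by truncating the approximations in `F_p`. -/

open Set Filter Topology MeasureTheory
open scoped ENNReal

/-! ### Calculus of absolutely continuous vector-valued functions. -/

section Calculus

/-- Pointwise application of a strongly measurable operator family preserves measurability. -/
theorem AEStronglyMeasurable.apply_of_strongly_measurable {α 𝕜 E F : Type*} [MeasurableSpace α]
    {μ : Measure α}
    [NontriviallyNormedField 𝕜] [NormedAddCommGroup E] [NormedSpace 𝕜 E]
    [NormedAddCommGroup F] [NormedSpace 𝕜 F] {K : α → E →L[𝕜] F} {g : α → E}
    (hK : ∀ x, AEStronglyMeasurable (fun t => K t x) μ) (hg : AEStronglyMeasurable g μ) :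
    AEStronglyMeasurable (fun t => K t (g t)) μ := by
  have key : ∀ f : SimpleFunc α E, AEStronglyMeasurable (fun t => K t (f t)) μ := by
    intro f
    induction f using SimpleFunc.induction with
    | const c hs =>
      rename_i S
      refine ((hK c).indicator hs).congr (Eventually.of_forall fun t => ?_)
      by_cases ht : t ∈ S <;> simp [Set.piecewise, ht]
    | add _ h1 h2 =>
      refine (h1.add h2).congr (Eventually.of_forall fun t => ?_)
      simp
  have h1 : AEStronglyMeasurable (fun t => K t (hg.mk g t)) μ :=
    aestronglyMeasurable_of_tendsto_ae atTop (fun n => key (hg.stronglyMeasurable_mk.approx n))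
      (Eventually.of_forall fun t =>
        ((K t).continuous.tendsto _).comp (hg.stronglyMeasurable_mk.tendsto_approx t))
  refine h1.congr ?_
  filter_upwards [hg.ae_eq_mk] with t ht
  rw [ht]

variable {X : Type*} [NormedAddCommGroup X] [NormedSpace ℝ X]

theorem exists_continuous_integral_norm_sub_le {s t : ℝ} (hst : s ≤ t) {v : ℝ → X}
    (hv : IntervalIntegrable v volume s t) {ε : ℝ} (hε : 0 < ε) :
    ∃ c : ℝ → X, Continuous c ∧ HasCompactSupport c ∧ ∫ τ in s..t, ‖v τ - c τ‖ ≤ ε := by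
  rw [intervalIntegrable_iff_integrableOn_Ioc_of_le hst] at hv
  obtain ⟨c, h1, h2, h3, -⟩ := hv.exists_hasCompactSupport_integral_sub_le hε
  exact ⟨c, h3, h1, by rwa [intervalIntegral.integral_of_le hst]⟩

theorem continuousOn_of_primitive {s t : ℝ} {v v' : ℝ → X} (hst : s ≤ t)
    (hv' : IntervalIntegrable v' volume s t) (hv : ∀ r ∈ Icc s t, v r = v s + ∫ τ in s..r, v' τ) :
    ContinuousOn v (Icc s t) := by
  have h1 : ContinuousOn (fun r => v s + ∫ τ in s..r, v' τ) (Icc s t) := by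
    refine continuousOn_const.add ?_
    have := intervalIntegral.continuousOn_primitive_interval (μ := volume) (f := v') (a := s) (b := t)
      (by rw [uIcc_of_le hst, integrableOn_Icc_iff_integrableOn_Ioc]
          exact (intervalIntegrable_iff_integrableOn_Ioc_of_le hst).1 hv')
    rwa [uIcc_of_le hst] at this
  exact h1.congr hv

theorem IntervalIntegrable.continuousOn_smul_Icc {s t : ℝ} (hst : s ≤ t) {ρ : ℝ → ℝ} {f : ℝ → X}
    (hf : IntervalIntegrable f volume s t) (hρ : ContinuousOn ρ (Icc s t)) :
    IntervalIntegrable (fun τ => ρ τ • f τ) volume s t :=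
  hf.continuousOn_smul (by rwa [uIcc_of_le hst])

theorem IntervalIntegrable.mono_Icc {X : Type*} [NormedAddCommGroup X] {s t r q : ℝ} {f : ℝ → X}
    (hf : IntervalIntegrable f volume s t) (hr : r ∈ Icc s t) (hq : q ∈ Icc s t) :
    IntervalIntegrable f volume r q :=
  hf.mono_set (uIcc_subset_uIcc (Icc_subset_uIcc hr) (Icc_subset_uIcc hq))

/-- The product rule for absolutely continuous functions, in integrated form. -/
theorem smul_eq_add_integral_of_primitive [CompleteSpace X] {s t : ℝ} (hst : s ≤ t) {ρ ρ' : ℝ → ℝ}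
    {v v' : ℝ → X}
    (hρ' : ContinuousOn ρ' (Icc s t)) (hρ : ∀ r ∈ Icc s t, ρ r = ρ s + ∫ τ in s..r, ρ' τ)
    (hv' : IntervalIntegrable v' volume s t) (hv : ∀ r ∈ Icc s t, v r = v s + ∫ τ in s..r, v' τ) :
    ρ t • v t = ρ s • v s + ∫ τ in s..t, (ρ' τ • v τ + ρ τ • v' τ) := by
  have hu : uIcc s t = Icc s t := uIcc_of_le hst
  have hρ'i : IntervalIntegrable ρ' volume s t := ContinuousOn.intervalIntegrable (by rwa [hu])
  have hρc := continuousOn_of_primitive hst hρ'i hρ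
  have hvc := continuousOn_of_primitive hst hv' hv
  obtain ⟨C, hC⟩ := isCompact_Icc.exists_bound_of_continuousOn hρc
  obtain ⟨C', hC'⟩ := isCompact_Icc.exists_bound_of_continuousOn hρ'
  have hs : s ∈ Icc s t := ⟨le_rfl, hst⟩
  have ht : t ∈ Icc s t := ⟨hst, le_rfl⟩
  have hC0 : 0 ≤ C := (norm_nonneg _).trans (hC s hs)
  have hC'0 : 0 ≤ C' := (norm_nonneg _).trans (hC' s hs)
  -- Approximate `v'` in `L^1` by a continuous `c'`; the primitive `c` then obeys the classical
  -- product rule and is uniformly close to `v`. The constant `K` below adds up the boundary term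
  -- and the two integral terms of the error.
  refine eq_of_forall_dist_le fun ε hε => ?_
  set K : ℝ := 2 * C + C' * (t - s) + 1 with hK
  have hK0 : 0 < K := by
    have := mul_nonneg hC'0 (sub_nonneg.2 hst); positivity
  obtain ⟨c', hc', -, hd⟩ := exists_continuous_integral_norm_sub_le hst hv' (div_pos hε hK0)
  set η := ε / K with hη
  have hη0 : 0 < η := div_pos hε hK0
  set c : ℝ → X := fun r => v s + ∫ τ in s..r, c' τ with hcdef
  have hcd : ∀ r, HasDerivAt c (c' r) r := fun r =>
    (intervalIntegral.integral_hasDerivAt_right (hc'.intervalIntegrable _ _)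
      (hc'.stronglyMeasurableAtFilter _ _) hc'.continuousAt).const_add _
  have hcc : Continuous c := continuous_iff_continuousAt.2 fun r => (hcd r).continuousAt
  have hcs : c s = v s := by simp [hcdef]
  -- the identity for the smooth function
  have hid : ρ t • c t = ρ s • c s + ∫ τ in s..t, (ρ' τ • c τ + ρ τ • c' τ) := by
    have hder : ∀ r ∈ Ioo s t, HasDerivAt (fun r => ρ r • c r) (ρ' r • c r + ρ r • c' r) r := by
      intro r hr
      have h1 : HasDerivAt (fun y => ρ s + ∫ τ in s..y, ρ' τ) (ρ' r) r := by
        refine (intervalIntegral.integral_hasDerivAt_right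
          (hρ'i.mono_Icc hs (Ioo_subset_Icc_self hr)) ?_ ?_).const_add _
        · exact hρ'.stronglyMeasurableAtFilter_nhdsWithin measurableSet_Icc r |>.filter_mono
            (by rw [nhdsWithin_eq_nhds.2 (Icc_mem_nhds hr.1 hr.2)])
        · exact hρ'.continuousAt (Icc_mem_nhds hr.1 hr.2)
      have h2 : HasDerivAt ρ (ρ' r) r := by
        refine h1.congr_of_eventuallyEq ?_
        filter_upwards [Icc_mem_nhds hr.1 hr.2] with y hy using hρ y hy
      have := h2.smul (hcd r)
      rwa [add_comm] at this
    have := intervalIntegral.integral_eq_sub_of_hasDerivAt_of_le hst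
      (hρc.smul hcc.continuousOn) hder
      (ContinuousOn.intervalIntegrable (by
        rw [hu]; exact (hρ'.smul hcc.continuousOn).add (hρc.smul hc'.continuousOn)))
    rw [this]
    simp
  have hdiffi : IntervalIntegrable (fun τ => v' τ - c' τ) volume s t :=
    hv'.sub (hc'.intervalIntegrable _ _)
  have hvcd : ∀ r ∈ Icc s t, ‖v r - c r‖ ≤ η := by
    intro r hr
    have : v r - c r = ∫ τ in s..r, (v' τ - c' τ) := by
      rw [intervalIntegral.integral_sub (hv'.mono_Icc hs hr) (hc'.intervalIntegrable _ _), hv r hr]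
      simp [hcdef]
    rw [this]
    refine (intervalIntegral.norm_integral_le_integral_norm hr.1).trans (le_trans ?_ hd)
    exact intervalIntegral.integral_mono_interval le_rfl hr.1 hr.2
      (Eventually.of_forall fun _ => norm_nonneg _) hdiffi.norm
  have hint1 : IntervalIntegrable (fun τ => ρ' τ • v τ + ρ τ • v' τ) volume s t :=
    (ContinuousOn.intervalIntegrable (by rw [hu]; exact hρ'.smul hvc)).add
      (hv'.continuousOn_smul_Icc hst hρc)
  have hint2 : IntervalIntegrable (fun τ => ρ' τ • c τ + ρ τ • c' τ) volume s t :=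
    ContinuousOn.intervalIntegrable (by
        rw [hu]; exact (hρ'.smul hcc.continuousOn).add (hρc.smul hc'.continuousOn))
  have hE : ρ t • v t - (ρ s • v s + ∫ τ in s..t, (ρ' τ • v τ + ρ τ • v' τ)) =
      ρ t • (v t - c t) - ∫ τ in s..t, (ρ' τ • (v τ - c τ) + ρ τ • (v' τ - c' τ)) := by
    have : ∫ τ in s..t, (ρ' τ • (v τ - c τ) + ρ τ • (v' τ - c' τ)) =
        (∫ τ in s..t, (ρ' τ • v τ + ρ τ • v' τ)) - ∫ τ in s..t, (ρ' τ • c τ + ρ τ • c' τ) := by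
      rw [← intervalIntegral.integral_sub hint1 hint2]
      refine intervalIntegral.integral_congr fun τ _ => ?_
      simp only [smul_sub]; abel
    rw [this, smul_sub, hid, hcs]; abel
  rw [dist_eq_norm, hE]
  have hb : ‖∫ τ in s..t, (ρ' τ • (v τ - c τ) + ρ τ • (v' τ - c' τ))‖ ≤
      ∫ τ in s..t, (C' * η + C * ‖v' τ - c' τ‖) := by
    refine intervalIntegral.norm_integral_le_of_norm_le hst ?_
      (intervalIntegrable_const.add (hdiffi.norm.const_mul C))
    refine Eventually.of_forall fun τ hτ => ?_
    have hτ' := Ioc_subset_Icc_self hτ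
    refine (norm_add_le _ _).trans (add_le_add ?_ ?_)
    · rw [norm_smul]; exact mul_le_mul (hC' τ hτ') (hvcd τ hτ') (norm_nonneg _) hC'0
    · rw [norm_smul]; exact mul_le_mul_of_nonneg_right (hC τ hτ') (norm_nonneg _)
  rw [intervalIntegral.integral_add intervalIntegrable_const (hdiffi.norm.const_mul C),
    intervalIntegral.integral_const_mul C, intervalIntegral.integral_const, smul_eq_mul] at hb
  have h3 : ‖ρ t • (v t - c t)‖ ≤ C * η := by
    rw [norm_smul]; exact mul_le_mul (hC t ht) (hvcd t ht) (norm_nonneg _) hC0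
  have h4 : C * ∫ τ in s..t, ‖v' τ - c' τ‖ ≤ C * η := mul_le_mul_of_nonneg_left hd hC0
  calc _ ≤ C * η + ((t - s) * (C' * η) + C * η) := by
        refine (norm_sub_le _ _).trans ?_; linarith
    _ ≤ K * η := by rw [hK]; nlinarith
    _ = ε := by rw [hη]; field_simp

theorem exp_primitive (β s r : ℝ) :
    Real.exp (β * (r - s)) = Real.exp (β * (s - s)) + ∫ τ in s..r, β * Real.exp (β * (τ - s)) := by
  rw [intervalIntegral.integral_eq_sub_of_hasDerivAt (f := fun τ => Real.exp (β * (τ - s)))]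
  · ring
  · intro x _
    have := (((hasDerivAt_id x).sub_const s).const_mul β).exp
    simpa [mul_comm] using this
  · exact Continuous.intervalIntegrable (by fun_prop) _ _

/-- Strong continuity handles the fixed vector `g t`, and the uniform operator bound handles the
difference `g τ - g t`. -/
theorem ContinuousOn.apply_of_strongly_continuous {α 𝕜 E F : Type*} [TopologicalSpace α]
    [NontriviallyNormedField 𝕜] [NormedAddCommGroup E] [NormedSpace 𝕜 E]
    [NormedAddCommGroup F] [NormedSpace 𝕜 F] {K : α → E →L[𝕜] F} {g : α → E} {S : Set α} {C : ℝ}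
    (hK : ∀ x, ContinuousOn (fun t => K t x) S) (hC : ∀ t ∈ S, ‖K t‖ ≤ C)
    (hg : ContinuousOn g S) : ContinuousOn (fun t => K t (g t)) S := by
  intro t ht
  have h1 : Tendsto (fun τ => K τ (g t) + K τ (g τ - g t)) (𝓝[S] t) (𝓝 (K t (g t) + 0)) := by
    refine Filter.Tendsto.add (hK (g t) t ht) (squeeze_zero_norm' (a := fun τ => C * ‖g τ - g t‖) ?_ ?_)
    · filter_upwards [self_mem_nhdsWithin] with τ hτ
      exact (K τ).le_of_opNorm_le (hC τ hτ) _
    · have h2 : Tendsto (fun τ => C * ‖g τ - g t‖) (𝓝[S] t) (𝓝 (C * ‖g t - g t‖)) :=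
        (Filter.Tendsto.sub (hg t ht) tendsto_const_nhds).norm.const_mul C
      simpa using h2
  rw [add_zero] at h1
  refine h1.congr fun τ => ?_
  rw [map_sub]; abel

theorem integral_pow_div_factorial (β s r : ℝ) (k : ℕ) :
    ∫ τ in s..r, β * ((β * (τ - s)) ^ k / k.factorial) =
      (β * (r - s)) ^ (k + 1) / (k + 1).factorial := by
  rw [intervalIntegral.integral_eq_sub_of_hasDerivAt
    (f := fun τ => (β * (τ - s)) ^ (k + 1) / (k + 1).factorial)]
  · simp
  · intro x _
    have := ((((hasDerivAt_id x).sub_const s).const_mul β).pow (k + 1)).div_const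
      ((k + 1).factorial : ℝ)
    refine this.congr_deriv ?_
    have hk : (k.factorial : ℝ) ≠ 0 := by positivity
    rw [Nat.factorial_succ]
    push_cast
    simp
    field_simp
  · exact Continuous.intervalIntegrable (by fun_prop) _ _

/-- The left side is the solution of `Φ' = βΦ + Mκ`, `Φ(s) = Mc`. In integrated form this makes it
the fixed point of the scalar Volterra iteration in `norm_le_of_ordered_products`. -/
theorem exp_integral_eq {s t β M c : ℝ} {κ : ℝ → ℝ} (hst : s ≤ t)
    (hκ : IntervalIntegrable κ volume s t) :
    M * Real.exp (β * (t - s)) * (c + ∫ τ in s..t, Real.exp (-β * (τ - s)) * κ τ) =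
      M * c + ∫ τ in s..t, (β * (M * Real.exp (β * (τ - s)) *
        (c + ∫ σ in s..τ, Real.exp (-β * (σ - s)) * κ σ)) + M * κ τ) := by
  have h := smul_eq_add_integral_of_primitive (X := ℝ) hst
    (ρ := fun r => Real.exp (β * (r - s))) (ρ' := fun r => β * Real.exp (β * (r - s)))
    (v := fun r => M * (c + ∫ τ in s..r, Real.exp (-β * (τ - s)) * κ τ))
    (v' := fun r => M * (Real.exp (-β * (r - s)) * κ r))
    (by fun_prop) (fun r _ => exp_primitive β s r)
    ((hκ.continuousOn_smul_Icc hst (ρ := fun τ => Real.exp (-β * (τ - s)))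
      (by fun_prop)).const_mul M) (fun r _ => by
        rw [intervalIntegral.integral_const_mul]; simp [mul_add])
  simp only [smul_eq_mul, sub_self, mul_zero, Real.exp_zero, intervalIntegral.integral_same,
    add_zero, one_mul] at h
  have h2 : M * Real.exp (β * (t - s)) * (c + ∫ τ in s..t, Real.exp (-β * (τ - s)) * κ τ) =
      Real.exp (β * (t - s)) * (M * (c + ∫ τ in s..t, Real.exp (-β * (τ - s)) * κ τ)) := by ring
  rw [h2, h]
  congr 1
  refine intervalIntegral.integral_congr fun τ _ => ?_
  have h3 : Real.exp (β * (τ - s)) * Real.exp (-β * (τ - s)) = 1 := by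
    rw [← Real.exp_add]; simp
  linear_combination (M * κ τ) * h3

end Calculus

/-! ### Volterra iteration with time-ordered products. -/

section OrderedProducts

variable {𝕜 : Type*} [RCLike 𝕜] {X : Type*} [NormedAddCommGroup X] [NormedSpace 𝕜 X]
  [NormedSpace ℝ X] [IsScalarTower ℝ 𝕜 X] [CompleteSpace X]

theorem clm_integral_comm (L : X →L[𝕜] X) {s t : ℝ} {f : ℝ → X}
    (hf : IntervalIntegrable f volume s t) : L (∫ τ in s..t, f τ) = ∫ τ in s..t, L (f τ) :=
  ((L.restrictScalars ℝ).intervalIntegral_comp_comm hf).symm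

/-- If time-ordered products of the operators `B τ` are bounded by `M * β ^ k`, then solutions of
`v' = B v + κ` grow at most like `M * exp (β (t - s))`. -/
theorem norm_le_of_ordered_products {s t M β : ℝ} (hst : s ≤ t) (hβ : 0 ≤ β)
    {B : ℝ → X →L[𝕜] X}
    (hB : ∀ ts : List ℝ, ts.Pairwise (· ≥ ·) → (∀ r ∈ ts, r ∈ Icc s t) →
      ‖(ts.map B).prod‖ ≤ M * β ^ ts.length)
    (hBc : ∀ x, ContinuousOn (fun r => B r x) (Icc s t)) {v κ : ℝ → X}
    (hκ : IntervalIntegrable κ volume s t) (hvc : ContinuousOn v (Icc s t))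
    (hv : ∀ r ∈ Icc s t, v r = v s + ∫ τ in s..r, (B τ (v τ) + κ τ)) :
    ‖v t‖ ≤ M * Real.exp (β * (t - s)) *
      (‖v s‖ + ∫ τ in s..t, Real.exp (-β * (τ - s)) * ‖κ τ‖) := by
  have hM : 0 ≤ M := by
    have := (norm_nonneg _).trans (hB [] List.Pairwise.nil (by simp))
    simpa using this
  have hs : s ∈ Icc s t := ⟨le_rfl, hst⟩
  have ht : t ∈ Icc s t := ⟨hst, le_rfl⟩
  obtain ⟨C, hC⟩ := isCompact_Icc.exists_bound_of_continuousOn hvc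
  have hC0 : 0 ≤ C := (norm_nonneg _).trans (hC s hs)
  have hB1 : ∀ r ∈ Icc s t, ‖B r‖ ≤ M * β := fun r hr => by
    simpa using hB [r] (List.pairwise_singleton _ _) (by simpa using hr)
  have hBv : ContinuousOn (fun r => B r (v r)) (Icc s t) := ContinuousOn.apply_of_strongly_continuous hBc hB1 hvc
  set Φ : ℝ → ℝ := fun r => M * Real.exp (β * (r - s)) *
      (‖v s‖ + ∫ τ in s..r, Real.exp (-β * (τ - s)) * ‖κ τ‖) with hΦ
  have hκe : IntervalIntegrable (fun τ => Real.exp (-β * (τ - s)) * ‖κ τ‖) volume s t :=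
    hκ.norm.continuousOn_smul_Icc hst (ρ := fun τ => Real.exp (-β * (τ - s))) (by fun_prop)
  have hΦc : ContinuousOn Φ (Icc s t) := by
    have h1 : ContinuousOn (fun r => ∫ τ in s..r, Real.exp (-β * (τ - s)) * ‖κ τ‖) (Icc s t) :=
      continuousOn_of_primitive hst hκe (fun r _ => by simp)
    have h2 : ContinuousOn (fun r => M * Real.exp (β * (r - s))) (Icc s t) := by fun_prop
    exact h2.mul (continuousOn_const.add h1)
  have hΦ0 : ∀ r ∈ Icc s t, 0 ≤ Φ r := by
    intro r hr
    refine mul_nonneg (by positivity) (add_nonneg (norm_nonneg _) ?_)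
    exact intervalIntegral.integral_nonneg hr.1 fun _ _ => by positivity
  -- The induction carries a whole ordered product `L` in front of `v r`, with times later than `r`.
  -- Each integration appends one `B τ`, `τ ≤ r`, at the right end of the list, so the order is kept
  -- and the constant `M` enters once instead of once per iteration. The term with `k!` is the
  -- remainder after `k` iterations.
  have hP : ∀ k : ℕ, ∀ r ∈ Icc s t, ∀ ts : List ℝ, ts.Pairwise (· ≥ ·) →
      (∀ q ∈ ts, q ∈ Icc r t) → ‖(ts.map B).prod (v r)‖ ≤
        β ^ ts.length * (Φ r + M * C * ((β * (r - s)) ^ k / k.factorial)) := by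
    intro k
    induction k with
    | zero =>
      intro r hr ts hts hmem
      have h1 := hB ts hts fun q hq => Icc_subset_Icc_left hr.1 (hmem q hq)
      calc _ ≤ M * β ^ ts.length * C :=
            ((ts.map B).prod.le_opNorm _).trans
              (mul_le_mul h1 (hC r hr) (norm_nonneg _) (by positivity))
        _ = β ^ ts.length * (M * C) := by ring
        _ ≤ _ := by
          refine mul_le_mul_of_nonneg_left ?_ (by positivity)
          have := hΦ0 r hr
          simp; linarith
    | succ k ih =>
      intro r hr ts hts hmem
      have hr' : Icc s r ⊆ Icc s t := Icc_subset_Icc_right hr.2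
      set L := (ts.map B).prod with hL
      have hLn : ‖L‖ ≤ M * β ^ ts.length :=
        hB ts hts fun q hq => Icc_subset_Icc_left hr.1 (hmem q hq)
      have hi1 : IntervalIntegrable (fun τ => B τ (v τ)) volume s r :=
        ContinuousOn.intervalIntegrable (by rw [uIcc_of_le hr.1]; exact hBv.mono hr')
      have hi2 : IntervalIntegrable κ volume s r := hκ.mono_Icc hs hr
      have hcb : ContinuousOn (fun τ => β * (Φ τ + M * C * ((β * (τ - s)) ^ k / k.factorial)))
          (Icc s r) := by
        refine continuousOn_const.mul ((hΦc.mono hr').add ?_)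
        fun_prop
      have hi3 : IntervalIntegrable
          (fun τ => β * (Φ τ + M * C * ((β * (τ - s)) ^ k / k.factorial))) volume s r :=
        ContinuousOn.intervalIntegrable (by rwa [uIcc_of_le hr.1])
      have e1 : L (v r) = L (v s) + ∫ τ in s..r, L (B τ (v τ) + κ τ) := by
        rw [hv r hr, map_add, clm_integral_comm L (hi1.add hi2)]
      have hb : ‖∫ τ in s..r, L (B τ (v τ) + κ τ)‖ ≤ ∫ τ in s..r, β ^ ts.length *
          (β * (Φ τ + M * C * ((β * (τ - s)) ^ k / k.factorial)) + M * ‖κ τ‖) := by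
        refine intervalIntegral.norm_integral_le_of_norm_le hr.1 (Eventually.of_forall ?_)
          ((hi3.add (hi2.norm.const_mul M)).const_mul _)
        intro τ hτ
        have hτ' : τ ∈ Icc s t := hr' (Ioc_subset_Icc_self hτ)
        have h1 := ih τ hτ' (ts ++ [τ]) (by
            rw [List.pairwise_append]
            refine ⟨hts, List.pairwise_singleton _ _, ?_⟩
            intro q hq q' hq'
            rw [List.mem_singleton.1 hq']
            exact hτ.2.trans (hmem q hq).1) (by
            intro q hq
            rcases List.mem_append.1 hq with hq | hq
            · exact ⟨hτ.2.trans (hmem q hq).1, (hmem q hq).2⟩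
            · rw [List.mem_singleton.1 hq]; exact ⟨le_rfl, hτ'.2⟩)
        simp only [List.map_append, List.prod_append, List.map_singleton, List.prod_singleton,
          List.length_append, List.length_singleton, mul_apply_eq_comp] at h1
        rw [map_add]
        refine (norm_add_le _ _).trans ?_
        have h2 := L.le_of_opNorm_le hLn (κ τ)
        calc _ ≤ _ := add_le_add h1 h2
          _ = _ := by ring
      have hint : ∫ τ in s..r, β ^ ts.length *
          (β * (Φ τ + M * C * ((β * (τ - s)) ^ k / k.factorial)) + M * ‖κ τ‖) =
          β ^ ts.length * ((Φ r - M * ‖v s‖) +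
            M * C * ((β * (r - s)) ^ (k + 1) / (k + 1).factorial)) := by
        rw [intervalIntegral.integral_const_mul]
        congr 1
        have hΦr : Φ r = M * ‖v s‖ + ∫ τ in s..r, (β * Φ τ + M * ‖κ τ‖) :=
          exp_integral_eq hr.1 hi2.norm
        rw [hΦr, ← integral_pow_div_factorial, ← intervalIntegral.integral_const_mul,
          add_sub_cancel_left, ← intervalIntegral.integral_add]
        · refine intervalIntegral.integral_congr fun τ _ => ?_
          ring
        · refine IntervalIntegrable.add (ContinuousOn.intervalIntegrable ?_) (hi2.norm.const_mul M)
          rw [uIcc_of_le hr.1]; exact continuousOn_const.mul (hΦc.mono hr')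
        · exact Continuous.intervalIntegrable (by fun_prop) _ _
      rw [hint] at hb
      rw [e1]
      have h5 := L.le_of_opNorm_le hLn (v s)
      calc _ ≤ _ := norm_add_le _ _
        _ ≤ _ := add_le_add h5 hb
        _ = _ := by ring
  have hlim : Tendsto (fun k : ℕ => Φ t + M * C * ((β * (t - s)) ^ k / k.factorial)) atTop
      (𝓝 (Φ t + M * C * 0)) :=
    tendsto_const_nhds.add ((FloorSemiring.tendsto_pow_div_factorial_atTop _).const_mul _)
  rw [mul_zero, add_zero] at hlim
  refine ge_of_tendsto' hlim fun k => ?_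
  simpa using hP k t ht [] List.Pairwise.nil (by simp)

end OrderedProducts

/-! ### Young's inequality for moving averages. -/

section Young

/-- Moving averages over an interval of length `σ` are bounded by `σ` on `L^p`. -/
theorem eLpNorm_movingIntegral_le {p : ℝ≥0∞} (hp : 1 ≤ p) {φ : ℝ → ℝ}
    (hφ : AEStronglyMeasurable φ volume) {σ : ℝ} {F : ℝ → ℝ} {μ : Measure ℝ}
    (hμ : μ ≤ volume)
    (hF : ∀ᵐ t ∂μ, ‖F t‖ₑ ≤ ∫⁻ τ in Ioc (t - σ) t, ‖φ τ‖ₑ) :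
    eLpNorm F p μ ≤ ENNReal.ofReal σ * eLpNorm φ p volume := by
  have hvol : ∀ t : ℝ, volume (Ioc (t - σ) t) = ENNReal.ofReal σ := fun t => by simp
  by_cases hpt : p = ∞
  · subst hpt
    rw [eLpNorm_exponent_top, eLpNorm_exponent_top]
    refine eLpNormEssSup_le_of_ae_enorm_bound ?_
    filter_upwards [hF] with t ht
    refine ht.trans ?_
    calc ∫⁻ τ in Ioc (t - σ) t, ‖φ τ‖ₑ ≤ ∫⁻ τ in Ioc (t - σ) t, eLpNormEssSup φ volume :=
          lintegral_mono_ae (ae_restrict_of_ae (enorm_ae_le_eLpNormEssSup φ volume))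
      _ = _ := by rw [setLIntegral_const, hvol, mul_comm]
  have hp0 : p ≠ 0 := (zero_lt_one.trans_le hp).ne'
  have hpr : 1 ≤ p.toReal := by
    rw [← ENNReal.toReal_one]; exact ENNReal.toReal_mono hpt hp
  have hpr0 : 0 < p.toReal := zero_lt_one.trans_le hpr
  -- Jensen
  have hJ : ∀ t : ℝ, (∫⁻ τ in Ioc (t - σ) t, ‖φ τ‖ₑ) ^ p.toReal ≤
      ENNReal.ofReal σ ^ (p.toReal - 1) * ∫⁻ τ in Ioc (t - σ) t, ‖φ τ‖ₑ ^ p.toReal := by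
    intro t
    have h1 := eLpNorm_le_eLpNorm_mul_rpow_measure_univ (μ := volume.restrict (Ioc (t - σ) t)) hp
      hφ.restrict
    rw [eLpNorm_one_eq_lintegral_enorm, eLpNorm_eq_lintegral_rpow_enorm_toReal hp0 hpt,
      Measure.restrict_apply_univ, hvol] at h1
    have h2 := ENNReal.rpow_le_rpow h1 hpr0.le
    rw [ENNReal.mul_rpow_of_nonneg _ _ hpr0.le, ← ENNReal.rpow_mul, ← ENNReal.rpow_mul,
      one_div_mul_cancel hpr0.ne', ENNReal.rpow_one] at h2
    refine h2.trans_eq ?_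
    rw [mul_comm]
    congr 2
    simp
    field_simp
  have hmeas : AEMeasurable (fun τ => ‖φ τ‖ₑ ^ p.toReal) volume := hφ.enorm.pow_const _
  -- Tonelli
  have hT : ∫⁻ t, ∫⁻ τ in Ioc (t - σ) t, ‖φ τ‖ₑ ^ p.toReal =
      ENNReal.ofReal σ * ∫⁻ τ, ‖φ τ‖ₑ ^ p.toReal := by
    have h1 : ∀ t : ℝ, ∫⁻ τ in Ioc (t - σ) t, ‖φ τ‖ₑ ^ p.toReal =
        ∫⁻ τ, (Ico τ (τ + σ)).indicator (fun _ => ‖φ τ‖ₑ ^ p.toReal) t := by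
      intro t
      rw [← lintegral_indicator measurableSet_Ioc]
      refine lintegral_congr fun τ => ?_
      by_cases h : τ ∈ Ioc (t - σ) t
      · have : t ∈ Ico τ (τ + σ) := ⟨h.2, by linarith [h.1]⟩
        simp only [indicator_of_mem h, indicator_of_mem this]
      · have : t ∉ Ico τ (τ + σ) := fun h' => h ⟨by linarith [h'.2], h'.1⟩
        simp only [indicator_of_notMem h, indicator_of_notMem this]
    simp_rw [h1]
    rw [lintegral_lintegral_swap]
    · rw [← lintegral_const_mul'' _ hmeas]
      refine lintegral_congr fun τ => ?_
      rw [lintegral_indicator measurableSet_Ico, setLIntegral_const]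
      simp [mul_comm]
    · have : (Function.uncurry fun t τ => (Ico τ (τ + σ)).indicator
          (fun _ => ‖φ τ‖ₑ ^ p.toReal) t) =
          {q : ℝ × ℝ | q.2 ≤ q.1 ∧ q.1 < q.2 + σ}.indicator (fun q => ‖φ q.2‖ₑ ^ p.toReal) := by
        ext ⟨t, τ⟩
        by_cases h : t ∈ Ico τ (τ + σ)
        · have h' : ((t, τ) : ℝ × ℝ) ∈ {q : ℝ × ℝ | q.2 ≤ q.1 ∧ q.1 < q.2 + σ} := h
          simp only [Function.uncurry_apply_pair, indicator_of_mem h, indicator_of_mem h']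
        · have h' : ((t, τ) : ℝ × ℝ) ∉ {q : ℝ × ℝ | q.2 ≤ q.1 ∧ q.1 < q.2 + σ} := h
          simp only [Function.uncurry_apply_pair, indicator_of_notMem h, indicator_of_notMem h']
      rw [this]
      refine AEMeasurable.indicator ?_ ?_
      · exact hmeas.comp_quasiMeasurePreserving Measure.quasiMeasurePreserving_snd
      · exact (measurableSet_le measurable_snd measurable_fst).inter
          (measurableSet_lt measurable_fst (measurable_snd.add_const _))
  rw [eLpNorm_eq_lintegral_rpow_enorm_toReal hp0 hpt, eLpNorm_eq_lintegral_rpow_enorm_toReal hp0 hpt]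
  have hmain : ∫⁻ t, ‖F t‖ₑ ^ p.toReal ∂μ ≤
      ENNReal.ofReal σ ^ p.toReal * ∫⁻ τ, ‖φ τ‖ₑ ^ p.toReal := by
    calc ∫⁻ t, ‖F t‖ₑ ^ p.toReal ∂μ
        ≤ ∫⁻ t, (ENNReal.ofReal σ ^ (p.toReal - 1) *
            ∫⁻ τ in Ioc (t - σ) t, ‖φ τ‖ₑ ^ p.toReal) ∂μ := by
          refine lintegral_mono_ae ?_
          filter_upwards [hF] with t ht
          exact (ENNReal.rpow_le_rpow ht hpr0.le).trans (hJ t)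
      _ ≤ ∫⁻ t, (ENNReal.ofReal σ ^ (p.toReal - 1) *
            ∫⁻ τ in Ioc (t - σ) t, ‖φ τ‖ₑ ^ p.toReal) := lintegral_mono' hμ le_rfl
      _ = ENNReal.ofReal σ ^ (p.toReal - 1) * (ENNReal.ofReal σ * ∫⁻ τ, ‖φ τ‖ₑ ^ p.toReal) := by
          rw [lintegral_const_mul', hT]
          exact ENNReal.rpow_ne_top_of_nonneg (by linarith) ENNReal.ofReal_ne_top
      _ = _ := by
          rw [← mul_assoc]
          congr 1
          nth_rw 2 [← ENNReal.rpow_one (ENNReal.ofReal σ)]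
          rw [← ENNReal.rpow_add_of_nonneg _ _ (by linarith) zero_le_one]
          simp
  calc _ ≤ (ENNReal.ofReal σ ^ p.toReal * ∫⁻ τ, ‖φ τ‖ₑ ^ p.toReal) ^ (1 / p.toReal) :=
        ENNReal.rpow_le_rpow hmain (by positivity)
    _ = _ := by
        rw [ENNReal.mul_rpow_of_nonneg _ _ (by positivity), ← ENNReal.rpow_mul,
          mul_one_div_cancel hpr0.ne', ENNReal.rpow_one]

end Young

/-! ### Hölder estimates on intervals with uniform constants. -/

section Hoelder

variable {X : Type*} [NormedAddCommGroup X]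

/-- On a bounded interval the `L^1`-norm is dominated by the `L^p`-norm. -/
theorem exists_integral_norm_le_eLpNorm {p : ℝ≥0∞} (hp : 1 ≤ p) (ℓ : ℝ) :
    ∃ C : ℝ, 0 < C ∧ ∀ s t : ℝ, s ≤ t → t - s ≤ ℓ → ∀ f : ℝ → X,
      MemLp f p (volume.restrict (Icc s t)) →
      ∫ τ in s..t, ‖f τ‖ ≤ C * (eLpNorm f p (volume.restrict (Icc s t))).toReal := by
  -- For `p = ∞` the convention `∞.toReal = 0` makes the exponent `1`, which is the correct value.
  -- The base `1 + max ℓ 0` is positive and dominates `t - s`.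
  refine ⟨(1 + max ℓ 0) ^ (1 - 1 / p.toReal) , by positivity, fun s t hst hl f hf => ?_⟩
  have h1 := eLpNorm_le_eLpNorm_mul_rpow_measure_univ (μ := volume.restrict (Icc s t)) hp hf.1
  have hp1 : 0 ≤ 1 - 1 / p.toReal := by
    by_cases hpt : p = ∞
    · simp [hpt]
    have hpr : 1 ≤ p.toReal := by
      rw [← ENNReal.toReal_one]; exact ENNReal.toReal_mono hpt hp
    rw [sub_nonneg, div_le_one (by linarith)]; exact hpr
  have hint : IntegrableOn f (Icc s t) := by
    have : IsFiniteMeasure (volume.restrict (Icc s t)) := ⟨by simp⟩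
    exact hf.integrable hp
  rw [eLpNorm_one_eq_lintegral_enorm] at h1
  rw [intervalIntegral.integral_of_le hst, ← integral_Icc_eq_integral_Ioc,
    integral_norm_eq_lintegral_enorm hf.1]
  have h2 := ENNReal.toReal_mono (ENNReal.mul_ne_top hf.2.ne
    (ENNReal.rpow_ne_top_of_nonneg (by simpa using hp1) (by simp))) h1
  refine h2.trans ?_
  rw [ENNReal.toReal_mul, mul_comm, ← ENNReal.toReal_rpow, Measure.restrict_apply_univ]
  refine mul_le_mul_of_nonneg_right ?_ ENNReal.toReal_nonneg
  simp only [ENNReal.toReal_one, div_one, Real.volume_Icc]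
  refine Real.rpow_le_rpow ENNReal.toReal_nonneg ?_ (by simpa using hp1)
  rw [ENNReal.toReal_ofReal (by linarith)]
  linarith [le_max_left ℓ 0]

/-- Hölder's inequality with an exponential weight. -/
theorem exists_integral_exp_mul_norm_le {p : ℝ≥0∞} (hp : 1 ≤ p) {δ : ℝ} (hδ : 0 < δ) :
    ∃ C : ℝ, 0 < C ∧ ∀ s t : ℝ, s ≤ t → ∀ f : ℝ → X,
      MemLp f p (volume.restrict (Icc s t)) →
      ∫ τ in s..t, Real.exp (-δ * (t - τ)) * ‖f τ‖ ≤
        C * (eLpNorm f p (volume.restrict (Icc s t))).toReal := by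
  set q := ENNReal.conjExponent p with hq
  have hpq : ENNReal.HolderConjugate p q := ENNReal.HolderConjugate.conjExponent hp
  have hW : MemLp (fun τ : ℝ => Real.exp (δ * τ)) q (volume.restrict (Iic 0)) := by
    have hb : MemLp (fun τ : ℝ => Real.exp (δ * τ)) ∞ (volume.restrict (Iic 0)) := by
      refine memLp_top_of_bound (by fun_prop) 1 ?_
      filter_upwards [ae_restrict_mem measurableSet_Iic] with τ hτ
      rw [Real.norm_eq_abs, Real.abs_exp]
      exact Real.exp_le_one_iff.2 (mul_nonpos_of_nonneg_of_nonpos hδ.le hτ)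
    by_cases hqt : q = ∞
    · rwa [hqt]
    have hq0 : q ≠ 0 := ENNReal.HolderConjugate.ne_zero q p
    rw [← integrable_norm_rpow_iff hb.1 hq0 hqt]
    have := integrableOn_exp_mul_Iic (mul_pos hδ (ENNReal.toReal_pos hq0 hqt)) 0
    refine this.congr (Eventually.of_forall fun τ => ?_)
    simp only [Real.norm_eq_abs, Real.abs_exp]
    rw [← Real.exp_mul]; congr 1; ring
  set C := (eLpNorm (fun τ : ℝ => Real.exp (δ * τ)) q (volume.restrict (Iic 0))).toReal with hC
  refine ⟨C + 1, by positivity, fun s t hst f hf => ?_⟩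
  -- By translation invariance the `L^q`-norm of the weight on `[s, t]` is at most its norm on `(-∞,
  -- 0]`. The constant is therefore independent of `s` and `t`; adding `1` makes it positive.
  have hmp : MeasurePreserving (fun τ : ℝ => τ - t) (volume.restrict (Iic t))
      (volume.restrict (Iic 0)) := by
    have := (measurePreserving_sub_right volume t).restrict_preimage (s := Iic 0) measurableSet_Iic
    simpa using this
  have hWt : eLpNorm (fun τ : ℝ => Real.exp (-δ * (t - τ))) q (volume.restrict (Icc s t)) ≤
      eLpNorm (fun τ : ℝ => Real.exp (δ * τ)) q (volume.restrict (Iic 0)) := by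
    rw [← eLpNorm_comp_measurePreserving hW.1 hmp]
    refine le_trans (le_of_eq ?_)
      (eLpNorm_mono_measure _ (Measure.restrict_mono (Icc_subset_Iic_self (a := s)) le_rfl))
    congr 1
    ext τ; simp only [Function.comp]; congr 1; ring
  have h1 := eLpNorm_smul_le_mul_eLpNorm (μ := volume.restrict (Icc s t)) (p := q) (q := p) (r := 1)
    (f := fun τ => ‖f τ‖) (φ := fun τ => Real.exp (-δ * (t - τ))) hf.1.norm (by fun_prop)
    (hpqr := hpq.symm)
  have h2 := (h1.trans (mul_le_mul_left hWt _))
  rw [eLpNorm_one_eq_lintegral_enorm, eLpNorm_norm] at h2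
  have hmeas : AEStronglyMeasurable (fun τ => Real.exp (-δ * (t - τ)) * ‖f τ‖)
      (volume.restrict (Icc s t)) := AEStronglyMeasurable.mul (by fun_prop) hf.1.norm
  have h3 := ENNReal.toReal_mono (ENNReal.mul_ne_top hW.2.ne hf.2.ne) h2
  rw [ENNReal.toReal_mul, ← hC] at h3
  rw [intervalIntegral.integral_of_le hst, ← integral_Icc_eq_integral_Ioc]
  calc _ ≤ ∫ τ in Icc s t, ‖Real.exp (-δ * (t - τ)) * ‖f τ‖‖ := by
        refine integral_mono_of_nonneg (Eventually.of_forall fun τ => by positivity) ?_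
          (Eventually.of_forall fun τ => le_abs_self _)
        have : MemLp (fun τ => Real.exp (-δ * (t - τ)) * ‖f τ‖) 1 (volume.restrict (Icc s t)) := by
          refine ⟨hmeas, ?_⟩
          rw [eLpNorm_one_eq_lintegral_enorm]
          exact h2.trans_lt (ENNReal.mul_lt_top hW.2 hf.2)
        exact (memLp_one_iff_integrable.1 this).norm
    _ = _ := integral_norm_eq_lintegral_enorm hmeas
    _ ≤ _ := h3
    _ ≤ _ := by
      refine mul_le_mul_of_nonneg_right (by linarith) ENNReal.toReal_nonneg

end Hoelder

/-! ### Resolvents and Kato stability. -/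

namespace EvolutionSemigroup

section Resolvent

variable {𝕜 : Type*} [RCLike 𝕜] {E : Type*} [NormedAddCommGroup E] [NormedSpace 𝕜 E]

theorem resolventOp_spec {B : E →ₗ.[𝕜] E} {l : 𝕜} (h : InResolventSet B l) :
    IsResolventAt B l (resolventOp B l) := by
  rw [resolventOp, dif_pos h]; exact h.choose_spec

theorem resolventOp_apply_of_mem_graph {B : E →ₗ.[𝕜] E} {l : 𝕜} (h : InResolventSet B l) {u g : E}
    (hu : (u, g) ∈ B.graph) : resolventOp B l (l • u - g) = u :=
  (resolventOp_spec h _ _).2 (by simpa using hu)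

theorem resolventOp_mem_graph {B : E →ₗ.[𝕜] E} {l : 𝕜} (h : InResolventSet B l) (x : E) :
    (resolventOp B l x, l • resolventOp B l x - x) ∈ B.graph :=
  (resolventOp_spec h _ _).1 rfl

/-- The difference of two resolvents at `l` in terms of the difference at `m`. -/
theorem resolventOp_sub {B B' : E →ₗ.[𝕜] E} {l m : 𝕜} (hl : InResolventSet B l)
    (hl' : InResolventSet B' l) (hm : InResolventSet B m) (hm' : InResolventSet B' m) (x : E) :
    resolventOp B l x - resolventOp B' l x =
      (resolventOp B m (x + (m - l) • resolventOp B' l x) -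
        resolventOp B' m (x + (m - l) • resolventOp B' l x)) +
      (m - l) • resolventOp B l (resolventOp B m (x + (m - l) • resolventOp B' l x) -
        resolventOp B' m (x + (m - l) • resolventOp B' l x)) := by
  set y := resolventOp B' l x with hy
  -- This is `(m - B') y`, so that `R(m, B') z = y`. For fixed `B'` the vector `z` does not depend
  -- on `B`.
  set z := x + (m - l) • y with hz
  have h1 : resolventOp B' m z = y := by
    have := resolventOp_apply_of_mem_graph hm' (resolventOp_mem_graph hl' x)
    rw [← hy] at this
    rw [← this, hz]; congr 1; module
  set q := resolventOp B m z with hq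
  have h2 : resolventOp B l (z + (l - m) • q) = q := by
    have := resolventOp_apply_of_mem_graph hl (resolventOp_mem_graph hm z)
    rw [← hq] at this
    rwa [show l • q - (m • q - z) = z + (l - m) • q by module] at this
  have h3 : resolventOp B l x = q + (m - l) • resolventOp B l (q - y) := by
    have : x = (z + (l - m) • q) + (m - l) • (q - y) := by rw [hz]; module
    rw [this, map_add, h2, map_smul]
  rw [h1, h3]; abel

variable {I : Set ℝ} {A : ℝ → E →ₗ.[𝕜] E} {M w : ℝ}

theorem IsKatoStable.nonneg (hA : IsKatoStable I A M w) : 0 ≤ M := by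
  have := (norm_nonneg _).trans (hA.bound [] List.Pairwise.nil (by simp) (w + 1) (by linarith))
  simpa using this

theorem IsKatoStable.norm_resolvent_le (hA : IsKatoStable I A M w) {t l : ℝ} (ht : t ∈ I)
    (hl : w < l) : ‖resolventOp (A t) (l : 𝕜)‖ ≤ M * (l - w)⁻¹ := by
  simpa using hA.bound [t] (List.pairwise_singleton _ _) (by simpa using ht) l hl

end Resolvent

/-! ### Intervals that are open to the left, and functions vanishing at infinity. -/

section Interval

variable {X : Type*} [NormedAddCommGroup X]

/-- An interval in which `a` (possibly `-∞`) does not lie and which is closed to the right. -/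
structure IsLeftOpen (I : Set ℝ) : Prop where
  exists_lt : ∀ s ∈ I, ∃ s' ∈ I, s' < s
  isClosed : ∀ m ∈ I, IsClosed (I ∩ Ici m)

theorem isLeftOpen_of_Ioc_or_univ {I : Set ℝ} (hI : (∃ a b : ℝ, a < b ∧ I = Ioc a b) ∨ I = univ) :
    IsLeftOpen I := by
  rcases hI with ⟨a, b, -, rfl⟩ | rfl
  · refine ⟨fun s hs => ⟨(a + s) / 2, ⟨?_, ?_⟩, ?_⟩, fun m hm => ?_⟩
    · linarith [hs.1]
    · linarith [hs.1, hs.2]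
    · linarith [hs.1]
    · have : Ioc a b ∩ Ici m = Icc m b := by
        ext t; constructor
        · exact fun h => ⟨h.2, h.1.2⟩
        · exact fun h => ⟨⟨hm.1.trans_le h.1, h.2⟩, h.1⟩
      rw [this]; exact isClosed_Icc
  · exact ⟨fun s _ => ⟨s - 1, mem_univ _, by linarith⟩, fun m _ => by simpa using isClosed_Ici⟩

variable {I : Set ℝ}

/-- A point to the left of the minimum of `K ∪ {s}` does the job. At such a point a function in
`C_0(I, X)` is small, which replaces a zero initial value at the left end of `I`. -/
theorem IsLeftOpen.exists_notMem_compact (hI : IsLeftOpen I) {K : Set ℝ} (hK : IsCompact K)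
    (hKI : K ⊆ I) {s : ℝ} (hs : s ∈ I) : ∃ s' ∈ I, s' ≤ s ∧ s' ∉ K := by
  obtain ⟨m, hm⟩ := (hK.insert s).exists_isLeast (insert_nonempty _ _)
  obtain ⟨s', hs', hlt⟩ := hI.exists_lt m (by
    rcases hm.1 with h | h
    · rwa [h]
    · exact hKI h)
  exact ⟨s', hs', hlt.le.trans (hm.2 (mem_insert _ _)), fun h =>
    absurd (hm.2 (mem_insert_of_mem _ h)) (not_le.2 hlt)⟩

theorem IsLeftOpen.isCompact (hI : IsLeftOpen I) {m : ℝ} (hm : m ∈ I) (e : ℝ) :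
    IsCompact (I ∩ Icc m e) := by
  have : I ∩ Icc m e = (I ∩ Ici m) ∩ Icc m e := by
    ext t; simp only [mem_inter_iff, mem_Icc, mem_Ici]; tauto
  rw [this]
  exact isCompact_Icc.inter_left (hI.isClosed m hm)

theorem memC0_iff {v : ℝ → X} : MemC0 I v ↔ ContinuousOn v I ∧
    ∀ ε > 0, ∃ K ⊆ I, IsCompact K ∧ ∀ t ∈ I, t ∉ K → ‖v t‖ < ε := by
  refine and_congr_right fun hc => ?_
  rw [Metric.tendsto_nhds]
  refine forall₂_congr fun ε hε => ?_
  rw [Filter.Eventually, mem_cocompact]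
  constructor
  · rintro ⟨K, hK, hKs⟩
    refine ⟨Subtype.val '' K, by rintro _ ⟨x, -, rfl⟩; exact x.2, hK.image continuous_subtype_val,
      fun t ht htK => ?_⟩
    have : (⟨t, ht⟩ : I) ∈ Kᶜ := fun h => htK ⟨_, h, rfl⟩
    simpa using hKs this
  · rintro ⟨K, hKI, hK, h⟩
    refine ⟨Subtype.val ⁻¹' K, ?_, fun t ht => ?_⟩
    · rw [Topology.IsEmbedding.subtypeVal.isCompact_iff, Subtype.image_preimage_coe,
        inter_eq_right.2 hKI]
      exact hK
    · simpa using h t t.2 ht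

theorem MemC0.exists_bound {v : ℝ → X} (hv : MemC0 I v) : ∃ C, ∀ t ∈ I, ‖v t‖ ≤ C := by
  obtain ⟨hc, h⟩ := memC0_iff.1 hv
  obtain ⟨K, hKI, hK, h1⟩ := h 1 one_pos
  obtain ⟨C, hC⟩ := hK.exists_bound_of_continuousOn (hc.mono hKI)
  refine ⟨max C 1, fun t ht => ?_⟩
  by_cases htK : t ∈ K
  · exact (hC t htK).trans (le_max_left _ _)
  · exact (h1 t ht htK).le.trans (le_max_right _ _)

theorem MemC0.smul_bounded [NormedSpace ℝ X] {v : ℝ → X} {φ : ℝ → ℝ} {C : ℝ} (hv : MemC0 I v)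
    (hφ : ContinuousOn φ I) (hC : ∀ t ∈ I, ‖φ t‖ ≤ C) : MemC0 I (fun t => φ t • v t) := by
  obtain ⟨hc, h⟩ := memC0_iff.1 hv
  refine memC0_iff.2 ⟨hφ.smul hc, fun ε hε => ?_⟩
  obtain ⟨K, hKI, hK, h1⟩ := h (ε / (|C| + 1)) (by positivity)
  refine ⟨K, hKI, hK, fun t ht htK => ?_⟩
  rw [norm_smul]
  have h2 := h1 t ht htK
  rw [lt_div_iff₀ (by positivity)] at h2
  have h3 : ‖φ t‖ ≤ |C| + 1 := (hC t ht).trans ((le_abs_self C).trans (by linarith))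
  nlinarith [mul_le_mul_of_nonneg_right h3 (norm_nonneg (v t))]

theorem IsLeftOpen.memC0_of_eq_zero (hI : IsLeftOpen I) {v : ℝ → X} (hv : ContinuousOn v I)
    {m e : ℝ} (hm : m ∈ I) (h1 : ∀ t ∈ I, t < m → v t = 0) (h2 : ∀ t ∈ I, e < t → v t = 0) :
    MemC0 I v := by
  refine memC0_iff.2 ⟨hv, fun ε hε => ⟨I ∩ Icc m e, inter_subset_left, hI.isCompact hm e,
    fun t ht htK => ?_⟩⟩
  by_cases h : t < m
  · rw [h1 t ht h, norm_zero]; exact hε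
  · rw [h2 t ht (by by_contra h'; exact htK ⟨ht, not_lt.1 h, not_lt.1 h'⟩), norm_zero]; exact hε

theorem MemC0.memLp_top [I.OrdConnected] {v : ℝ → X} (hv : MemC0 I v) :
    MemLp v ∞ (volume.restrict I) := by
  have hI : MeasurableSet I := Set.OrdConnected.measurableSet ‹_›
  obtain ⟨C, hC⟩ := hv.exists_bound
  refine memLp_top_of_bound (hv.1.aestronglyMeasurable hI) C ?_
  filter_upwards [ae_restrict_mem hI] with t ht using hC t ht

/-- Every point of `I` is the right end point of a nondegenerate interval in `I`, and there a
continuous function is determined by its values almost everywhere. Passing to `max (‖v‖ - C) 0`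
turns the inequality into an equation. -/
theorem IsLeftOpen.norm_le_of_ae [I.OrdConnected] (hI : IsLeftOpen I) {v : ℝ → X} {C : ℝ}
    (hv : ContinuousOn v I) (h : ∀ᵐ t ∂volume.restrict I, ‖v t‖ ≤ C) : ∀ t ∈ I, ‖v t‖ ≤ C := by
  intro t ht
  obtain ⟨t', ht', hlt⟩ := hI.exists_lt t ht
  have hsub : Icc t' t ⊆ I := Set.OrdConnected.out ‹_› ht' ht
  have := Measure.eqOn_Icc_of_ae_eq volume hlt.ne (f := fun τ => max (‖v τ‖ - C) 0)
    (g := fun _ => 0)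
    (by
      filter_upwards [ae_restrict_of_ae_restrict_of_subset hsub h] with τ hτ
      exact max_eq_right (by linarith))
    (((hv.mono hsub).norm.sub continuousOn_const).sup continuousOn_const) continuousOn_const
    (right_mem_Icc.2 hlt.le)
  have h2 := max_eq_right_iff.1 this
  linarith

end Interval

/-! ### The standing assumptions and their direct consequences. -/

section Data

variable {𝕜 : Type*} [RCLike 𝕜] {X : Type*} [NormedAddCommGroup X] [NormedSpace 𝕜 X]
  [NormedSpace ℝ X] [IsScalarTower ℝ 𝕜 X]

/-- The standing assumptions on the family `A t`, `t ∈ I`. -/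
structure IsStableFamily (I : Set ℝ) [I.OrdConnected] (p : ℝ≥0∞) [Fact (1 ≤ p)]
    (A : ℝ → X →ₗ.[𝕜] X) (M w w' : ℝ) : Prop where
  leftOpen : IsLeftOpen I
  kato : IsKatoStable I A M w
  lt : w < w'
  resolvent_cont : ∀ x : X, ContinuousOn (fun t => resolventOp (A t) (w' : 𝕜) x) I
  range_dense : Dense {h : Ep 𝕜 X I p | ∃ f g : Ep 𝕜 X I p, (f, g) ∈ (G0 I p A).graph ∧
      h = (w' : 𝕜) • f - g}
  domain_dense : Dense ((G0 I p A).domain : Set (Ep 𝕜 X I p))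
  domain_dense' : Dense {h : Ep 𝕜 X I ∞ | ∃ f ∈ (G0 I p A).domain, fn h =ᵐ[volume.restrict I] fn f}

variable {I : Set ℝ} [I.OrdConnected] {p : ℝ≥0∞} [Fact (1 ≤ p)] {A : ℝ → X →ₗ.[𝕜] X} {M w w' : ℝ}

/-- In `resolventOp_sub` with `B' = A s` the difference of resolvents at `w'` is taken at a vector
that does not depend on `t`, so it tends to `0`. The outer factor `R(l, A(t))` is bounded uniformly
in `t`. -/
theorem IsStableFamily.resolvent_continuousOn (h : IsStableFamily I p A M w w') {l : ℝ}
    (hl : w < l) (x : X) : ContinuousOn (fun t => resolventOp (A t) (l : 𝕜) x) I := by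
  intro s hs
  set z := x + ((w' : 𝕜) - (l : 𝕜)) • resolventOp (A s) (l : 𝕜) x with hz
  have h1 : Tendsto (fun t => resolventOp (A t) (w' : 𝕜) z - resolventOp (A s) (w' : 𝕜) z) (𝓝[I] s)
      (𝓝 0) := by
    have := Filter.Tendsto.sub (h.resolvent_cont z s hs)
      (tendsto_const_nhds (x := resolventOp (A s) (w' : 𝕜) z))
    simpa only [sub_self] using this
  have h2 : Tendsto (fun t => resolventOp (A t) (l : 𝕜)
      (resolventOp (A t) (w' : 𝕜) z - resolventOp (A s) (w' : 𝕜) z)) (𝓝[I] s) (𝓝 0) := by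
    refine squeeze_zero_norm' (a := fun t => M * (l - w)⁻¹ *
      ‖resolventOp (A t) (w' : 𝕜) z - resolventOp (A s) (w' : 𝕜) z‖) ?_ ?_
    · filter_upwards [self_mem_nhdsWithin] with t ht
      exact ContinuousLinearMap.le_of_opNorm_le _ (h.kato.norm_resolvent_le ht hl) _
    · simpa using h1.norm.const_mul (M * (l - w)⁻¹)
  have h3 := (h1.add (h2.const_smul ((w' : 𝕜) - (l : 𝕜)))).add_const
    (resolventOp (A s) (l : 𝕜) x)
  simp only [smul_zero, add_zero, zero_add] at h3
  refine h3.congr' ?_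
  filter_upwards [self_mem_nhdsWithin] with t ht
  have := resolventOp_sub (h.kato.resolvent t ht l hl) (h.kato.resolvent s hs l hl)
    (h.kato.resolvent t ht w' h.lt) (h.kato.resolvent s hs w' h.lt) x
  rw [← hz] at this
  rw [← this]; abel

theorem exists_isFp_of_mem_domain [CompleteSpace X] {f : Ep 𝕜 X I p} (hf : f ∈ (G0 I p A).domain) :
    ∃ v v' g : ℝ → X, IsFp I p A v v' g ∧ fn f =ᵐ[volume.restrict I] v := by
  have h1 : (f, (G0 I p A) ⟨f, hf⟩) ∈ (G0 I p A).graph := (G0 I p A).mem_graph ⟨f, hf⟩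
  rw [G0_graph] at h1
  obtain ⟨v, v', g, hF, h2, -⟩ := h1
  exact ⟨v, v', g, hF, h2⟩

/-- `F_p` is uniformly dense in `C_0(I, X)`. -/
theorem IsStableFamily.exists_isFp_norm_sub_le [CompleteSpace X] (h : IsStableFamily I p A M w w')
    {c : ℝ → X} (hc : MemC0 I c) {ε : ℝ} (hε : 0 < ε) :
    ∃ v v' g : ℝ → X, IsFp I p A v v' g ∧ ∀ t ∈ I, ‖c t - v t‖ ≤ ε := by
  set C : Ep 𝕜 X I ∞ := ⟨hc.memLp_top.toLp c, fun _ => ⟨c, hc, hc.memLp_top.coeFn_toLp⟩⟩ with hC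
  obtain ⟨k, ⟨f, hf, hkf⟩, hk⟩ := Metric.dense_iff.1 h.domain_dense' C ε hε |>.imp fun k hk =>
    (⟨hk.2, hk.1⟩ : _ ∧ _)
  obtain ⟨v, v', g, hF, hfv⟩ := exists_isFp_of_mem_domain hf
  refine ⟨v, v', g, hF, ?_⟩
  -- Density in `E_∞` controls only the essential supremum; continuity of both functions upgrades it
  -- to a bound at every point.
  refine h.leftOpen.norm_le_of_ae (hc.1.sub hF.w10.memC0.1) ?_
  have h1 : ‖(C : Lp X ∞ (volume.restrict I)) - k‖ < ε := by
    rw [Metric.mem_ball, dist_comm, dist_eq_norm] at hk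
    exact hk
  have h2 : ∀ᵐ t ∂volume.restrict I, ‖((C : Lp X ∞ (volume.restrict I)) -
      (k : Lp X ∞ (volume.restrict I)) : Lp X ∞ (volume.restrict I)) t‖ ≤ ε := by
    have h3 := ae_le_eLpNormEssSup (μ := volume.restrict I) (f := ((C : Lp X ∞ (volume.restrict I)) -
      (k : Lp X ∞ (volume.restrict I)) : Lp X ∞ (volume.restrict I)))
    filter_upwards [h3] with t ht
    rw [Lp.norm_def, eLpNorm_exponent_top] at h1
    have h4 : eLpNormEssSup (((C : Lp X ∞ (volume.restrict I)) -
      (k : Lp X ∞ (volume.restrict I)) : Lp X ∞ (volume.restrict I))) (volume.restrict I) ≠ ∞ := by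
      rw [← eLpNorm_exponent_top]; exact Lp.eLpNorm_ne_top _
    have := (ENNReal.toReal_mono h4 ht).trans h1.le
    simpa using this
  filter_upwards [h2, Lp.coeFn_sub (C : Lp X ∞ (volume.restrict I)) (k : Lp X ∞ (volume.restrict I)),
    hc.memLp_top.coeFn_toLp, hkf, hfv] with t h3 h4 h5 h6 h7
  rw [h4, Pi.sub_apply] at h3
  have h8 : (C : Lp X ∞ (volume.restrict I)) t = c t := h5
  have h9 : (k : Lp X ∞ (volume.restrict I)) t = v t := h6.trans h7
  rwa [h8, h9] at h3

end Data

end EvolutionSemigroup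

/-! ### The a priori estimate by Yosida approximation. -/

namespace EvolutionSemigroup

section Apriori

variable {𝕜 : Type*} [RCLike 𝕜] {X : Type*} [NormedAddCommGroup X] [NormedSpace 𝕜 X]
  [NormedSpace ℝ X] [IsScalarTower ℝ 𝕜 X]
  {I : Set ℝ} [I.OrdConnected] {p : ℝ≥0∞} [Fact (1 ≤ p)] {A : ℝ → X →ₗ.[𝕜] X} {M w w' : ℝ}

theorem prod_map_smul {𝕜 : Type*} [NontriviallyNormedField 𝕜] {X : Type*} [NormedAddCommGroup X]
    [NormedSpace 𝕜 X] (c : 𝕜) (R : ℝ → X →L[𝕜] X) (ts : List ℝ) :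
    (ts.map fun t => c • R t).prod = c ^ ts.length • (ts.map R).prod := by
  induction ts with
  | nil => simp
  | cons t ts ih =>
    simp only [List.map_cons, List.prod_cons, ih, List.length_cons, pow_succ']
    rw [smul_mul_smul_comm]

theorem IsStableFamily.aestronglyMeasurable_resolvent (h : IsStableFamily I p A M w w') {l : ℝ}
    (hl : w < l) {s t : ℝ} (hs : s ∈ I) (ht : t ∈ I) {g : ℝ → X}
    (hg : AEStronglyMeasurable g (volume.restrict (Ioc s t))) :
    AEStronglyMeasurable (fun τ => resolventOp (A τ) (l : 𝕜) (g τ)) (volume.restrict (Ioc s t)) :=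
  AEStronglyMeasurable.apply_of_strongly_measurable (fun x =>
    ((h.resolvent_continuousOn hl x).mono (Ioc_subset_Icc_self.trans
      (Set.OrdConnected.out ‹_› hs ht))).aestronglyMeasurable measurableSet_Ioc) hg

/-- Since `2w ≤ l`, the quotient `l / (l - w)` is at most `2`. This bounds the operators `l R(l,
A(τ))` by `2M` for all large `l`. -/
theorem mul_inv_sub_le_two {M w l : ℝ} (hM : 0 ≤ M) (hl : 2 * |w| + 1 ≤ l) :
    l * (M * (l - w)⁻¹) ≤ 2 * M := by
  have h1 : 0 < l - w := by linarith [le_abs_self w, abs_nonneg w]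
  have h2 : l * (l - w)⁻¹ ≤ 2 := by
    rw [← div_eq_mul_inv, div_le_iff₀ h1]; linarith [le_abs_self w, abs_nonneg w]
  nlinarith

theorem IsStableFamily.norm_smul_resolvent_le (h : IsStableFamily I p A M w w') {l : ℝ}
    (hl : 2 * |w| + 1 ≤ l) {τ : ℝ} (hτ : τ ∈ I) (x : X) :
    ‖l • resolventOp (A τ) (l : 𝕜) x‖ ≤ 2 * M * ‖x‖ := by
  have hwl : w < l := by linarith [le_abs_self w, abs_nonneg w]
  have hl0 : 0 ≤ l := by linarith [abs_nonneg w]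
  rw [norm_smul, Real.norm_of_nonneg hl0]
  calc l * ‖resolventOp (A τ) (l : 𝕜) x‖ ≤ l * (M * (l - w)⁻¹ * ‖x‖) :=
        mul_le_mul_of_nonneg_left
          (ContinuousLinearMap.le_of_opNorm_le _ (h.kato.norm_resolvent_le hτ hwl) _) hl0
    _ = l * (M * (l - w)⁻¹) * ‖x‖ := by ring
    _ ≤ _ := mul_le_mul_of_nonneg_right (mul_inv_sub_le_two h.kato.nonneg hl) (norm_nonneg _)

theorem IsStableFamily.intervalIntegrable_smul_resolvent (h : IsStableFamily I p A M w w') {l : ℝ}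
    (hl : 2 * |w| + 1 ≤ l) {s t : ℝ} (hs : s ∈ I) (ht : t ∈ I) (hst : s ≤ t) {g : ℝ → X}
    (hg : IntervalIntegrable g volume s t) :
    IntervalIntegrable (fun τ => l • resolventOp (A τ) (l : 𝕜) (g τ)) volume s t := by
  have hwl : w < l := by linarith [le_abs_self w, abs_nonneg w]
  rw [intervalIntegrable_iff_integrableOn_Ioc_of_le hst] at hg ⊢
  refine (hg.norm.const_mul (2 * M)).mono'
    ((h.aestronglyMeasurable_resolvent hwl hs ht hg.1).const_smul l) ?_
  filter_upwards [ae_restrict_mem measurableSet_Ioc] with τ hτ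
  exact h.norm_smul_resolvent_le hl (Set.OrdConnected.out ‹_› hs ht (Ioc_subset_Icc_self hτ)) _

variable [CompleteSpace X]

/-- Integrable functions are approximated in `L^1(s, t)` by elements of `F_p`. -/
theorem IsStableFamily.exists_isFp_integral_norm_sub_le (h : IsStableFamily I p A M w w')
    {s t : ℝ} (hs : s ∈ I) (ht : t ∈ I) (hst : s ≤ t) {g : ℝ → X}
    (hg : IntervalIntegrable g volume s t) {ε : ℝ} (hε : 0 < ε) :
    ∃ v v' k : ℝ → X, IsFp I p A v v' k ∧ ∫ τ in s..t, ‖g τ - v τ‖ ≤ ε := by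
  obtain ⟨c, hc, -, hcg⟩ := exists_continuous_integral_norm_sub_le hst hg (half_pos hε)
  obtain ⟨r, hr, hrs⟩ := h.leftOpen.exists_lt s hs
  -- A trapezoid that is `1` on `[s, t]` and vanishes outside `[r, t + 1]`; multiplication by it
  -- puts the continuous approximation into `C_0(I, X)`.
  set θ : ℝ → ℝ := fun τ => max 0 (min 1 ((τ - r) / (s - r))) * max 0 (min 1 (t + 1 - τ)) with hθ
  have hθc : Continuous θ := by
    have h1 : Continuous fun τ : ℝ => (τ - r) / (s - r) := by fun_prop
    fun_prop
  have hsr : 0 < s - r := by linarith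
  have hθ1 : ∀ τ ∈ Icc s t, θ τ = 1 := by
    intro τ hτ
    have h1 : 1 ≤ (τ - r) / (s - r) := by rw [le_div_iff₀ hsr]; linarith [hτ.1]
    simp only [hθ]
    rw [min_eq_left h1, min_eq_left (by linarith [hτ.2])]
    norm_num
  have hm : MemC0 I (fun τ => θ τ • c τ) := by
    refine h.leftOpen.memC0_of_eq_zero (hθc.smul hc).continuousOn hr (e := t + 1) ?_ ?_
    · intro τ _ hτ
      have : (τ - r) / (s - r) ≤ 0 := div_nonpos_of_nonpos_of_nonneg (by linarith) hsr.le
      simp only [hθ]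
      rw [max_eq_left ((min_le_right _ _).trans this)]; simp
    · intro τ _ hτ
      simp only [hθ]
      rw [max_eq_left (a := (0 : ℝ)) (b := min 1 (t + 1 - τ))
        ((min_le_right _ _).trans (by linarith))]; simp
  have hη : 0 < ε / 2 / (t - s + 1) := by
    have : 0 < t - s + 1 := by linarith
    positivity
  obtain ⟨v, v', k, hF, hv⟩ := h.exists_isFp_norm_sub_le hm hη
  refine ⟨v, v', k, hF, ?_⟩
  have hsub : Icc s t ⊆ I := Set.OrdConnected.out ‹_› hs ht
  have hi : IntervalIntegrable v volume s t := hF.w10.memE.intervalIntegrable hs ht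
  have hci : IntervalIntegrable c volume s t := hc.intervalIntegrable _ _
  calc ∫ τ in s..t, ‖g τ - v τ‖ ≤ ∫ τ in s..t, (‖g τ - c τ‖ + ε / 2 / (t - s + 1)) := by
        refine intervalIntegral.integral_mono_on hst (hg.sub hi).norm
          ((hg.sub hci).norm.add intervalIntegrable_const) fun τ hτ => ?_
        have h1 := hv τ (hsub hτ)
        rw [hθ1 τ hτ, one_smul] at h1
        calc ‖g τ - v τ‖ = ‖(g τ - c τ) + (c τ - v τ)‖ := by congr 1; abel
          _ ≤ _ := (norm_add_le _ _).trans (add_le_add_right h1 _)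
    _ = (∫ τ in s..t, ‖g τ - c τ‖) + (t - s) * (ε / 2 / (t - s + 1)) := by
        rw [intervalIntegral.integral_add (hg.sub hci).norm intervalIntegrable_const,
          intervalIntegral.integral_const, smul_eq_mul]
    _ ≤ ε / 2 + ε / 2 := by
        refine add_le_add hcg ?_
        have h1 : 0 < t - s + 1 := by linarith
        rw [mul_div_assoc', div_le_iff₀ h1]
        nlinarith
    _ = ε := by ring

/-- For `v ∈ F_p` the difference `l R(l, A) v - v` equals `R(l, A) A v`, which is of order `1 / (l -
w)`. The uniform bound on `l R(l, A)` and the `L^1`-density of `F_p` extend the convergence to every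
integrable `g`. -/
theorem IsStableFamily.integral_norm_smul_resolvent_sub_le (h : IsStableFamily I p A M w w')
    {s t : ℝ} (hs : s ∈ I) (ht : t ∈ I) (hst : s ≤ t) {g : ℝ → X}
    (hg : IntervalIntegrable g volume s t) {ε : ℝ} (hε : 0 < ε) :
    ∃ Λ : ℝ, ∀ l : ℝ, Λ ≤ l →
      ∫ τ in s..t, ‖l • resolventOp (A τ) (l : 𝕜) (g τ) - g τ‖ ≤ ε := by
  have hM := h.kato.nonneg
  have hsub : Icc s t ⊆ I := Set.OrdConnected.out ‹_› hs ht
  obtain ⟨v, v', k, hF, hv⟩ := h.exists_isFp_integral_norm_sub_le hs ht hst hg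
    (ε := ε / 2 / (2 * M + 1)) (by positivity)
  have hvi : IntervalIntegrable v volume s t := hF.w10.memE.intervalIntegrable hs ht
  have hki : IntervalIntegrable k volume s t := hF.memE.intervalIntegrable hs ht
  set G := ∫ τ in s..t, ‖k τ‖ with hG
  have hG0 : 0 ≤ G := intervalIntegral.integral_nonneg hst fun _ _ => norm_nonneg _
  refine ⟨max (2 * |w| + 1) (w + 1 + M * G / (ε / 2)), fun l hl => ?_⟩
  have hl1 := (le_max_left _ _).trans hl
  have hl2 := (le_max_right _ _).trans hl
  have hwl : w < l := by linarith [le_abs_self w, abs_nonneg w]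
  have hi := h.intervalIntegrable_smul_resolvent hl1 hs ht hst hg
  have hae : ∀ᵐ τ ∂volume.restrict (Ioc s t), ‖l • resolventOp (A τ) (l : 𝕜) (g τ) - g τ‖ ≤
      (2 * M + 1) * ‖g τ - v τ‖ + M * (l - w)⁻¹ * ‖k τ‖ := by
    filter_upwards [ae_restrict_mem measurableSet_Ioc, ae_restrict_of_ae_restrict_of_subset
      (Ioc_subset_Icc_self.trans hsub) hF.apply_ae] with τ hτ hg'
    have hτI := hsub (Ioc_subset_Icc_self hτ)
    have h1 : l • resolventOp (A τ) (l : 𝕜) (v τ) - v τ = resolventOp (A τ) (l : 𝕜) (k τ) := by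
      have := resolventOp_apply_of_mem_graph (h.kato.resolvent τ hτI l hwl) hg'
      rw [map_sub, map_smul] at this
      rw [RCLike.real_smul_eq_coe_smul (K := 𝕜)]
      nth_rw 2 [← this]
      abel
    have h2 : l • resolventOp (A τ) (l : 𝕜) (g τ) - g τ =
        l • resolventOp (A τ) (l : 𝕜) (g τ - v τ) + resolventOp (A τ) (l : 𝕜) (k τ) -
          (g τ - v τ) := by
      rw [← h1, map_sub, smul_sub]; abel
    rw [h2]
    refine (norm_sub_le _ _).trans ?_
    have h3 := h.norm_smul_resolvent_le hl1 hτI (g τ - v τ)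
    have h4 := ContinuousLinearMap.le_of_opNorm_le _ (h.kato.norm_resolvent_le hτI hwl) (k τ)
    have h5 := norm_add_le (l • resolventOp (A τ) (l : 𝕜) (g τ - v τ))
      (resolventOp (A τ) (l : 𝕜) (k τ))
    linarith
  have hlw : 0 < l - w := by linarith
  calc _ ≤ ∫ τ in s..t, ((2 * M + 1) * ‖g τ - v τ‖ + M * (l - w)⁻¹ * ‖k τ‖) := by
        refine intervalIntegral.integral_mono_ae_restrict hst (hi.sub hg).norm
          (((hg.sub hvi).norm.const_mul _).add (hki.norm.const_mul _)) ?_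
        rw [← restrict_Ioc_eq_restrict_Icc]
        exact hae
    _ = (2 * M + 1) * (∫ τ in s..t, ‖g τ - v τ‖) + M * (l - w)⁻¹ * G := by
        rw [intervalIntegral.integral_add ((hg.sub hvi).norm.const_mul _) (hki.norm.const_mul _),
          intervalIntegral.integral_const_mul, intervalIntegral.integral_const_mul]
    _ ≤ ε / 2 + ε / 2 := by
        refine add_le_add ?_ ?_
        · rw [le_div_iff₀ (by positivity)] at hv; linarith
        · have : M * G / (ε / 2) ≤ l - w := by linarith
          rw [div_le_iff₀ (by positivity)] at this
          rw [mul_assoc, mul_comm (l - w)⁻¹, ← mul_assoc, ← div_eq_mul_inv, div_le_iff₀ hlw]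
          linarith
    _ = ε := by ring

/-- The a priori estimate for the inhomogeneous problem `u' = A(τ) u + (u' - g)`. -/
theorem IsStableFamily.norm_le (h : IsStableFamily I p A M w w') {ω : ℝ} (hω : w < ω)
    {s t : ℝ} (hs : s ∈ I) (ht : t ∈ I) (hst : s ≤ t) {u u' g : ℝ → X}
    (hu' : IntervalIntegrable u' volume s t) (hg : IntervalIntegrable g volume s t)
    (hu : ∀ r ∈ Icc s t, u r = u s + ∫ τ in s..r, u' τ)
    (hgr : ∀ᵐ τ ∂volume.restrict (Icc s t), (u τ, g τ) ∈ (A τ).graph) :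
    ‖u t‖ ≤ M * Real.exp (ω * (t - s)) *
      (‖u s‖ + ∫ τ in s..t, Real.exp (-ω * (τ - s)) * ‖u' τ - g τ‖) := by
  have hM := h.kato.nonneg
  have hsub : Icc s t ⊆ I := Set.OrdConnected.out ‹_› hs ht
  have huc := continuousOn_of_primitive hst hu' hu
  set E := Real.exp (|ω| * (t - s)) with hE
  have hexp : ∀ τ ∈ Icc s t, Real.exp (-ω * (τ - s)) ≤ E := by
    intro τ hτ
    refine Real.exp_le_exp.2 ((mul_le_mul_of_nonneg_right (neg_le_abs ω)
      (sub_nonneg.2 hτ.1)).trans ?_)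
    exact mul_le_mul_of_nonneg_left (by linarith [hτ.2]) (abs_nonneg _)
  have hcont : ContinuousOn (fun τ => Real.exp (-ω * (τ - s))) (Icc s t) := by fun_prop
  refine le_of_forall_pos_le_add fun ε hε => ?_
  set K := M * Real.exp (ω * (t - s)) * E + 1 with hK
  have hK0 : 0 < K := by positivity
  obtain ⟨Λ, hΛ⟩ := h.integral_norm_smul_resolvent_sub_le hs ht hst hg (div_pos hε hK0)
  -- The last lower bound is equivalent to `l² ≤ (l + ω)(l - w)`, that is, to `l² / (l - w) ≤ l +
  -- ω`. This is where `w < ω` enters.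
  obtain ⟨l, hl⟩ : ∃ l : ℝ, max (max Λ (2 * |w| + 1)) (max (|ω|) (ω * w / (ω - w))) ≤ l := ⟨_, le_rfl⟩
  have hl1 : Λ ≤ l := (le_max_left _ _).trans ((le_max_left _ _).trans hl)
  have hl2 : 2 * |w| + 1 ≤ l := (le_max_right _ _).trans ((le_max_left _ _).trans hl)
  have hl3 : |ω| ≤ l := (le_max_left _ _).trans ((le_max_right _ _).trans hl)
  have hl4 : ω * w / (ω - w) ≤ l := (le_max_right _ _).trans ((le_max_right _ _).trans hl)
  have hwl : w < l := by linarith [le_abs_self w, abs_nonneg w]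
  have hβ0 : 0 ≤ l + ω := by linarith [neg_abs_le ω]
  have hβ : l ^ 2 * (l - w)⁻¹ ≤ l + ω := by
    rw [← div_eq_mul_inv, div_le_iff₀ (by linarith)]
    rw [div_le_iff₀ (by linarith)] at hl4
    nlinarith
  have hRi := h.intervalIntegrable_smul_resolvent hl2 hs ht hst hg
  -- From `u = l R u - R g` one gets `u' + l u = l² R u + (u' - l R g)`. Hence `ρ u`, with `ρ =
  -- e^{l(· - s)}`, solves `v' = B v + κ`, and the products of `B` are those controlled by Kato
  -- stability.
  set B : ℝ → X →L[𝕜] X := fun τ => ((l : 𝕜) ^ 2) • resolventOp (A τ) (l : 𝕜) with hB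
  set ρ : ℝ → ℝ := fun r => Real.exp (l * (r - s)) with hρ
  set κ : ℝ → X := fun τ => ρ τ • (u' τ - l • resolventOp (A τ) (l : 𝕜) (g τ)) with hκdef
  have hρc : ContinuousOn ρ (Icc s t) := by simp only [hρ]; fun_prop
  have hκ : IntervalIntegrable κ volume s t := (hu'.sub hRi).continuousOn_smul_Icc hst hρc
  have hv : ∀ r ∈ Icc s t, ρ r • u r = ρ s • u s + ∫ τ in s..r, (B τ (ρ τ • u τ) + κ τ) := by
    intro r hr
    have hrs : Icc s r ⊆ Icc s t := Icc_subset_Icc_right hr.2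
    rw [smul_eq_add_integral_of_primitive hr.1 (ρ := ρ) (ρ' := fun τ => l * Real.exp (l * (τ - s)))
      (by fun_prop) (fun q _ => exp_primitive l s q) (hu'.mono_Icc ⟨le_rfl, hst⟩ hr)
      (fun q hq => hu q (hrs hq))]
    congr 1
    refine intervalIntegral.integral_congr_ae ?_
    rw [uIoc_of_le hr.1]
    rw [← ae_restrict_iff' measurableSet_Ioc]
    filter_upwards [ae_restrict_mem measurableSet_Ioc, ae_restrict_of_ae_restrict_of_subset
      (Ioc_subset_Icc_self.trans hrs) hgr] with τ hτ hgτ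
    have h1 := resolventOp_apply_of_mem_graph
      (h.kato.resolvent τ (hsub (hrs (Ioc_subset_Icc_self hτ))) l hwl) hgτ
    rw [map_sub, map_smul] at h1
    simp only [hB, hκdef, hρ, smul_apply, RCLike.real_smul_eq_coe_smul (K := 𝕜),
      map_smul]
    set R := resolventOp (A τ) (l : 𝕜)
    have h2 : (l : 𝕜) • u τ = (l : 𝕜) • ((l : 𝕜) • R (u τ) - R (g τ)) := by rw [h1]
    rw [show ((l * Real.exp (l * (τ - s)) : ℝ) : 𝕜) • u τ =
      ((Real.exp (l * (τ - s)) : ℝ) : 𝕜) • ((l : 𝕜) • u τ) by rw [smul_smul]; push_cast; ring_nf, h2]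
    module
  have hD := norm_le_of_ordered_products (𝕜 := 𝕜) (M := M) (β := l + ω) (v := fun r => ρ r • u r)
    hst hβ0 (B := B) (by
      intro ts hts hmem
      have h1 := h.kato.bound ts hts (fun q hq => hsub (hmem q hq)) l hwl
      rw [hB, prod_map_smul, norm_smul]
      have h2 : ‖((l : 𝕜) ^ 2) ^ ts.length‖ = (l ^ 2) ^ ts.length := by
        simp
      rw [h2]
      calc _ ≤ (l ^ 2) ^ ts.length * (M * ((l - w) ^ ts.length)⁻¹) :=
            mul_le_mul_of_nonneg_left h1 (by positivity)
        _ = M * (l ^ 2 * (l - w)⁻¹) ^ ts.length := by rw [mul_pow, inv_pow]; ring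
        _ ≤ _ := by
          refine mul_le_mul_of_nonneg_left (pow_le_pow_left₀ ?_ hβ _) hM
          have : 0 < l - w := by linarith
          positivity)
    (fun x => by
      have := ((h.resolvent_continuousOn hwl x).mono hsub).const_smul ((l : 𝕜) ^ 2)
      exact this) hκ (hρc.smul huc) hv
  have hρs : ρ s = 1 := by simp [hρ]
  simp only [hρs, one_smul, norm_smul] at hD
  rw [Real.norm_of_nonneg (Real.exp_pos _).le] at hD
  -- The factor `ρ` inside `κ` cancels the part `e^{-l(τ-s)}` of the weight. What remains is the
  -- true residual plus the Yosida error, which is small in `L^1`.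
  have hint : ∫ τ in s..t, Real.exp (-(l + ω) * (τ - s)) * ‖κ τ‖ ≤
      (∫ τ in s..t, Real.exp (-ω * (τ - s)) * ‖u' τ - g τ‖) + E * (ε / K) := by
    have hi1 : IntervalIntegrable (fun τ => Real.exp (-ω * (τ - s)) * ‖u' τ - g τ‖) volume s t :=
      (hu'.sub hg).norm.continuousOn_smul_Icc hst hcont
    have hi2 : IntervalIntegrable (fun τ => E * ‖l • resolventOp (A τ) (l : 𝕜) (g τ) - g τ‖)
        volume s t := (hRi.sub hg).norm.const_mul E
    have hi3 : IntervalIntegrable (fun τ => Real.exp (-(l + ω) * (τ - s)) * ‖κ τ‖) volume s t :=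
      hκ.norm.continuousOn_smul_Icc hst (ρ := fun τ => Real.exp (-(l + ω) * (τ - s))) (by fun_prop)
    calc _ ≤ ∫ τ in s..t, (Real.exp (-ω * (τ - s)) * ‖u' τ - g τ‖ +
          E * ‖l • resolventOp (A τ) (l : 𝕜) (g τ) - g τ‖) := by
          refine intervalIntegral.integral_mono_on hst hi3 (hi1.add hi2) fun τ hτ => ?_
          have e1 : Real.exp (-(l + ω) * (τ - s)) * ‖κ τ‖ = Real.exp (-ω * (τ - s)) *
              ‖u' τ - l • resolventOp (A τ) (l : 𝕜) (g τ)‖ := by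
            simp only [hκdef, hρ]
            rw [norm_smul, Real.norm_of_nonneg (Real.exp_pos _).le, ← mul_assoc, ← Real.exp_add]
            congr 2; ring
          rw [e1]
          calc _ ≤ Real.exp (-ω * (τ - s)) * (‖u' τ - g τ‖ +
                ‖l • resolventOp (A τ) (l : 𝕜) (g τ) - g τ‖) := by
                refine mul_le_mul_of_nonneg_left ?_ (Real.exp_pos _).le
                refine le_trans (le_of_eq ?_) (norm_sub_le _ _)
                congr 1; abel
            _ ≤ _ := by
                rw [mul_add]
                exact add_le_add_right (mul_le_mul_of_nonneg_right (hexp τ hτ) (norm_nonneg _)) _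
      _ = _ := intervalIntegral.integral_add hi1 hi2
      _ ≤ _ := by
          rw [intervalIntegral.integral_const_mul]
          exact add_le_add_right (mul_le_mul_of_nonneg_left (hΛ l hl1) (Real.exp_pos _).le) _
  have hρt : 0 < ρ t := Real.exp_pos _
  have hfac : M * Real.exp ((l + ω) * (t - s)) = ρ t * (M * Real.exp (ω * (t - s))) := by
    simp only [hρ]
    rw [add_mul, Real.exp_add]; ring
  rw [hfac, mul_assoc] at hD
  have hD' := le_of_mul_le_mul_left hD hρt
  calc _ ≤ _ := hD'
    _ ≤ M * Real.exp (ω * (t - s)) * (‖u s‖ +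
        ((∫ τ in s..t, Real.exp (-ω * (τ - s)) * ‖u' τ - g τ‖) + E * (ε / K))) := by
        gcongr
    _ = M * Real.exp (ω * (t - s)) * (‖u s‖ +
        ∫ τ in s..t, Real.exp (-ω * (τ - s)) * ‖u' τ - g τ‖) + (K - 1) * (ε / K) := by
        rw [hK]; ring
    _ ≤ _ := by
        refine add_le_add_right ?_ _
        have : K * (ε / K) = ε := by field_simp
        have : 0 < ε / K := by positivity
        linarith

end Apriori

end EvolutionSemigroup

/-! ### Regular functions on compact intervals, and multiplication by cut-offs. -/

namespace EvolutionSemigroup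

section LocalSolutions

variable {𝕜 : Type*} [RCLike 𝕜] {X : Type*} [NormedAddCommGroup X] [NormedSpace 𝕜 X]
  [NormedSpace ℝ X]

/-- `u` is absolutely continuous on `[s, t]` with derivative `u'`, and `A(·) u = g` is integrable
there. -/
structure IsRegularOn (A : ℝ → X →ₗ.[𝕜] X) (s t : ℝ) (u u' g : ℝ → X) : Prop where
  integrable' : IntervalIntegrable u' volume s t
  integrable : IntervalIntegrable g volume s t
  primitive : ∀ r ∈ Icc s t, u r = u s + ∫ τ in s..r, u' τ
  graph_ae : ∀ᵐ τ ∂volume.restrict (Icc s t), (u τ, g τ) ∈ (A τ).graph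

variable {A : ℝ → X →ₗ.[𝕜] X} {s t : ℝ} {u u' g v v' k : ℝ → X}

theorem IsRegularOn.mono (h : IsRegularOn A s t u u' g) {r q : ℝ} (hr : r ∈ Icc s t)
    (hq : q ∈ Icc s t) : IsRegularOn A r q u u' g where
  integrable' := h.integrable'.mono_Icc hr hq
  integrable := h.integrable.mono_Icc hr hq
  primitive := by
    intro x hx
    have hx' : x ∈ Icc s t := ⟨hr.1.trans hx.1, hx.2.trans hq.2⟩
    have hs : s ∈ Icc s t := ⟨le_rfl, hr.1.trans hr.2⟩
    rw [h.primitive x hx', h.primitive r hr, add_assoc,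
      intervalIntegral.integral_add_adjacent_intervals (h.integrable'.mono_Icc hs hr)
        (h.integrable'.mono_Icc hr hx')]
  graph_ae := ae_restrict_of_ae_restrict_of_subset (Icc_subset_Icc hr.1 hq.2) h.graph_ae

theorem IsRegularOn.sub (h : IsRegularOn A s t u u' g) (h' : IsRegularOn A s t v v' k) :
    IsRegularOn A s t (u - v) (u' - v') (g - k) where
  integrable' := h.integrable'.sub h'.integrable'
  integrable := h.integrable.sub h'.integrable
  primitive := by
    intro r hr
    have hs : s ∈ Icc s t := ⟨le_rfl, hr.1.trans hr.2⟩
    simp only [Pi.sub_apply]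
    rw [h.primitive r hr, h'.primitive r hr, intervalIntegral.integral_sub
      (h.integrable'.mono_Icc hs hr) (h'.integrable'.mono_Icc hs hr)]
    abel
  graph_ae := by
    filter_upwards [h.graph_ae, h'.graph_ae] with τ h1 h2
    exact (A τ).graph.sub_mem h1 h2

theorem IsRegularOn.add (h : IsRegularOn A s t u u' g) (h' : IsRegularOn A s t v v' k) :
    IsRegularOn A s t (u + v) (u' + v') (g + k) where
  integrable' := h.integrable'.add h'.integrable'
  integrable := h.integrable.add h'.integrable
  primitive := by
    intro r hr
    have hs : s ∈ Icc s t := ⟨le_rfl, hr.1.trans hr.2⟩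
    simp only [Pi.add_apply]
    rw [h.primitive r hr, h'.primitive r hr, intervalIntegral.integral_add
      (h.integrable'.mono_Icc hs hr) (h'.integrable'.mono_Icc hs hr)]
    abel
  graph_ae := by
    filter_upwards [h.graph_ae, h'.graph_ae] with τ h1 h2
    exact (A τ).graph.add_mem h1 h2

theorem IsRegularOn.integral_norm_sub_le {s t : ℝ} (hst : s ≤ t) {u u' g v v' k : ℝ → X}
    (hu : IsRegularOn A s t u u' g) (hv : IsRegularOn A s t v v' k) :
    ∫ τ in s..t, ‖(u' - v') τ - (g - k) τ‖ ≤
      (∫ τ in s..t, ‖u' τ - g τ‖) + ∫ τ in s..t, ‖v' τ - k τ‖ := by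
  have h1 := (hu.integrable'.sub hu.integrable).norm
  have h2 := (hv.integrable'.sub hv.integrable).norm
  rw [← intervalIntegral.integral_add h1 h2]
  refine intervalIntegral.integral_mono_on hst
    ((hu.integrable'.sub hv.integrable').sub (hu.integrable.sub hv.integrable)).norm
    (h1.add h2) fun τ _ => ?_
  refine le_trans (le_of_eq ?_) (norm_sub_le _ _)
  congr 1; simp only [Pi.sub_apply]; abel

theorem IsRegularOn.integral_norm_add_le {s t : ℝ} (hst : s ≤ t) {u u' g v v' k : ℝ → X}
    (hu : IsRegularOn A s t u u' g) (hv : IsRegularOn A s t v v' k) :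
    ∫ τ in s..t, ‖(u' + v') τ - (g + k) τ‖ ≤
      (∫ τ in s..t, ‖u' τ - g τ‖) + ∫ τ in s..t, ‖v' τ - k τ‖ := by
  have h1 := (hu.integrable'.sub hu.integrable).norm
  have h2 := (hv.integrable'.sub hv.integrable).norm
  rw [← intervalIntegral.integral_add h1 h2]
  refine intervalIntegral.integral_mono_on hst
    ((hu.integrable'.add hv.integrable').sub (hu.integrable.add hv.integrable)).norm
    (h1.add h2) fun τ _ => ?_
  refine le_trans (le_of_eq ?_) (norm_add_le _ _)
  congr 1; simp only [Pi.add_apply]; abel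

theorem IsRegularOn.smul_const [IsScalarTower ℝ 𝕜 X] {s t : ℝ} {u u' g : ℝ → X}
    (hu : IsRegularOn A s t u u' g) (c : 𝕜) :
    IsRegularOn A s t (c • u) (c • u') (c • g) where
  integrable' := hu.integrable'.smul c
  integrable := hu.integrable.smul c
  primitive := by
    intro r hr
    have : SMulCommClass ℝ 𝕜 X := IsScalarTower.to_smulCommClass
    simp only [Pi.smul_apply]
    rw [intervalIntegral.integral_smul, hu.primitive r hr, smul_add]
  graph_ae := by
    filter_upwards [hu.graph_ae] with τ h1
    exact (A τ).graph.smul_mem c h1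

variable {I : Set ℝ} {p : ℝ≥0∞} {M w w' : ℝ}

variable [I.OrdConnected]

theorem MemE.smul_bounded {f : ℝ → X} (hf : MemE I p f) {φ : ℝ → ℝ} {C : ℝ}
    (hφ : ContinuousOn φ I) (hC : ∀ t ∈ I, ‖φ t‖ ≤ C) : MemE I p (fun t => φ t • f t) := by
  have hI : MeasurableSet I := Set.OrdConnected.measurableSet ‹_›
  refine ⟨?_, fun hp => (hf.2 hp).smul_bounded hφ hC⟩
  refine hf.1.of_le_mul (c := C) ((hφ.aestronglyMeasurable hI).smul hf.1.1) ?_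
  filter_upwards [ae_restrict_mem hI] with t ht
  rw [norm_smul]
  exact mul_le_mul_of_nonneg_right (hC t ht) (norm_nonneg _)

variable [Fact (1 ≤ p)]

theorem IsFp.isRegularOn (h : IsFp I p A v v' k) (hs : s ∈ I) (ht : t ∈ I) :
    IsRegularOn A s t v v' k where
  integrable' := h.w10.memE'.intervalIntegrable hs ht
  integrable := h.memE.intervalIntegrable hs ht
  primitive := fun r hr => by
    rw [← h.w10.primitive s hs r (Set.OrdConnected.out ‹_› hs ht hr)]; abel
  graph_ae := ae_restrict_of_ae_restrict_of_subset (Set.OrdConnected.out ‹_› hs ht) h.apply_ae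

theorem IsFp.add (h : IsFp I p A u u' g) (h' : IsFp I p A v v' k) :
    IsFp I p A (u + v) (u' + v') (g + k) where
  w10 := h.w10.add h'.w10
  memE := h.memE.add h'.memE
  apply_ae := by
    filter_upwards [h.apply_ae, h'.apply_ae] with t h1 h2
    exact (A t).graph.add_mem h1 h2

variable [IsScalarTower ℝ 𝕜 X]

theorem real_smul_mem_graph {B : X →ₗ.[𝕜] X} {x y : X} (h : (x, y) ∈ B.graph) (r : ℝ) :
    (r • x, r • y) ∈ B.graph := by
  rw [RCLike.real_smul_eq_coe_smul (K := 𝕜), RCLike.real_smul_eq_coe_smul (K := 𝕜)]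
  exact B.graph.smul_mem (r : 𝕜) h

theorem IsRegularOn.smul [CompleteSpace X] (h : IsRegularOn A s t u u' g) (hst : s ≤ t)
    {ρ ρ' : ℝ → ℝ} (hρ' : ContinuousOn ρ' (Icc s t))
    (hρ : ∀ r ∈ Icc s t, ρ r = ρ s + ∫ τ in s..r, ρ' τ) :
    IsRegularOn A s t (fun τ => ρ τ • u τ) (fun τ => ρ' τ • u τ + ρ τ • u' τ)
      (fun τ => ρ τ • g τ) where
  integrable' := by
    have h1 := continuousOn_of_primitive hst h.integrable' h.primitive
    have hρ'i : IntervalIntegrable ρ' volume s t :=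
      ContinuousOn.intervalIntegrable (by rwa [uIcc_of_le hst])
    have h2 := continuousOn_of_primitive hst hρ'i hρ
    exact (ContinuousOn.intervalIntegrable (by rw [uIcc_of_le hst]; exact hρ'.smul h1)).add
      (h.integrable'.continuousOn_smul_Icc hst h2)
  integrable := by
    have hρ'i : IntervalIntegrable ρ' volume s t :=
      ContinuousOn.intervalIntegrable (by rwa [uIcc_of_le hst])
    exact h.integrable.continuousOn_smul_Icc hst (continuousOn_of_primitive hst hρ'i hρ)
  primitive := by
    intro r hr
    have hrs : Icc s r ⊆ Icc s t := Icc_subset_Icc_right hr.2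
    exact smul_eq_add_integral_of_primitive hr.1 (hρ'.mono hrs) (fun q hq => hρ q (hrs hq))
      (h.integrable'.mono_Icc ⟨le_rfl, hst⟩ hr) (fun q hq => h.primitive q (hrs hq))
  graph_ae := by
    filter_upwards [h.graph_ae] with τ h1
    exact real_smul_mem_graph h1 _

/-- `F_p` is stable under multiplication with bounded `C^1`-functions with bounded derivative. -/
theorem IsFp.smul_cutoff [CompleteSpace X] (h : IsFp I p A v v' k) {φ φ' : ℝ → ℝ} {C C' : ℝ}
    (hφ' : ContinuousOn φ' I) (hφ : ∀ r ∈ I, ∀ q ∈ I, φ q - φ r = ∫ τ in r..q, φ' τ)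
    (hφc : ContinuousOn φ I) (hC : ∀ t ∈ I, ‖φ t‖ ≤ C) (hC' : ∀ t ∈ I, ‖φ' t‖ ≤ C') :
    IsFp I p A (fun t => φ t • v t) (fun t => φ' t • v t + φ t • v' t) (fun t => φ t • k t) where
  w10 :=
    { memE := h.w10.memE.smul_bounded hφc hC
      memC0 := h.w10.memC0.smul_bounded hφc hC
      memE' := (h.w10.memE.smul_bounded hφ' hC').add (h.w10.memE'.smul_bounded hφc hC)
      primitive := by
        have key : ∀ r ∈ I, ∀ q ∈ I, r ≤ q → φ q • v q - φ r • v r =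
            ∫ τ in r..q, (φ' τ • v τ + φ τ • v' τ) := by
          intro r hr q hq hrq
          have hsub : Icc r q ⊆ I := Set.OrdConnected.out ‹_› hr hq
          have := (h.isRegularOn hr hq).smul hrq (hφ'.mono hsub)
            (ρ := φ) (fun x hx => by rw [← hφ r hr x (hsub hx)]; abel)
          rw [this.primitive q ⟨hrq, le_rfl⟩]; abel
        intro r hr q hq
        rcases le_total r q with hrq | hrq
        · exact key r hr q hq hrq
        · rw [intervalIntegral.integral_symm, ← key q hq r hr hrq]; abel }
  memE := h.memE.smul_bounded hφc hC
  apply_ae := by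
    filter_upwards [h.apply_ae] with t ht
    exact real_smul_mem_graph ht _

variable [CompleteSpace X]

theorem IsStableFamily.norm_le_exp (h : IsStableFamily I p A M w w') {ω : ℝ} (hω : w < ω)
    (hs : s ∈ I) (ht : t ∈ I) (hst : s ≤ t) (hu : IsRegularOn A s t u u' g) :
    ‖u t‖ ≤ M * Real.exp (ω * (t - s)) *
      (‖u s‖ + Real.exp (|ω| * (t - s)) * ∫ τ in s..t, ‖u' τ - g τ‖) := by
  have hM := h.kato.nonneg
  refine (h.norm_le hω hs ht hst hu.integrable' hu.integrable hu.primitive hu.graph_ae).trans ?_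
  have e2 : ∫ τ in s..t, Real.exp (-ω * (τ - s)) * ‖u' τ - g τ‖ ≤
      Real.exp (|ω| * (t - s)) * ∫ τ in s..t, ‖u' τ - g τ‖ := by
    rw [← intervalIntegral.integral_const_mul]
    refine intervalIntegral.integral_mono_on hst ?_ ?_ fun τ hτ => ?_
    · exact (hu.integrable'.sub hu.integrable).norm.continuousOn_smul_Icc hst
        (ρ := fun τ => Real.exp (-ω * (τ - s))) (by fun_prop)
    · exact (hu.integrable'.sub hu.integrable).norm.const_mul _
    · refine mul_le_mul_of_nonneg_right (Real.exp_le_exp.2 ?_) (norm_nonneg _)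
      exact (mul_le_mul_of_nonneg_right (neg_le_abs ω) (sub_nonneg.2 hτ.1)).trans
        (mul_le_mul_of_nonneg_left (by linarith [hτ.2]) (abs_nonneg _))
  gcongr

/-- A version with `ω = w'` whose constant depends only on a bound `ℓ` for the length. One
exponential is the growth factor, the other one removes the weight from the integral. -/
theorem IsStableFamily.norm_le_mul (h : IsStableFamily I p A M w w') (hs : s ∈ I) (ht : t ∈ I)
    (hst : s ≤ t) {ℓ : ℝ} (hℓ : t - s ≤ ℓ) (hu : IsRegularOn A s t u u' g) :
    ‖u t‖ ≤ M * Real.exp (|w'| * ℓ) ^ 2 * (‖u s‖ + ∫ τ in s..t, ‖u' τ - g τ‖) := by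
  have hM := h.kato.nonneg
  set E := Real.exp (|w'| * ℓ) with hE
  have hℓ0 : 0 ≤ ℓ := (sub_nonneg.2 hst).trans hℓ
  have hE1 : 1 ≤ E := Real.one_le_exp (by positivity)
  have e0 : Real.exp (|w'| * (t - s)) ≤ E := Real.exp_le_exp.2
    (mul_le_mul_of_nonneg_left hℓ (abs_nonneg _))
  have e1 : Real.exp (w' * (t - s)) ≤ E := (Real.exp_le_exp.2
    (mul_le_mul_of_nonneg_right (le_abs_self w') (sub_nonneg.2 hst))).trans e0
  have e3 : 0 ≤ ∫ τ in s..t, ‖u' τ - g τ‖ :=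
    intervalIntegral.integral_nonneg hst fun _ _ => norm_nonneg _
  calc _ ≤ _ := h.norm_le_exp h.lt hs ht hst hu
    _ ≤ M * E * (‖u s‖ + E * ∫ τ in s..t, ‖u' τ - g τ‖) := by gcongr
    _ ≤ M * E * (E * ‖u s‖ + E * ∫ τ in s..t, ‖u' τ - g τ‖) := by
        gcongr
        exact le_mul_of_one_le_left (norm_nonneg _) hE1
    _ = _ := by ring

/-- Every `v ∈ F_p` is controlled by `(w' - G_0) v`. -/
theorem IsStableFamily.norm_le_of_isFp (h : IsStableFamily I p A M w w') (hv : IsFp I p A v v' k)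
    (ht : t ∈ I) {B : ℝ} (hB : ∀ s ∈ I, s ≤ t →
      ∫ τ in s..t, Real.exp (-((w' - w) / 2) * (t - τ)) * ‖w' • v τ + v' τ - k τ‖ ≤ B) :
    ‖v t‖ ≤ M * B := by
  have hM := h.kato.nonneg
  have hlt := h.lt
  refine le_of_forall_pos_le_add fun ε hε => ?_
  -- Because `v ∈ C_0(I, X)`, a starting time `s` sufficiently far to the left makes `v s`
  -- negligible.
  obtain ⟨K, hKI, hK, hKv⟩ := (memC0_iff.1 hv.w10.memC0).2 (ε / (M + 1)) (by positivity)
  obtain ⟨s, hs, hst, hsK⟩ := h.leftOpen.exists_notMem_compact hK hKI ht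
  have hvs := hKv s hs hsK
  -- The estimate is applied to `e^{w'(τ-s)} v`, whose residual is `e^{w'(τ-s)} (w' v + v' - k)`.
  -- Growth with the midpoint exponent leaves the gap `w' - ω = (w' - w) / 2` as decay of the
  -- kernel.
  set ω := (w + w') / 2 with hω
  have hr := (hv.isRegularOn hs ht).smul hst (ρ := fun τ => Real.exp (w' * (τ - s)))
    (ρ' := fun τ => w' * Real.exp (w' * (τ - s))) (by fun_prop) (fun r _ => exp_primitive w' s r)
  have h1 := h.norm_le (ω := ω) (by rw [hω]; linarith) hs ht hst hr.integrable' hr.integrable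
    hr.primitive hr.graph_ae
  simp only [sub_self, mul_zero, Real.exp_zero, one_smul] at h1
  rw [norm_smul, Real.norm_of_nonneg (Real.exp_pos _).le] at h1
  set D := Real.exp ((w' - w) / 2 * (t - s)) with hD
  have hD1 : 1 ≤ D := Real.one_le_exp (mul_nonneg (by linarith) (by linarith))
  have h2 : ∫ τ in s..t, Real.exp (-ω * (τ - s)) *
      ‖(w' * Real.exp (w' * (τ - s))) • v τ + Real.exp (w' * (τ - s)) • v' τ -
        Real.exp (w' * (τ - s)) • k τ‖ =
      D * ∫ τ in s..t, Real.exp (-((w' - w) / 2) * (t - τ)) * ‖w' • v τ + v' τ - k τ‖ := by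
    rw [← intervalIntegral.integral_const_mul]
    refine intervalIntegral.integral_congr fun τ _ => ?_
    have e1 : (w' * Real.exp (w' * (τ - s))) • v τ + Real.exp (w' * (τ - s)) • v' τ -
        Real.exp (w' * (τ - s)) • k τ = Real.exp (w' * (τ - s)) • (w' • v τ + v' τ - k τ) := by
      module
    rw [e1, norm_smul, Real.norm_of_nonneg (Real.exp_pos _).le, ← mul_assoc, ← mul_assoc,
      ← Real.exp_add, hD, ← Real.exp_add]
    congr 2
    rw [hω]; ring
  rw [h2] at h1
  have h3 : Real.exp (w' * (t - s)) = Real.exp (ω * (t - s)) * D := by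
    rw [hD, ← Real.exp_add, hω]; congr 1; ring
  rw [h3, mul_comm M, mul_assoc, mul_assoc] at h1
  have h4 := le_of_mul_le_mul_left h1 (Real.exp_pos _)
  have h5 : D * ‖v t‖ ≤ D * (M * (‖v s‖ + ∫ τ in s..t,
      Real.exp (-((w' - w) / 2) * (t - τ)) * ‖w' • v τ + v' τ - k τ‖)) := by
    refine h4.trans ?_
    rw [mul_left_comm]
    refine mul_le_mul_of_nonneg_left ?_ hM
    rw [mul_add]
    exact add_le_add_left (le_mul_of_one_le_left (norm_nonneg _) hD1) _
  have h6 := le_of_mul_le_mul_left h5 (zero_lt_one.trans_le hD1)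
  have h7 := hB s hs hst
  rw [lt_div_iff₀ (by positivity)] at hvs
  have h8 := mul_le_mul_of_nonneg_left h7 hM
  rw [mul_add] at h6
  nlinarith [norm_nonneg (v s)]

end LocalSolutions

end EvolutionSemigroup

/-! ### Approximate solutions in `F_p` with prescribed initial value. -/

namespace EvolutionSemigroup

section Basic

variable {𝕜 : Type*} [RCLike 𝕜] {X : Type*} [NormedAddCommGroup X] [NormedSpace 𝕜 X]
  {I : Set ℝ} {p : ℝ≥0∞} [Fact (1 ≤ p)]

variable (𝕜) in
/-- The element of `E_p` represented by the function `v`. -/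
noncomputable def MemE.toEp {v : ℝ → X} (hv : MemE I p v) : Ep 𝕜 X I p :=
  ⟨hv.1.toLp v, fun hp => ⟨v, hv.2 hp, hv.1.coeFn_toLp⟩⟩

theorem fn_toEp {v : ℝ → X} (hv : MemE I p v) : fn (hv.toEp 𝕜) =ᵐ[volume.restrict I] v :=
  hv.1.coeFn_toLp

theorem norm_eq_eLpNorm (f : Ep 𝕜 X I p) : ‖f‖ = (eLpNorm (fn f) p (volume.restrict I)).toReal :=
  Lp.norm_def _

theorem eLpNorm_fn_ne_top (f : Ep 𝕜 X I p) : eLpNorm (fn f) p (volume.restrict I) ≠ ∞ :=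
  Lp.eLpNorm_ne_top _

theorem fn_sub (f g : Ep 𝕜 X I p) : fn (f - g) =ᵐ[volume.restrict I] fn f - fn g :=
  Lp.coeFn_sub _ _

theorem eLpNorm_eq_ofReal_norm {f : Ep 𝕜 X I p} {v : ℝ → X} (h : fn f =ᵐ[volume.restrict I] v) :
    eLpNorm v p (volume.restrict I) = ENNReal.ofReal ‖f‖ := by
  rw [norm_eq_eLpNorm, ENNReal.ofReal_toReal (eLpNorm_fn_ne_top f), eLpNorm_congr_ae h]

theorem MemE.memLp_Icc {X : Type*} [NormedAddCommGroup X] {I : Set ℝ} [I.OrdConnected] {p : ℝ≥0∞}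
    {f : ℝ → X} (hf : MemE I p f) {s t : ℝ} (hs : s ∈ I) (ht : t ∈ I) :
    MemLp f p (volume.restrict (Icc s t)) :=
  hf.1.mono_measure (Measure.restrict_mono (Set.OrdConnected.out ‹_› hs ht) le_rfl)

end Basic

section Existence

variable {𝕜 : Type*} [RCLike 𝕜] {X : Type*} [NormedAddCommGroup X] [NormedSpace 𝕜 X]
  [NormedSpace ℝ X] [IsScalarTower ℝ 𝕜 X] [CompleteSpace X]
  {I : Set ℝ} [I.OrdConnected] {p : ℝ≥0∞} [Fact (1 ≤ p)] {A : ℝ → X →ₗ.[𝕜] X} {M w w' : ℝ}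

theorem IsStableFamily.exists_isFp_eLpNorm_sub_le (h : IsStableFamily I p A M w w') {k : ℝ → X}
    (hk : MemE I p k) {η : ℝ} (hη : 0 < η) : ∃ v v' g : ℝ → X, IsFp I p A v v' g ∧
      eLpNorm (fun τ => k τ - (w' • v τ + v' τ - g τ)) p (volume.restrict I) ≤
        ENNReal.ofReal η := by
  obtain ⟨z, hz, f, f', hf, rfl⟩ := Metric.dense_iff.1 h.range_dense (hk.toEp 𝕜) η hη
  rw [G0_graph] at hf
  obtain ⟨v, v', g, hF, h1, h2⟩ := hf
  refine ⟨v, v', g, hF, ?_⟩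
  have h3 : fn (hk.toEp 𝕜 - ((w' : 𝕜) • f - f')) =ᵐ[volume.restrict I]
      fun τ => k τ - (w' • v τ + v' τ - g τ) := by
    filter_upwards [fn_sub (hk.toEp 𝕜) ((w' : 𝕜) • f - f'), fn_sub ((w' : 𝕜) • f) f',
      fn_smul (w' : 𝕜) f, h1, h2, fn_toEp (𝕜 := 𝕜) hk] with τ e1 e2 e3 e4 e5 e6
    simp only [Pi.sub_apply, Pi.smul_apply, Pi.add_apply, Pi.neg_apply] at *
    rw [e1, e2, e3, e4, e5, e6, RCLike.real_smul_eq_coe_smul (K := 𝕜)]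
    abel
  rw [eLpNorm_eq_ofReal_norm h3]
  refine ENNReal.ofReal_le_ofReal ?_
  rw [Metric.mem_ball, dist_comm, dist_eq_norm] at hz
  exact hz.le

/-- A tent function with peak `x` at `s` lies in `C_0(I, X)`, where `F_p` is uniformly dense. -/
theorem IsStableFamily.exists_isFp_norm_apply_sub_le (h : IsStableFamily I p A M w w') {s : ℝ}
    (hs : s ∈ I) (x : X) {ε : ℝ} (hε : 0 < ε) :
    ∃ v v' g : ℝ → X, IsFp I p A v v' g ∧ ‖v s - x‖ ≤ ε := by
  obtain ⟨r, hr, hrs⟩ := h.leftOpen.exists_lt s hs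
  have hsr : 0 < s - r := by linarith
  have hm : MemC0 I (fun τ => max 0 (1 - |τ - s| / (s - r)) • x) := by
    refine h.leftOpen.memC0_of_eq_zero (by fun_prop) hr (e := 2 * s - r) ?_ ?_
    · intro τ _ hτ
      rw [max_eq_left, zero_smul]
      rw [sub_nonpos, one_le_div hsr, abs_sub_comm]
      exact (by linarith : s - r ≤ s - τ).trans (le_abs_self _)
    · intro τ _ hτ
      rw [max_eq_left, zero_smul]
      rw [sub_nonpos, one_le_div hsr]
      exact (by linarith : s - r ≤ τ - s).trans (le_abs_self _)
  obtain ⟨v, v', g, hF, hv⟩ := h.exists_isFp_norm_sub_le hm hε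
  refine ⟨v, v', g, hF, ?_⟩
  have := hv s hs
  rw [norm_sub_rev]
  simpa using this

/-- A continuous function that equals `exp (-λ τ)` on `[s, e]` and is supported near `[s, e]`. -/
theorem exists_expCutoff (l : ℝ) {r₀ e : ℝ} :
    ∃ C : ℝ, 0 < C ∧ ∀ r s : ℝ, r₀ ≤ r → r < s → s ≤ e → ∃ κ : ℝ → ℝ, Continuous κ ∧
      (∀ τ, ‖κ τ‖ ≤ C) ∧ (∀ τ ≤ r, κ τ = 0) ∧ ∀ τ ∈ Icc s e, κ τ = Real.exp (-l * τ) := by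
  -- The bound involves only `r₀` and `e`, since the function vanishes outside `[r₀, e + 1]`. It
  -- must be available before `r` is chosen, because `r` is later moved close to `s`.
  refine ⟨Real.exp (|l| * max |r₀| |e + 1|), Real.exp_pos _, fun r s hr hrs hse => ?_⟩
  have hsr : 0 < s - r := by linarith
  have hc : Continuous fun τ : ℝ => (τ - r) / (s - r) := by fun_prop
  refine ⟨fun τ => max 0 (min 1 ((τ - r) / (s - r))) * max 0 (min 1 (e + 1 - τ)) *
    Real.exp (-l * τ), by fun_prop, fun τ => ?_, fun τ hτ => ?_, fun τ hτ => ?_⟩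
  · beta_reduce
    by_cases h1 : τ ≤ r
    · have : (τ - r) / (s - r) ≤ 0 := div_nonpos_of_nonpos_of_nonneg (by linarith) hsr.le
      rw [max_eq_left ((min_le_right _ _).trans this)]
      simp only [zero_mul, norm_zero]; positivity
    by_cases h2 : e + 1 ≤ τ
    · rw [max_eq_left (a := (0 : ℝ)) (b := min 1 (e + 1 - τ))
        ((min_le_right _ _).trans (by linarith))]
      simp only [mul_zero, zero_mul, norm_zero]; positivity
    have b1 : ∀ y : ℝ, 0 ≤ max 0 (min 1 y) ∧ max 0 (min 1 y) ≤ 1 := fun y =>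
      ⟨le_max_left _ _, max_le zero_le_one (min_le_left _ _)⟩
    have b2 := mul_le_one₀ (b1 ((τ - r) / (s - r))).2 (b1 (e + 1 - τ)).1 (b1 (e + 1 - τ)).2
    have b3 : 0 ≤ max 0 (min 1 ((τ - r) / (s - r))) * max 0 (min 1 (e + 1 - τ)) :=
      mul_nonneg (b1 _).1 (b1 _).1
    rw [Real.norm_of_nonneg (mul_nonneg b3 (Real.exp_pos _).le)]
    refine (mul_le_of_le_one_left (Real.exp_pos _).le b2).trans (Real.exp_le_exp.2 ?_)
    have b4 : |τ| ≤ max |r₀| |e + 1| := abs_le_max_abs_abs (by linarith) (by linarith)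
    calc -l * τ ≤ |-l * τ| := le_abs_self _
      _ = |l| * |τ| := by rw [abs_mul, abs_neg]
      _ ≤ _ := mul_le_mul_of_nonneg_left b4 (abs_nonneg _)
  · have : (τ - r) / (s - r) ≤ 0 := div_nonpos_of_nonpos_of_nonneg (by linarith) hsr.le
    simp only
    rw [max_eq_left ((min_le_right _ _).trans this)]; simp
  · have h1 : 1 ≤ (τ - r) / (s - r) := by rw [le_div_iff₀ hsr]; linarith [hτ.1]
    simp only
    rw [min_eq_left h1, min_eq_left (by linarith [hτ.2])]
    norm_num

/-- A compactly supported `C^1`-function that equals `exp (λ τ)` on a neighbourhood of `[s, e]`. -/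
theorem exists_smooth_expCutoff (l s e : ℝ) : ∃ ρ ρ' : ℝ → ℝ, ∃ C : ℝ, 0 < C ∧ Continuous ρ ∧
    Continuous ρ' ∧ (∀ r q, ρ q - ρ r = ∫ τ in r..q, ρ' τ) ∧ (∀ τ, ‖ρ τ‖ ≤ C) ∧ (∀ τ, ‖ρ' τ‖ ≤ C) ∧
    ∀ τ ∈ Icc s e, ρ τ = Real.exp (l * τ) ∧ ρ' τ = l * ρ τ := by
  let χ : ContDiffBump ((s + e) / 2) := ⟨|e - s| / 2 + 1, |e - s| / 2 + 2, by positivity, by linarith⟩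
  set ρ : ℝ → ℝ := fun τ => χ τ * Real.exp (l * τ) with hρ
  have hcd : ContDiff ℝ 1 ρ := χ.contDiff.mul (by fun_prop)
  have hcs : HasCompactSupport ρ := χ.hasCompactSupport.mul_right
  have hc' : Continuous (deriv ρ) := hcd.continuous_deriv le_rfl
  obtain ⟨C1, hC1⟩ := hcd.continuous.bounded_above_of_compact_support hcs
  obtain ⟨C2, hC2⟩ := hc'.bounded_above_of_compact_support hcs.deriv
  refine ⟨ρ, deriv ρ, max (max C1 C2) 1, by positivity, hcd.continuous, hc', fun r q => ?_,
    fun τ => (hC1 τ).trans ((le_max_left _ _).trans (le_max_left _ _)),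
    fun τ => (hC2 τ).trans ((le_max_right _ _).trans (le_max_left _ _)), fun τ hτ => ?_⟩
  · rw [intervalIntegral.integral_deriv_eq_sub (fun x _ => (hcd.differentiable one_ne_zero) x)
      (hc'.intervalIntegrable _ _)]
  · have hball : Metric.ball ((s + e) / 2) (|e - s| / 2 + 1) ∈ 𝓝 τ := by
      refine Metric.isOpen_ball.mem_nhds ?_
      rw [Metric.mem_ball, Real.dist_eq, abs_lt]
      have := le_abs_self (e - s)
      constructor <;> linarith [hτ.1, hτ.2]
    have heq : ρ =ᶠ[𝓝 τ] fun y => Real.exp (l * y) := by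
      filter_upwards [hball] with y hy
      simp only [hρ]
      rw [χ.one_of_mem_closedBall (Metric.ball_subset_closedBall hy), one_mul]
    refine ⟨heq.self_of_nhds, ?_⟩
    rw [heq.deriv_eq, heq.self_of_nhds]
    have := (((hasDerivAt_id τ).const_mul l).exp).deriv
    simp only [id] at this
    rw [this]; ring

/-- Every initial value is the approximate initial value of approximate solutions in `F_p`. -/
theorem IsStableFamily.exists_isFp_approx (h : IsStableFamily I p A M w w') {s e : ℝ}
    (hs : s ∈ I) (he : e ∈ I) (hse : s ≤ e) (x : X) {ε : ℝ} (hε : 0 < ε) :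
    ∃ v v' g : ℝ → X, IsFp I p A v v' g ∧ ‖v s - x‖ ≤ ε ∧
      eLpNorm (-v' + g) p (volume.restrict (Icc s e)) ≤ ENNReal.ofReal ε := by
  have hp : 1 ≤ p := Fact.out
  have hM := h.kato.nonneg
  have hlt := h.lt
  have hsub : Icc s e ⊆ I := Set.OrdConnected.out ‹_› hs he
  -- `v₀` has nearly the right initial value but an uncontrolled residual `h₀`. If `(w' - G_0) v` is
  -- close to `e^{-w'τ} h₀` on `[s, e]`, then `e^{w'τ} v` nearly cancels `h₀` there: the sum has
  -- residual `ρ d` on `[s, e]`, where `d` is the error in solving for `v`.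
  obtain ⟨v₀, v₀', g₀, hF₀, hv₀⟩ := h.exists_isFp_norm_apply_sub_le hs x (half_pos hε)
  set h₀ : ℝ → X := fun τ => g₀ τ - v₀' τ with hh₀
  have hh₀E : MemE I p h₀ := by
    have h1 := hF₀.memE.add (hF₀.w10.memE'.smul (-1 : 𝕜))
    have : g₀ + (-1 : 𝕜) • v₀' = h₀ := by ext τ; simp [hh₀, sub_eq_add_neg]
    rwa [this] at h1
  obtain ⟨r₀, hr₀, hr₀s⟩ := h.leftOpen.exists_lt s hs
  obtain ⟨C₁, hC₁, hκ⟩ := exists_expCutoff w' (r₀ := r₀) (e := e)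
  obtain ⟨ρ, ρ', C₂, hC₂, hρc, hρ'c, hρp, hρb, hρ'b, hρe⟩ := exists_smooth_expCutoff w' s e
  obtain ⟨C₃, hC₃, hH⟩ := exists_integral_exp_mul_norm_le (X := X) hp
    (δ := (w' - w) / 2) (by linarith)
  -- the choice of the ramp
  set η := ε / 2 / (C₂ * (M + 1) * (C₁ + C₃) + C₂) with hη
  have hη0 : 0 < η := by positivity
  -- The estimate for `v s` sees the data `κ h₀` only up to time `s`. As `κ` vanishes to the left of
  -- `r`, a short ramp `[r, s]` keeps `v s` small. In `η` the summand with `M + 1` pays for `ρ s • v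
  -- s` and the summand `C₂` for the residual.
  obtain ⟨r, hrI, hr₀r, hrs, hrint⟩ : ∃ r ∈ I, r₀ ≤ r ∧ r < s ∧ ∫ τ in r..s, ‖h₀ τ‖ ≤ η := by
    have hi : IntervalIntegrable (fun τ => ‖h₀ τ‖) volume r₀ s :=
      (hh₀E.intervalIntegrable hr₀ hs).norm
    have hc : ContinuousOn (fun r => ∫ τ in r₀..r, ‖h₀ τ‖) (Icc r₀ s) :=
      continuousOn_of_primitive hr₀s.le hi (fun r _ => by simp)
    have h1 := (hc s ⟨hr₀s.le, le_rfl⟩).mono (Ico_subset_Icc_self)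
    have h2 : ∀ᶠ r in 𝓝[Ico r₀ s] s,
        (∫ τ in r₀..s, ‖h₀ τ‖) - η < ∫ τ in r₀..r, ‖h₀ τ‖ :=
      h1.eventually (lt_mem_nhds (by linarith))
    have hne : (𝓝[Ico r₀ s] s).NeBot := by
      rw [nhdsWithin_Ico_eq_nhdsLT hr₀s]; infer_instance
    obtain ⟨r, hr1, hr2⟩ := (h2.and self_mem_nhdsWithin).exists
    refine ⟨r, Set.OrdConnected.out ‹_› hr₀ hs (Ico_subset_Icc_self hr2), hr2.1, hr2.2, ?_⟩
    have h3 := intervalIntegral.integral_add_adjacent_intervals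
      (hi.mono_Icc ⟨le_rfl, hr₀s.le⟩ (Ico_subset_Icc_self hr2))
      (hi.mono_Icc (Ico_subset_Icc_self hr2) ⟨hr₀s.le, le_rfl⟩)
    linarith
  obtain ⟨κ, hκc, hκb, hκ0, hκe⟩ := hκ r s hr₀r hrs hse
  have hkE : MemE I p (fun τ => κ τ • h₀ τ) := hh₀E.smul_bounded hκc.continuousOn fun t _ => hκb t
  obtain ⟨v, v', g, hF, herr⟩ := h.exists_isFp_eLpNorm_sub_le hkE hη0
  set d : ℝ → X := fun τ => κ τ • h₀ τ - (w' • v τ + v' τ - g τ) with hd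
  have hzE : MemE I p (fun τ => w' • v τ + v' τ - g τ) := by
    have h1 := ((hF.w10.memE.smul (w' : 𝕜)).add hF.w10.memE').add (hF.memE.smul (-1 : 𝕜))
    have : (w' : 𝕜) • v + v' + (-1 : 𝕜) • g = fun τ => w' • v τ + v' τ - g τ := by
      ext τ
      simp only [Pi.add_apply, Pi.smul_apply, RCLike.real_smul_eq_coe_smul (K := 𝕜)]
      module
    rwa [this] at h1
  have hdL : MemLp d p (volume.restrict I) := hkE.1.sub hzE.1
  have hdn : ∀ a ∈ I, ∀ b ∈ I, (eLpNorm d p (volume.restrict (Icc a b))).toReal ≤ η := by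
    intro a ha b hb
    have h1 := (eLpNorm_mono_measure d (Measure.restrict_mono
      (Set.OrdConnected.out ‹_› ha hb) le_rfl)).trans herr
    exact (ENNReal.toReal_mono ENNReal.ofReal_ne_top h1).trans_eq (ENNReal.toReal_ofReal hη0.le)
  have hvs : ‖v s‖ ≤ M * ((C₁ + C₃) * η) := by
    refine h.norm_le_of_isFp hF hs fun a ha has => ?_
    have hδ : 0 ≤ (w' - w) / 2 := by linarith
    have hki : IntervalIntegrable (fun τ => κ τ • h₀ τ) volume a s := hkE.intervalIntegrable ha hs
    have hdi : IntervalIntegrable d volume a s := hki.sub (hzE.intervalIntegrable ha hs)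
    have hdei : IntervalIntegrable (fun τ => Real.exp (-((w' - w) / 2) * (s - τ)) * ‖d τ‖)
        volume a s := hdi.norm.continuousOn_smul_Icc has
          (ρ := fun τ => Real.exp (-((w' - w) / 2) * (s - τ))) (by fun_prop)
    have hdMem : MemLp d p (volume.restrict (Icc a s)) :=
      hdL.mono_measure (Measure.restrict_mono (Set.OrdConnected.out ‹_› ha hs) le_rfl)
    have e1 : ∫ τ in a..s, Real.exp (-((w' - w) / 2) * (s - τ)) * ‖d τ‖ ≤ C₃ * η :=
      (hH a s has d hdMem).trans (mul_le_mul_of_nonneg_left (hdn a ha s hs) hC₃.le)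
    have e2 : ∫ τ in a..s, ‖κ τ • h₀ τ‖ ≤ C₁ * η := by
      have hle : ∀ c ∈ I, c ≤ s → r ≤ c → ∫ τ in c..s, ‖κ τ • h₀ τ‖ ≤ C₁ * η := by
        intro c hc hcs hrc
        have hi := (hh₀E.intervalIntegrable hrI hs).norm
        calc ∫ τ in c..s, ‖κ τ • h₀ τ‖ ≤ ∫ τ in c..s, C₁ * ‖h₀ τ‖ := by
              refine intervalIntegral.integral_mono_on hcs (hkE.intervalIntegrable hc hs).norm
                ((hh₀E.intervalIntegrable hc hs).norm.const_mul _) fun τ _ => ?_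
              rw [norm_smul]; exact mul_le_mul_of_nonneg_right (hκb τ) (norm_nonneg _)
          _ = C₁ * ∫ τ in c..s, ‖h₀ τ‖ := intervalIntegral.integral_const_mul _ _
          _ ≤ C₁ * ∫ τ in r..s, ‖h₀ τ‖ := by
              refine mul_le_mul_of_nonneg_left ?_ hC₁.le
              exact intervalIntegral.integral_mono_interval hrc hcs le_rfl
                (Eventually.of_forall fun _ => norm_nonneg _) hi
          _ ≤ _ := mul_le_mul_of_nonneg_left hrint hC₁.le
      rcases le_total r a with hra | har
      · exact hle a ha has hra
      · rw [← intervalIntegral.integral_add_adjacent_intervals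
          (hkE.intervalIntegrable ha hrI).norm (hkE.intervalIntegrable hrI hs).norm]
        have : ∫ τ in a..r, ‖κ τ • h₀ τ‖ = 0 := by
          rw [intervalIntegral.integral_congr (g := fun _ => (0 : ℝ)), intervalIntegral.integral_zero]
          intro τ hτ
          rw [uIcc_of_le har] at hτ
          simp [hκ0 τ hτ.2]
        rw [this, zero_add]
        exact hle r hrI hrs.le le_rfl
    calc _ ≤ ∫ τ in a..s, (‖κ τ • h₀ τ‖ + Real.exp (-((w' - w) / 2) * (s - τ)) * ‖d τ‖) := by
          refine intervalIntegral.integral_mono_on has ?_ (hki.norm.add hdei) fun τ hτ => ?_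
          · exact (hzE.intervalIntegrable ha hs).norm.continuousOn_smul_Icc has
              (ρ := fun τ => Real.exp (-((w' - w) / 2) * (s - τ))) (by fun_prop)
          · have h1 : Real.exp (-((w' - w) / 2) * (s - τ)) ≤ 1 := Real.exp_le_one_iff.2 (by
              have := mul_nonneg hδ (sub_nonneg.2 hτ.2); linarith)
            have h2 : ‖w' • v τ + v' τ - g τ‖ ≤ ‖κ τ • h₀ τ‖ + ‖d τ‖ := by
              refine le_trans (le_of_eq ?_) (norm_sub_le _ _)
              congr 1; simp only [hd]; abel
            have h3 := mul_le_mul_of_nonneg_left h2 (Real.exp_pos (-((w' - w) / 2) * (s - τ))).le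
            rw [mul_add] at h3
            exact h3.trans (add_le_add_left (mul_le_of_le_one_left (norm_nonneg _) h1) _)
      _ = _ := intervalIntegral.integral_add hki.norm hdei
      _ ≤ _ := by rw [add_mul]; exact add_le_add e2 e1
  have hFρ := hF.smul_cutoff hρ'c.continuousOn (fun r _ q _ => hρp r q) hρc.continuousOn
    (fun t _ => hρb t) (fun t _ => hρ'b t)
  refine ⟨_, _, _, hF₀.add hFρ, ?_, ?_⟩
  · have h1 : ‖ρ s • v s‖ ≤ C₂ * (M * ((C₁ + C₃) * η)) := by
      rw [norm_smul]; exact mul_le_mul (hρb s) hvs (norm_nonneg _) hC₂.le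
    have h2 : C₂ * (M * ((C₁ + C₃) * η)) ≤ ε / 2 := by
      have : (C₂ * (M + 1) * (C₁ + C₃) + C₂) * η = ε / 2 := by rw [hη]; field_simp
      have h3 : 0 ≤ C₂ * (C₁ + C₃) * η + C₂ * η := by positivity
      linarith
    have h3 : v₀ s + ρ s • v s - x = (v₀ s - x) + ρ s • v s := by abel
    simp only [Pi.add_apply]
    rw [h3]
    refine (norm_add_le _ _).trans ?_
    linarith
  · have hae : ∀ᵐ τ ∂volume.restrict (Icc s e),
        ‖(-(v₀' + fun t => ρ' t • v t + ρ t • v' t) + (g₀ + fun t => ρ t • g t)) τ‖ ≤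
          C₂ * ‖d τ‖ := by
      filter_upwards [ae_restrict_mem measurableSet_Icc] with τ hτ
      obtain ⟨h1, h2⟩ := hρe τ hτ
      have h3 : ρ τ * κ τ = 1 := by rw [h1, hκe τ hτ, ← Real.exp_add]; simp
      have h4 : (-(v₀' + fun t => ρ' t • v t + ρ t • v' t) + (g₀ + fun t => ρ t • g t)) τ =
          ρ τ • d τ := by
        simp only [hd, Pi.add_apply, Pi.neg_apply, smul_sub, smul_smul, h3, h2, smul_add, hh₀]
        rw [mul_comm w']
        module
      rw [h4, norm_smul]
      exact mul_le_mul_of_nonneg_right (hρb τ) (norm_nonneg _)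
    refine (eLpNorm_le_mul_eLpNorm_of_ae_le_mul hae p).trans ?_
    have h5 := (eLpNorm_mono_measure d (Measure.restrict_mono hsub le_rfl)).trans herr
    calc _ ≤ ENNReal.ofReal C₂ * ENNReal.ofReal η := by gcongr
      _ = ENNReal.ofReal (C₂ * η) := (ENNReal.ofReal_mul hC₂.le).symm
      _ ≤ _ := by
        refine ENNReal.ofReal_le_ofReal ?_
        have : (C₂ * (M + 1) * (C₁ + C₃) + C₂) * η = ε / 2 := by rw [hη]; field_simp
        have h3 : 0 ≤ C₂ * (M + 1) * (C₁ + C₃) * η := by positivity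
        linarith

end Existence

end EvolutionSemigroup

/-! ### The propagator as a limit of approximate solutions, and its evolution family. -/

namespace EvolutionSemigroup

section Integral

variable {X : Type*} [NormedAddCommGroup X]

theorem exists_integral_norm_sub_le_eLpNorm {p : ℝ≥0∞} (hp : 1 ≤ p) (ℓ : ℝ) : ∃ C : ℝ, 0 < C ∧
    ∀ s t : ℝ, s ≤ t → t - s ≤ ℓ → ∀ u' g : ℝ → X,
      MemLp (-u' + g) p (volume.restrict (Icc s t)) → ∫ τ in s..t, ‖u' τ - g τ‖ ≤
        C * (eLpNorm (-u' + g) p (volume.restrict (Icc s t))).toReal := by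
  obtain ⟨C, hC, hCi⟩ := exists_integral_norm_le_eLpNorm (X := X) hp ℓ
  refine ⟨C, hC, fun s t hst hℓ u' g hL => le_trans (le_of_eq ?_) (hCi s t hst hℓ _ hL)⟩
  refine intervalIntegral.integral_congr fun τ _ => ?_
  simp only [Pi.add_apply, Pi.neg_apply]
  rw [← norm_neg]; congr 1; abel

end Integral

section Propagator

variable {𝕜 : Type*} [RCLike 𝕜] {X : Type*} [NormedAddCommGroup X] [NormedSpace 𝕜 X]
  [NormedSpace ℝ X]

/-- `U` propagates every regular function up to the error it makes in the equation
`u' = A(t) u`. -/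
def IsPropagator (I : Set ℝ) (A : ℝ → X →ₗ.[𝕜] X) (M w' : ℝ) (U : ℝ → ℝ → X →L[𝕜] X) : Prop :=
  ∀ s ∈ I, ∀ t ∈ I, s ≤ t → ∀ ℓ : ℝ, t - s ≤ ℓ → ∀ u u' g : ℝ → X, IsRegularOn A s t u u' g →
    ∀ x : X, ‖u t - U t s x‖ ≤
      M * Real.exp (|w'| * ℓ) ^ 2 * (‖u s - x‖ + ∫ τ in s..t, ‖u' τ - g τ‖)

theorem IsPropagator.congr {I : Set ℝ} {A : ℝ → X →ₗ.[𝕜] X} {M w' : ℝ} {U V : ℝ → ℝ → X →L[𝕜] X}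
    (hU : IsPropagator I A M w' U) (hVU : ∀ s ∈ I, ∀ t ∈ I, s ≤ t → V t s = U t s) :
    IsPropagator I A M w' V := by
  intro s hs t ht hst
  rw [hVU s hs t ht hst]
  exact hU s hs t ht hst

variable {I : Set ℝ} [I.OrdConnected] {A : ℝ → X →ₗ.[𝕜] X} {M w' : ℝ} {U : ℝ → ℝ → X →L[𝕜] X}

/-- Approximate solutions in `F_p` are close to the orbits of the propagator, uniformly. -/
theorem IsPropagator.norm_sub_le (hU : IsPropagator I A M w' U) (hM : 0 ≤ M) {s e : ℝ} (hs : s ∈ I)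
    (he : e ∈ I) {u u' g : ℝ → X} (hu : IsRegularOn A s e u u' g) {x : X} {ε : ℝ}
    (h1 : ‖u s - x‖ ≤ ε) (h2 : ∫ τ in s..e, ‖u' τ - g τ‖ ≤ ε) {t : ℝ} (ht : t ∈ Icc s e) :
    ‖u t - U t s x‖ ≤ M * Real.exp (|w'| * (e - s)) ^ 2 * (2 * ε) := by
  refine (hU s hs t (Set.OrdConnected.out ‹_› hs he ht) ht.1 (e - s) (by linarith [ht.2]) u u' g
    (hu.mono ⟨le_rfl, ht.1.trans ht.2⟩ ht) x).trans (mul_le_mul_of_nonneg_left ?_ (by positivity))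
  have := intervalIntegral.integral_mono_interval le_rfl ht.1 ht.2
    (Eventually.of_forall fun τ => norm_nonneg (u' τ - g τ))
    (hu.integrable'.sub hu.integrable).norm
  linarith

variable [IsScalarTower ℝ 𝕜 X] [CompleteSpace X]
  {p : ℝ≥0∞} [Fact (1 ≤ p)] {w : ℝ}

theorem IsStableFamily.exists_isFp_approx_integral (h : IsStableFamily I p A M w w') {s e : ℝ}
    (hs : s ∈ I) (he : e ∈ I) (hse : s ≤ e) (x : X) {ε : ℝ} (hε : 0 < ε) :
    ∃ v v' g : ℝ → X, IsFp I p A v v' g ∧ ‖v s - x‖ ≤ ε ∧ ∫ τ in s..e, ‖v' τ - g τ‖ ≤ ε := by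
  obtain ⟨C, hC, hCi⟩ := exists_integral_norm_sub_le_eLpNorm (X := X) (p := p) Fact.out (e - s)
  obtain ⟨v, v', g, hF, h1, h2⟩ := h.exists_isFp_approx hs he hse x (ε := min ε (ε / C))
    (lt_min hε (by positivity))
  refine ⟨v, v', g, hF, h1.trans (min_le_left _ _), ?_⟩
  refine (hCi s e hse le_rfl v' g
    ((hF.w10.memE'.memLp_Icc hs he).neg.add (hF.memE.memLp_Icc hs he))).trans ?_
  rw [← le_div_iff₀' hC]
  refine (ENNReal.toReal_mono ENNReal.ofReal_ne_top
    (h2.trans (ENNReal.ofReal_le_ofReal (min_le_right _ _)))).trans_eq ?_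
  exact ENNReal.toReal_ofReal (by positivity)

theorem IsStableFamily.norm_sub_le (h : IsStableFamily I p A M w w') {s t : ℝ} (hs : s ∈ I)
    (ht : t ∈ I) (hst : s ≤ t) {ℓ : ℝ} (hℓ : t - s ≤ ℓ) {u u' g v v' k : ℝ → X}
    (hu : IsRegularOn A s t u u' g) (hv : IsRegularOn A s t v v' k) (x : X) {ε : ℝ}
    (h1 : ‖v s - x‖ ≤ ε) (h2 : ∫ τ in s..t, ‖v' τ - k τ‖ ≤ ε) :
    ‖u t - v t‖ ≤ M * Real.exp (|w'| * ℓ) ^ 2 *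
      (‖u s - x‖ + (∫ τ in s..t, ‖u' τ - g τ‖) + 2 * ε) := by
  have hM := h.kato.nonneg
  refine (h.norm_le_mul hs ht hst hℓ (hu.sub hv)).trans ?_
  refine mul_le_mul_of_nonneg_left ?_ (by positivity)
  have h3 := hu.integral_norm_sub_le hst hv
  have h4 : ‖(u - v) s‖ ≤ ‖u s - x‖ + ‖v s - x‖ := by
    refine le_trans (le_of_eq ?_) (_root_.norm_sub_le _ _)
    congr 1; simp only [Pi.sub_apply]; abel
  linarith

/-- Approximate solutions with errors `1 / (n + 1)` form a Cauchy sequence at `t` by stability.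
Comparing an arbitrary regular `u` with them and passing to the limit gives the inequality. The
bound `ℓ` is quantified after `y`, so a single value serves all lengths. -/
theorem IsStableFamily.exists_propagated_value (h : IsStableFamily I p A M w w') {s t : ℝ}
    (hs : s ∈ I) (ht : t ∈ I) (hst : s ≤ t) (x : X) :
    ∃ y : X, ∀ ℓ : ℝ, t - s ≤ ℓ → ∀ u u' g : ℝ → X, IsRegularOn A s t u u' g →
      ‖u t - y‖ ≤ M * Real.exp (|w'| * ℓ) ^ 2 * (‖u s - x‖ + ∫ τ in s..t, ‖u' τ - g τ‖) := by
  have hM := h.kato.nonneg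
  have hε : ∀ n : ℕ, (0 : ℝ) < 1 / (n + 1) := fun n => by positivity
  choose v v' g hF h1 h2 using fun n : ℕ => h.exists_isFp_approx_integral hs ht hst x (hε n)
  have hlim : Tendsto (fun n : ℕ => (1 : ℝ) / (n + 1)) atTop (𝓝 0) :=
    tendsto_one_div_add_atTop_nhds_zero_nat
  have hcau : CauchySeq fun n => v n t := by
    set K := M * Real.exp (|w'| * (t - s)) ^ 2 with hK
    refine cauchySeq_of_le_tendsto_0 (fun n : ℕ => K * (4 * (1 / (n + 1)))) ?_ ?_
    · intro n m N hn hm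
      rw [dist_eq_norm]
      have hmono : ∀ k : ℕ, N ≤ k → (1 : ℝ) / (k + 1) ≤ 1 / (N + 1) := fun k hk =>
        one_div_le_one_div_of_le (by positivity) (by exact_mod_cast Nat.succ_le_succ hk)
      refine (h.norm_sub_le hs ht hst le_rfl ((hF n).isRegularOn hs ht) ((hF m).isRegularOn hs ht)
        x ((h1 m).trans (hmono m hm)) ((h2 m).trans (hmono m hm))).trans ?_
      refine mul_le_mul_of_nonneg_left ?_ (by positivity)
      have := (h1 n).trans (hmono n hn)
      have := (h2 n).trans (hmono n hn)
      linarith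
    · simpa using (hlim.const_mul 4).const_mul K
  obtain ⟨y, hy⟩ := cauchySeq_tendsto_of_complete hcau
  refine ⟨y, fun ℓ hℓ u u' k hu => ?_⟩
  have hL : Tendsto (fun n => ‖u t - v n t‖) atTop (𝓝 ‖u t - y‖) :=
    (tendsto_const_nhds.sub hy).norm
  have hR : Tendsto (fun n : ℕ => M * Real.exp (|w'| * ℓ) ^ 2 *
      (‖u s - x‖ + (∫ τ in s..t, ‖u' τ - k τ‖) + 2 * (1 / (n + 1)))) atTop
      (𝓝 (M * Real.exp (|w'| * ℓ) ^ 2 *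
        (‖u s - x‖ + (∫ τ in s..t, ‖u' τ - k τ‖) + 2 * 0))) :=
    ((hlim.const_mul 2).const_add _).const_mul _
  rw [mul_zero, add_zero] at hR
  exact le_of_tendsto_of_tendsto' hL hR fun n =>
    h.norm_sub_le hs ht hst hℓ hu ((hF n).isRegularOn hs ht) x (h1 n) (h2 n)

theorem eq_of_forall_norm_sub_le_mul {E : Type*} [NormedAddCommGroup E] {x y : E} {C : ℝ}
    (h : ∀ ε > 0, ‖x - y‖ ≤ C * ε) : x = y := by
  have h1 : Tendsto (fun ε : ℝ => C * ε) (𝓝[>] 0) (𝓝 (C * 0)) :=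
    ((continuous_const.mul continuous_id).tendsto 0).mono_left nhdsWithin_le_nhds
  rw [mul_zero] at h1
  have h2 : ‖x - y‖ ≤ 0 := ge_of_tendsto h1 (by
    filter_upwards [self_mem_nhdsWithin] with ε hε using h ε hε)
  exact sub_eq_zero.1 (norm_le_zero_iff.1 h2)

/-- Sums and multiples of approximate solutions are approximate solutions, and the inequality
determines the limit value uniquely; hence linearity. The growth exponent is a midpoint: it must
exceed `w` for the a priori estimate and stay below `w'`, at which the range is known to be dense.
-/
theorem IsStableFamily.exists_propagated_clm (h : IsStableFamily I p A M w w') {s t : ℝ}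
    (hs : s ∈ I) (ht : t ∈ I) (hst : s ≤ t) :
    ∃ L : X →L[𝕜] X, ‖L‖ ≤ M * Real.exp ((w + w') / 2 * (t - s)) ∧
      ∀ ℓ : ℝ, t - s ≤ ℓ → ∀ u u' g : ℝ → X, IsRegularOn A s t u u' g → ∀ x : X,
      ‖u t - L x‖ ≤ M * Real.exp (|w'| * ℓ) ^ 2 * (‖u s - x‖ + ∫ τ in s..t, ‖u' τ - g τ‖) := by
  have hM := h.kato.nonneg
  have hlt := h.lt
  choose φ hφ using fun x : X => h.exists_propagated_value hs ht hst x
  set K := M * Real.exp (|w'| * (t - s)) ^ 2 with hK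
  have hK0 : 0 ≤ K := by positivity
  have happ : ∀ x : X, ∀ ε > 0, ∃ v v' g, IsRegularOn A s t v v' g ∧ ‖v s - x‖ ≤ ε ∧
      ∫ τ in s..t, ‖v' τ - g τ‖ ≤ ε := fun x ε hε => by
    obtain ⟨v, v', g, hF, h1, h2⟩ := h.exists_isFp_approx_integral hs ht hst x hε
    exact ⟨v, v', g, hF.isRegularOn hs ht, h1, h2⟩
  have hadd : ∀ x y, φ (x + y) = φ x + φ y := by
    intro x y
    refine eq_of_forall_norm_sub_le_mul (C := 8 * K) fun ε hε => ?_
    obtain ⟨v, v', g, hv, h1, h2⟩ := happ x ε hε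
    obtain ⟨u, u', k, hu, h3, h4⟩ := happ y ε hε
    have e1 := hφ x _ le_rfl v v' g hv
    have e2 := hφ y _ le_rfl u u' k hu
    have e3 := hφ (x + y) _ le_rfl _ _ _ (hv.add hu)
    have e4 := hv.integral_norm_add_le hst hu
    have e5 : ‖(v + u) s - (x + y)‖ ≤ ‖v s - x‖ + ‖u s - y‖ := by
      refine le_trans (le_of_eq ?_) (norm_add_le _ _)
      congr 1; simp only [Pi.add_apply]; abel
    have e6 : φ (x + y) - (φ x + φ y) = (v t - φ x) + (u t - φ y) - ((v + u) t - φ (x + y)) := by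
      simp only [Pi.add_apply]; abel
    rw [e6]
    refine (_root_.norm_sub_le _ _).trans ?_
    have e7 := norm_add_le (v t - φ x) (u t - φ y)
    have f1 : ‖v t - φ x‖ ≤ K * (2 * ε) := e1.trans (mul_le_mul_of_nonneg_left (by linarith) hK0)
    have f2 : ‖u t - φ y‖ ≤ K * (2 * ε) := e2.trans (mul_le_mul_of_nonneg_left (by linarith) hK0)
    have f3 : ‖(v + u) t - φ (x + y)‖ ≤ K * (4 * ε) :=
      e3.trans (mul_le_mul_of_nonneg_left (by linarith) hK0)
    linarith
  have hsmul : ∀ (c : 𝕜) x, φ (c • x) = c • φ x := by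
    intro c x
    refine eq_of_forall_norm_sub_le_mul (C := 4 * ‖c‖ * K) fun ε hε => ?_
    obtain ⟨v, v', g, hv, h1, h2⟩ := happ x ε hε
    have e1 := hφ x _ le_rfl v v' g hv
    have e3 := hφ (c • x) _ le_rfl _ _ _ (hv.smul_const c)
    have e4 : ∫ τ in s..t, ‖(c • v') τ - (c • g) τ‖ = ‖c‖ * ∫ τ in s..t, ‖v' τ - g τ‖ := by
      rw [← intervalIntegral.integral_const_mul]
      refine intervalIntegral.integral_congr fun τ _ => ?_
      simp only [Pi.smul_apply]
      rw [← smul_sub, norm_smul]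
    have e5 : ‖(c • v) s - c • x‖ = ‖c‖ * ‖v s - x‖ := by
      rw [Pi.smul_apply, ← smul_sub, norm_smul]
    have e6 : φ (c • x) - c • φ x = c • (v t - φ x) - ((c • v) t - φ (c • x)) := by
      simp only [Pi.smul_apply, smul_sub]; abel
    rw [e4, e5, ← mul_add] at e3
    rw [e6]
    refine (_root_.norm_sub_le _ _).trans ?_
    rw [norm_smul]
    have f1 : ‖v t - φ x‖ ≤ K * (2 * ε) := e1.trans (mul_le_mul_of_nonneg_left (by linarith) hK0)
    have f2 := mul_le_mul_of_nonneg_left f1 (norm_nonneg c)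
    have f3 : ‖(c • v) t - φ (c • x)‖ ≤ K * (‖c‖ * (2 * ε)) :=
      e3.trans (mul_le_mul_of_nonneg_left
        (mul_le_mul_of_nonneg_left (by linarith) (norm_nonneg c)) hK0)
    linarith
  have hbd : ∀ x, ‖φ x‖ ≤ M * Real.exp ((w + w') / 2 * (t - s)) * ‖x‖ := by
    intro x
    set ω := (w + w') / 2 with hω
    have hC : Tendsto (fun ε : ℝ => M * Real.exp (ω * (t - s)) *
        (‖x‖ + ε + Real.exp (|ω| * (t - s)) * ε) + K * (2 * ε)) (𝓝[>] 0)
        (𝓝 (M * Real.exp (ω * (t - s)) *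
        (‖x‖ + 0 + Real.exp (|ω| * (t - s)) * 0) + K * (2 * 0))) :=
      (Continuous.tendsto (by fun_prop) 0).mono_left nhdsWithin_le_nhds
    simp only [mul_zero, add_zero] at hC
    refine ge_of_tendsto hC ?_
    filter_upwards [self_mem_nhdsWithin] with ε hε
    obtain ⟨v, v', g, hv, h1, h2⟩ := happ x ε hε
    have e1 := hφ x _ le_rfl v v' g hv
    have e2 := h.norm_le_exp (ω := ω) (by rw [hω]; linarith) hs ht hst hv
    have f1 : ‖v t - φ x‖ ≤ K * (2 * ε) := e1.trans (mul_le_mul_of_nonneg_left (by linarith) hK0)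
    have f2 : ‖v s‖ ≤ ‖x‖ + ε := by
      have := norm_sub_norm_le (v s) x; linarith
    have f3 : ‖φ x‖ ≤ ‖v t‖ + ‖v t - φ x‖ := by
      have := norm_sub_norm_le (φ x) (v t)
      rw [norm_sub_rev] at this; linarith
    refine f3.trans (add_le_add (e2.trans ?_) f1)
    gcongr
  refine ⟨LinearMap.mkContinuous ⟨⟨φ, hadd⟩, hsmul⟩ _ hbd,
    LinearMap.mkContinuous_norm_le _ (by positivity) _, fun ℓ hℓ u u' g hu x => ?_⟩
  exact hφ x ℓ hℓ u u' g hu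

theorem IsStableFamily.exists_propagator (h : IsStableFamily I p A M w w') :
    ∃ U : ℝ → ℝ → X →L[𝕜] X, IsPropagator I A M w' U ∧
      ∀ s ∈ I, ∀ t ∈ I, s ≤ t → ‖U t s‖ ≤ M * Real.exp ((w + w') / 2 * (t - s)) := by
  classical
  refine ⟨fun t s => if hst : s ∈ I ∧ t ∈ I ∧ s ≤ t then
    (h.exists_propagated_clm hst.1 hst.2.1 hst.2.2).choose else 0, ?_, ?_⟩
  · intro s hs t ht hst ℓ hℓ u u' g hu x
    beta_reduce
    rw [dif_pos ⟨hs, ht, hst⟩]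
    exact (h.exists_propagated_clm hs ht hst).choose_spec.2 ℓ hℓ u u' g hu x
  · intro s hs t ht hst
    beta_reduce
    rw [dif_pos ⟨hs, ht, hst⟩]
    exact (h.exists_propagated_clm hs ht hst).choose_spec.1

/-- A single approximate solution on `[s, t]` follows `U(·, s)x` up to `t` and, restarted at `r`,
also `U(·, r) U(r, s)x`. -/
theorem IsPropagator.comp_apply (h : IsStableFamily I p A M w w') (hU : IsPropagator I A M w' U)
    {s r t : ℝ} (hs : s ∈ I) (hr : r ∈ I) (ht : t ∈ I) (hsr : s ≤ r) (hrt : r ≤ t) (x : X) :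
    U t r (U r s x) = U t s x := by
  have hM := h.kato.nonneg
  set K := M * Real.exp (|w'| * (t - s)) ^ 2 with hK
  have hK0 : 0 ≤ K := by positivity
  refine eq_of_forall_norm_sub_le_mul (C := K * (K * 2 + 1) + K * 2) fun ε hε => ?_
  obtain ⟨v, v', g, hF, h1, h2⟩ := h.exists_isFp_approx_integral hs ht (hsr.trans hrt) x hε
  have hv := hF.isRegularOn hs ht
  have e1 := hU.norm_sub_le hM hs ht hv h1 h2 (t := r) ⟨hsr, hrt⟩
  have e2 := hU.norm_sub_le hM hs ht hv h1 h2 (t := t) ⟨hsr.trans hrt, le_rfl⟩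
  have e3 := hU r hr t ht hrt (t - s) (by linarith) v v' g
    (hv.mono ⟨hsr, hrt⟩ ⟨hsr.trans hrt, le_rfl⟩) (U r s x)
  have e4 := intervalIntegral.integral_mono_interval hsr hrt le_rfl
    (Eventually.of_forall fun τ => norm_nonneg (v' τ - g τ)) (hv.integrable'.sub hv.integrable).norm
  have e5 : ‖v t - U t r (U r s x)‖ ≤ K * (K * (2 * ε) + ε) :=
    e3.trans (mul_le_mul_of_nonneg_left (by linarith) hK0)
  have e6 : U t r (U r s x) - U t s x = (v t - U t s x) - (v t - U t r (U r s x)) := by abel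
  rw [e6]
  refine (_root_.norm_sub_le _ _).trans ?_
  linarith

theorem IsPropagator.refl_apply (h : IsStableFamily I p A M w w') (hU : IsPropagator I A M w' U)
    {t : ℝ} (ht : t ∈ I) (x : X) : U t t x = x := by
  have hM := h.kato.nonneg
  refine eq_of_forall_norm_sub_le_mul (C := M * 2 + 1) fun ε hε => ?_
  obtain ⟨v, v', g, hF, h1, h2⟩ := h.exists_isFp_approx_integral ht ht le_rfl x hε
  have e2 := hU.norm_sub_le hM ht ht (hF.isRegularOn ht ht) h1 h2 (t := t) ⟨le_rfl, le_rfl⟩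
  simp only [sub_self, mul_zero, Real.exp_zero, one_pow, mul_one] at e2
  have e6 : U t t x - x = (v t - x) - (v t - U t t x) := by abel
  rw [e6]
  refine (_root_.norm_sub_le _ _).trans ?_
  linarith

/-- The orbit is the uniform limit on `[s, e]` of functions in `F_p`, which are continuous. -/
theorem IsPropagator.continuousOn_left (h : IsStableFamily I p A M w w')
    (hU : IsPropagator I A M w' U) {s e : ℝ} (hs : s ∈ I) (he : e ∈ I) (hse : s ≤ e) (x : X) :
    ContinuousOn (fun t => U t s x) (Icc s e) := by
  have hM := h.kato.nonneg
  have hε : ∀ n : ℕ, (0 : ℝ) < 1 / (n + 1) := fun n => by positivity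
  choose v v' g hF h1 h2 using fun n : ℕ => h.exists_isFp_approx_integral hs he hse x (hε n)
  have hu : TendstoUniformlyOn v (fun t => U t s x) atTop (Icc s e) := by
    rw [Metric.tendstoUniformlyOn_iff]
    intro ε hε
    have hlim : Tendsto (fun n : ℕ => M * Real.exp (|w'| * (e - s)) ^ 2 *
        (2 * ((1 : ℝ) / (n + 1)))) atTop (𝓝 (M * Real.exp (|w'| * (e - s)) ^ 2 * (2 * 0))) :=
      (tendsto_one_div_add_atTop_nhds_zero_nat.const_mul 2).const_mul _
    rw [mul_zero, mul_zero] at hlim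
    filter_upwards [hlim.eventually (gt_mem_nhds hε)] with n hn t ht
    rw [dist_comm, dist_eq_norm]
    exact (hU.norm_sub_le hM hs he ((hF n).isRegularOn hs he) (h1 n) (h2 n) ht).trans_lt hn
  exact hu.continuousOn (Eventually.of_forall fun n =>
    (hF n).w10.memC0.1.mono (Set.OrdConnected.out ‹_› hs he)).frequently

/-- `U r q x → x` as `q ≤ r` both tend to `s`. -/
theorem IsPropagator.tendsto_diag (h : IsStableFamily I p A M w w') (hU : IsPropagator I A M w' U)
    {s : ℝ} (hs : s ∈ I) (x : X) {ε : ℝ} (hε : 0 < ε) :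
    ∀ᶠ δ in 𝓝[>] (0 : ℝ), ∀ r ∈ I, ∀ q ∈ I, q ≤ r → |r - s| < δ → |q - s| < δ →
      ‖U r q x - x‖ ≤ ε := by
  have hM := h.kato.nonneg
  set K := M * Real.exp (|w'| * 2) ^ 2 with hK
  have hK0 : 0 ≤ K := by positivity
  set η := ε / (2 * (2 * K + 1)) with hη
  have hη0 : 0 < η := by positivity
  -- Here `v` need not be an approximate solution: it is fixed, and its residual has a small
  -- integral over every sufficiently short interval near `s`.
  obtain ⟨v, v', g, hF, h1⟩ := h.exists_isFp_norm_apply_sub_le hs x (half_pos hη0)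
  have hvc := Metric.continuousWithinAt_iff.1 (hF.w10.memC0.1 s hs) (η / 2) (half_pos hη0)
  obtain ⟨δ₁, hδ₁, hv1⟩ := hvc
  obtain ⟨r₀, hr₀, hr₀s⟩ := h.leftOpen.exists_lt s hs
  -- a right end point for the primitive
  obtain ⟨e₀, he₀, hse₀, he₀I⟩ : ∃ e₀ ∈ I, s ≤ e₀ ∧ ∃ δ > 0, ∀ r ∈ I, |r - s| < δ → r ≤ e₀ := by
    by_cases hex : ∃ e ∈ I, s < e
    · obtain ⟨e, he, hse⟩ := hex
      exact ⟨e, he, hse.le, e - s, by linarith, fun r _ hr => by linarith [(abs_lt.1 hr).2]⟩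
    · push Not at hex
      exact ⟨s, hs, le_rfl, 1, one_pos, fun r hr _ => hex r hr⟩
  obtain ⟨δ₂, hδ₂, hle⟩ := he₀I
  have hre : r₀ ≤ e₀ := hr₀s.le.trans hse₀
  have hi : IntervalIntegrable (fun τ => ‖v' τ - g τ‖) volume r₀ e₀ :=
    ((hF.isRegularOn hr₀ he₀).integrable'.sub (hF.isRegularOn hr₀ he₀).integrable).norm
  have hprim : ContinuousOn (fun r => ∫ τ in r₀..r, ‖v' τ - g τ‖) (Icc r₀ e₀) :=
    continuousOn_of_primitive hre hi (fun r _ => by simp)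
  obtain ⟨δ₃, hδ₃, hv3⟩ := Metric.continuousWithinAt_iff.1 (hprim s ⟨hr₀s.le, hse₀⟩) (η / 2)
    (half_pos hη0)
  have hpos : 0 < min (min δ₁ δ₂) (min δ₃ (min (s - r₀) 1)) := by
    refine lt_min (lt_min hδ₁ hδ₂) (lt_min hδ₃ (lt_min (by linarith) one_pos))
  filter_upwards [Ioo_mem_nhdsGT hpos] with δ hδ r hr q hq hqr hrs hqs
  have hδ' := hδ.2
  simp only [lt_min_iff] at hδ'
  obtain ⟨⟨d1, d2⟩, d3, d4, d5⟩ := hδ'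
  have hr' := abs_lt.1 hrs
  have hq' := abs_lt.1 hqs
  have hrmem : r ∈ Icc r₀ e₀ := ⟨by linarith, hle r hr (hrs.trans d2)⟩
  have hqmem : q ∈ Icc r₀ e₀ := ⟨by linarith, hqr.trans hrmem.2⟩
  have a1 : ‖v r - x‖ ≤ η := by
    have := (hv1 hr (by rw [Real.dist_eq]; exact hrs.trans d1)).le
    rw [dist_eq_norm] at this
    calc ‖v r - x‖ = ‖(v r - v s) + (v s - x)‖ := by congr 1; abel
      _ ≤ _ := norm_add_le _ _
      _ ≤ η := by linarith
  have a2 : ‖v q - x‖ ≤ η := by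
    have := (hv1 hq (by rw [Real.dist_eq]; exact hqs.trans d1)).le
    rw [dist_eq_norm] at this
    calc ‖v q - x‖ = ‖(v q - v s) + (v s - x)‖ := by congr 1; abel
      _ ≤ _ := norm_add_le _ _
      _ ≤ η := by linarith
  have a3 : ∫ τ in q..r, ‖v' τ - g τ‖ ≤ η := by
    have b1 := (hv3 hrmem (by rw [Real.dist_eq]; exact hrs.trans d3)).le
    have b2 := (hv3 hqmem (by rw [Real.dist_eq]; exact hqs.trans d3)).le
    rw [Real.dist_eq, abs_le] at b1 b2
    have b3 := intervalIntegral.integral_add_adjacent_intervals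
      (hi.mono_Icc ⟨le_rfl, hre⟩ hqmem) (hi.mono_Icc hqmem hrmem)
    linarith [b1.2, b2.1]
  have a4 := hU q hq r hr hqr 2 (by linarith) v v' g (hF.isRegularOn hq hr) x
  have a5 : ‖v r - U r q x‖ ≤ K * (2 * η) :=
    a4.trans (mul_le_mul_of_nonneg_left (by linarith) hK0)
  have a6 : U r q x - x = (v r - x) - (v r - U r q x) := by abel
  rw [a6]
  refine (_root_.norm_sub_le _ _).trans ?_
  have : (2 * (2 * K + 1)) * η = ε := by rw [hη]; field_simp
  nlinarith

theorem IsPropagator.isEvolutionFamily (h : IsStableFamily I p A M w w')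
    (hU : IsPropagator I A M w' U)
    (hb : ∀ s ∈ I, ∀ t ∈ I, s ≤ t → ‖U t s‖ ≤ M * Real.exp ((w + w') / 2 * (t - s))) :
    IsEvolutionFamily I U where
  comp := fun s hs r hr t ht hsr hrt =>
    ContinuousLinearMap.ext fun x => hU.comp_apply h hs hr ht hsr hrt x
  refl := fun t ht => ContinuousLinearMap.ext fun x => hU.refl_apply h ht x
  bound := ⟨M, _, hb⟩
  cont := by
    have hM := h.kato.nonneg
    rintro x ⟨t₀, s₀⟩ ⟨ht₀, hs₀, hst₀⟩
    dsimp only at ht₀ hs₀ hst₀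
    have hfst : Tendsto (fun q : ℝ × ℝ => q.1)
        (𝓝[{q | q.1 ∈ I ∧ q.2 ∈ I ∧ q.2 ≤ q.1}] (t₀, s₀)) (𝓝 t₀) :=
      (continuous_fst.tendsto (t₀, s₀)).mono_left nhdsWithin_le_nhds
    have hsnd : Tendsto (fun q : ℝ × ℝ => q.2)
        (𝓝[{q | q.1 ∈ I ∧ q.2 ∈ I ∧ q.2 ≤ q.1}] (t₀, s₀)) (𝓝 s₀) :=
      (continuous_snd.tendsto (t₀, s₀)).mono_left nhdsWithin_le_nhds
    rw [ContinuousWithinAt, Metric.tendsto_nhds]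
    intro ε hε
    dsimp only
    rcases hst₀.eq_or_lt with heq | hlt
    · subst heq
      obtain ⟨δ, hδ, hδ0⟩ := ((hU.tendsto_diag h hs₀ x (half_pos hε)).and self_mem_nhdsWithin).exists
      filter_upwards [self_mem_nhdsWithin, hfst (Metric.ball_mem_nhds _ hδ0),
        hsnd (Metric.ball_mem_nhds _ hδ0)] with q hq h1 h2
      rw [dist_eq_norm, hU.refl_apply h hs₀]
      exact (hδ q.1 hq.1 q.2 hq.2.1 hq.2.2 (by simpa [Real.dist_eq] using h1)
        (by simpa [Real.dist_eq] using h2)).trans_lt (by linarith)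
    · set C := M * Real.exp (|(w + w') / 2| * (|t₀ - s₀| + 3)) + 1 with hC
      have hC0 : 0 < C := by positivity
      have hbd : ∀ s ∈ I, ∀ t ∈ I, s ≤ t → t - s ≤ |t₀ - s₀| + 3 → ‖U t s‖ ≤ C := by
        intro s hs t ht hst hle
        refine (hb s hs t ht hst).trans ?_
        refine le_trans (mul_le_mul_of_nonneg_left (Real.exp_le_exp.2 ?_) hM)
          (le_add_of_nonneg_right zero_le_one)
        exact (mul_le_mul_of_nonneg_right (le_abs_self _) (sub_nonneg.2 hst)).trans
          (mul_le_mul_of_nonneg_left hle (abs_nonneg _))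
      -- continuity in the first variable
      obtain ⟨e, he, hte, δ₂, hδ₂, hle⟩ : ∃ e ∈ I, t₀ ≤ e ∧ ∃ δ > 0, ∀ r ∈ I, |r - t₀| < δ → r ≤ e := by
        by_cases hex : ∃ e ∈ I, t₀ < e
        · obtain ⟨e, he, hse⟩ := hex
          exact ⟨e, he, hse.le, e - t₀, by linarith, fun r _ hr => by linarith [(abs_lt.1 hr).2]⟩
        · push Not at hex
          exact ⟨t₀, ht₀, le_rfl, 1, one_pos, fun r hr _ => hex r hr⟩
      have hcl := hU.continuousOn_left h hs₀ he (hst₀.trans hte) x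
      obtain ⟨δ₁, hδ₁, h1⟩ := Metric.continuousWithinAt_iff.1 (hcl t₀ ⟨hst₀, hte⟩) (ε / 2)
        (half_pos hε)
      obtain ⟨δ, hδ, hδ0⟩ := ((hU.tendsto_diag h hs₀ x (ε := ε / 2 / (2 * C)) (by positivity)).and
        self_mem_nhdsWithin).exists
      filter_upwards [self_mem_nhdsWithin, hfst (Metric.ball_mem_nhds _ hδ₁),
        hfst (Metric.ball_mem_nhds _ hδ₂), hfst (Metric.ball_mem_nhds _ one_pos),
        hfst (lt_mem_nhds hlt),
        hsnd (Metric.ball_mem_nhds _ hδ0), hsnd (Metric.ball_mem_nhds _ one_pos)] with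
        q hq k1 k2 k3 k4 k5 k6
      obtain ⟨hq1, hq2, hq3⟩ := hq
      rw [mem_preimage, Metric.mem_ball, Real.dist_eq] at k1 k2 k3 k5 k6
      have k4' : s₀ < q.1 := k4
      have b3 := abs_lt.1 k3
      have b6 := abs_lt.1 k6
      have c1 := h1 (x := q.1) ⟨k4'.le, hle q.1 hq1 k2⟩ (by rwa [Real.dist_eq])
      -- Near an off-diagonal point one still has `s₀ < q.1`. Both orbits can then be factored at
      -- the later of the times `q.2` and `s₀`, which reduces continuity in the second variable to
      -- continuity at the diagonal.
      have c2 : ‖U q.1 q.2 x - U q.1 s₀ x‖ ≤ C * (ε / 2 / (2 * C)) := by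
        rcases le_total s₀ q.2 with hc | hc
        · rw [← hU.comp_apply h hs₀ hq2 hq1 hc hq3 x, ← map_sub]
          refine ContinuousLinearMap.le_of_opNorm_le_of_le _
            (hbd q.2 hq2 q.1 hq1 hq3 (by linarith [le_abs_self (t₀ - s₀)])) ?_
          rw [norm_sub_rev]
          exact hδ q.2 hq2 s₀ hs₀ hc k5 (by simpa using hδ0)
        · rw [← hU.comp_apply h hq2 hs₀ hq1 hc k4'.le x, ← map_sub]
          refine ContinuousLinearMap.le_of_opNorm_le_of_le _
            (hbd s₀ hs₀ q.1 hq1 k4'.le (by linarith [le_abs_self (t₀ - s₀)])) ?_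
          exact hδ s₀ hs₀ q.2 hq2 hc (by simpa using hδ0) k5
      have c3 : C * (ε / 2 / (2 * C)) = ε / 4 := by field_simp; norm_num
      rw [dist_eq_norm] at c1 ⊢
      calc ‖U q.1 q.2 x - U t₀ s₀ x‖ = ‖(U q.1 q.2 x - U q.1 s₀ x) + (U q.1 s₀ x - U t₀ s₀ x)‖ := by
            congr 1; abel
        _ ≤ _ := norm_add_le _ _
        _ < ε := by linarith

end Propagator

end EvolutionSemigroup

/-! ### Strongly continuous semigroups: closed generators, cores and uniqueness. -/

namespace EvolutionSemigroup

section Semigroups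

variable {𝕜 : Type*} [RCLike 𝕜] {E : Type*} [NormedAddCommGroup E] [NormedSpace 𝕜 E]

/-- `(x, y)` lies in the graph of the generator of `T`. -/
def InGenerator (T : ℝ → E →L[𝕜] E) (x y : E) : Prop :=
  Tendsto (fun t : ℝ => ((t⁻¹ : ℝ) : 𝕜) • (T t x - x)) (𝓝[>] 0) (𝓝 y)

variable {T S : ℝ → E →L[𝕜] E} {x y x' y' : E}

theorem InGenerator.sub (h : InGenerator T x y) (h' : InGenerator T x' y') :
    InGenerator T (x - x') (y - y') := by
  refine (Filter.Tendsto.sub h h').congr fun t => ?_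
  rw [← smul_sub, map_sub]; congr 1; abel

theorem InGenerator.eq_zero (h : InGenerator T 0 y) : y = 0 := by
  refine tendsto_nhds_unique h ?_
  simp

theorem IsC0Semigroup.comm_apply (hT : IsC0Semigroup T) {r t : ℝ} (hr : 0 ≤ r) (ht : 0 ≤ t) (x : E) :
    T t (T r x) = T r (T t x) := by
  have h1 := hT.add t r ht hr
  have h2 := hT.add r t hr ht
  rw [add_comm, h2] at h1
  exact (DFunLike.congr_fun h1 x).symm

theorem InGenerator.apply (hT : IsC0Semigroup T) (h : InGenerator T x y) {r : ℝ} (hr : 0 ≤ r) :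
    InGenerator T (T r x) (T r y) := by
  refine (((T r).continuous.tendsto y).comp h).congr' ?_
  filter_upwards [self_mem_nhdsWithin] with t ht
  simp only [Function.comp, map_smul, map_sub]
  rw [hT.comm_apply hr (le_of_lt ht)]

variable [NormedSpace ℝ E] [IsScalarTower ℝ 𝕜 E]

theorem InGenerator.hasDerivWithinAt (hT : IsC0Semigroup T) (h : InGenerator T x y) {r : ℝ}
    (hr : 0 ≤ r) : HasDerivWithinAt (fun t => T t x) (T r y) (Ici r) r := by
  rw [hasDerivWithinAt_iff_tendsto_slope, Ici_sdiff_left]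
  have h1 : Tendsto (fun t => t - r) (𝓝[>] r) (𝓝[>] 0) := by
    refine tendsto_nhdsWithin_of_tendsto_nhds_of_eventually_within _ ?_ ?_
    · have : Tendsto (fun t => t - r) (𝓝 r) (𝓝 (r - r)) := (continuous_sub_right r).tendsto r
      rw [sub_self] at this
      exact this.mono_left nhdsWithin_le_nhds
    · filter_upwards [self_mem_nhdsWithin] with t ht
      exact sub_pos.2 (mem_Ioi.1 ht)
  refine (((T r).continuous.tendsto y).comp (h.comp h1)).congr' ?_
  filter_upwards [self_mem_nhdsWithin] with t ht
  have ht' : 0 ≤ t - r := (sub_pos.2 (mem_Ioi.1 ht)).le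
  have h2 : T t x = T r (T (t - r) x) := by
    have := hT.add r (t - r) hr ht'
    rw [add_sub_cancel] at this
    exact DFunLike.congr_fun this x
  simp only [Function.comp, map_smul, map_sub, slope, vsub_eq_sub]
  rw [h2, RCLike.real_smul_eq_coe_smul (K := 𝕜)]

/-- The mean value inequality for `r ↦ T r x - r • y`, whose right derivative is `T r y - y`. -/
theorem InGenerator.norm_sub_sub_le (hT : IsC0Semigroup T) (h : InGenerator T x y) {σ c : ℝ}
    (hσ : 0 ≤ σ) (hc : ∀ r ∈ Icc 0 σ, ‖T r y - y‖ ≤ c) : ‖T σ x - x - σ • y‖ ≤ c * σ := by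
  have h1 := norm_image_sub_le_of_norm_deriv_right_le_segment (a := 0) (b := σ) (C := c)
    (f := fun r => T r x - r • y) (f' := fun r => T r y - y)
    (((hT.cont x).mono Icc_subset_Ici_self).sub (by fun_prop)) (fun r hr => by
      have h2 := (h.hasDerivWithinAt hT hr.1).sub
        (((hasDerivAt_id r).smul_const y).hasDerivWithinAt (s := Ici r))
      exact h2.congr_deriv (by simp)) (fun r hr => hc r (Ico_subset_Icc_self hr)) σ ⟨hσ, le_rfl⟩
  simp only [hT.zero, zero_smul, sub_zero, one_apply_eq_self] at h1
  rwa [sub_right_comm] at h1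

/-- For fixed `σ` the Taylor bound of `InGenerator.norm_sub_sub_le` is a closed condition on the
pair, once its constant is corrected by `(C + 1) ‖v - y‖`. It therefore survives in the closure, and
strong continuity at `0` turns it back into differentiability. -/
theorem isClosed_inGenerator (hT : IsC0Semigroup T) {C : ℝ} (hC : ∀ t ∈ Icc (0 : ℝ) 1, ‖T t‖ ≤ C) :
    IsClosed {q : E × E | InGenerator T q.1 q.2} := by
  refine isClosed_of_closure_subset ?_
  rintro ⟨x, y⟩ hxy
  have hC0 : 0 ≤ C := (norm_nonneg _).trans (hC 0 ⟨le_rfl, zero_le_one⟩)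
  have hle : ∀ σ ∈ Icc (0 : ℝ) 1, ∀ c : ℝ, (∀ r ∈ Icc 0 σ, ‖T r y - y‖ ≤ c) →
      ‖T σ x - x - σ • y‖ ≤ c * σ := by
    intro σ hσ c hc
    have hcl : IsClosed {q : E × E | ‖T σ q.1 - q.1 - σ • q.2‖ ≤ (c + (C + 1) * ‖q.2 - y‖) * σ} :=
      isClosed_le (by fun_prop) (by fun_prop)
    have := closure_minimal (s := {q : E × E | InGenerator T q.1 q.2}) (by
      rintro ⟨u, v⟩ huv
      refine InGenerator.norm_sub_sub_le hT huv hσ.1 fun r hr => ?_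
      have h1 : T r v - v = (T r y - y) + T r (v - y) - (v - y) := by rw [map_sub]; abel
      rw [h1]
      have h2 := (T r).le_of_opNorm_le (hC r ⟨hr.1, hr.2.trans hσ.2⟩) (v - y)
      refine (norm_sub_le _ _).trans ?_
      have h3 := norm_add_le (T r y - y) (T r (v - y))
      have h4 := hc r hr
      dsimp only
      linarith) hcl hxy
    simpa using this
  change InGenerator T x y
  rw [InGenerator, Metric.tendsto_nhds]
  intro ε hε
  have h1 : ContinuousWithinAt (fun t => T t y) (Ici 0) 0 := hT.cont y 0 self_mem_Ici
  obtain ⟨δ, hδ, h2⟩ := Metric.continuousWithinAt_iff.1 h1 (ε / 2) (half_pos hε)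
  filter_upwards [Ioo_mem_nhdsGT (lt_min hδ one_pos)] with σ hσ
  have hσ0 := hσ.1
  have hσδ := hσ.2.trans_le (min_le_left _ _)
  have hσ1 := hσ.2.trans_le (min_le_right _ _)
  have h3 := hle σ ⟨hσ0.le, hσ1.le⟩ (ε / 2) fun r hr => by
    have := h2 (x := r) hr.1 (by
      rw [Real.dist_eq, sub_zero, abs_of_nonneg hr.1]; exact hr.2.trans_lt hσδ)
    rw [dist_eq_norm, hT.zero] at this
    exact this.le
  rw [dist_eq_norm, ← RCLike.real_smul_eq_coe_smul (K := 𝕜)]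
  have h4 : σ⁻¹ • (T σ x - x) - y = σ⁻¹ • (T σ x - x - σ • y) := by
    rw [smul_sub σ⁻¹ _ (σ • y), smul_smul, inv_mul_cancel₀ hσ0.ne', one_smul]
  rw [h4, norm_smul, norm_inv, Real.norm_of_nonneg hσ0.le, inv_mul_lt_iff₀ hσ0]
  nlinarith

/-- The resolvent estimate. The derivative of `e^{-lr} T r x` is `-e^{-lr} T r z` with `z = l x -
y`, which bounds the distance between this orbit and `x` by the integral of `M e^{-(l-ω)r} ‖z‖`. As
time tends to infinity the orbit itself dies out. -/
theorem InGenerator.norm_le (hT : IsC0Semigroup T) {M ω l : ℝ}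
    (hM : ∀ t, 0 ≤ t → ‖T t‖ ≤ M * Real.exp (ω * t)) (hl : ω < l) (h : InGenerator T x y) :
    ‖x‖ ≤ M / (l - ω) * ‖(l : 𝕜) • x - y‖ := by
  set z := (l : 𝕜) • x - y with hz
  have hd : 0 < l - ω := sub_pos.2 hl
  have hM0 : 0 ≤ M := by
    have := (norm_nonneg _).trans (hM 0 le_rfl); simpa using this
  set C := M / (l - ω) * ‖z‖ with hCdef
  have hbound : ∀ σ : ℝ, 0 ≤ σ → ‖x‖ ≤ M * Real.exp (-(l - ω) * σ) * ‖x‖ + C := by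
    intro σ hσ
    have h1 := image_norm_le_of_norm_deriv_right_le_deriv_boundary' (a := 0) (b := σ)
      (f := fun r => Real.exp (-l * r) • T r x - x)
      (f' := fun r => -(Real.exp (-l * r) • T r z))
      (B := fun r => C * (1 - Real.exp (-(l - ω) * r)))
      (B' := fun r => M * Real.exp (-(l - ω) * r) * ‖z‖)
      ((ContinuousOn.smul (by fun_prop) ((hT.cont x).mono Icc_subset_Ici_self)).sub
        continuousOn_const)
      (fun r hr => by
        have e1 : HasDerivAt (fun r : ℝ => Real.exp (-l * r)) (Real.exp (-l * r) * (-l * 1)) r :=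
          (((hasDerivAt_id r).const_mul (-l)).exp)
        have e2 := (e1.hasDerivWithinAt (s := Ici r)).smul (h.hasDerivWithinAt hT hr.1)
        refine (e2.sub_const x).congr_deriv ?_
        rw [hz, map_sub, map_smul, ← RCLike.real_smul_eq_coe_smul (K := 𝕜)]
        module)
      (by simp [hT.zero]) (by fun_prop)
      (fun r _ => by
        have e1 : HasDerivAt (fun r : ℝ => Real.exp (-(l - ω) * r))
          (Real.exp (-(l - ω) * r) * (-(l - ω) * 1)) r :=
            (((hasDerivAt_id r).const_mul (-(l - ω))).exp)
        refine ((e1.const_sub 1).const_mul C).hasDerivWithinAt.congr_deriv ?_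
        rw [hCdef]; field_simp)
      (fun r hr => by
        rw [norm_neg, norm_smul, Real.norm_of_nonneg (Real.exp_pos _).le]
        have e1 := (T r).le_of_opNorm_le (hM r hr.1) z
        calc _ ≤ Real.exp (-l * r) * (M * Real.exp (ω * r) * ‖z‖) :=
              mul_le_mul_of_nonneg_left e1 (Real.exp_pos _).le
          _ = M * (Real.exp (-l * r) * Real.exp (ω * r)) * ‖z‖ := by ring
          _ = _ := by rw [← Real.exp_add]; congr 3; ring)
      (right_mem_Icc.2 hσ)
    have hC0 : 0 ≤ C := by positivity
    have h2 : ‖Real.exp (-l * σ) • T σ x - x‖ ≤ C := by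
      refine h1.trans (mul_le_of_le_one_right hC0 ?_)
      linarith [Real.exp_pos (-(l - ω) * σ)]
    have h3 : ‖Real.exp (-l * σ) • T σ x‖ ≤ M * Real.exp (-(l - ω) * σ) * ‖x‖ := by
      rw [norm_smul, Real.norm_of_nonneg (Real.exp_pos _).le]
      have e1 := (T σ).le_of_opNorm_le (hM σ hσ) x
      calc _ ≤ Real.exp (-l * σ) * (M * Real.exp (ω * σ) * ‖x‖) :=
            mul_le_mul_of_nonneg_left e1 (Real.exp_pos _).le
        _ = M * (Real.exp (-l * σ) * Real.exp (ω * σ)) * ‖x‖ := by ring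
        _ = _ := by rw [← Real.exp_add]; congr 3; ring
    have h4 := norm_sub_norm_le x (Real.exp (-l * σ) • T σ x)
    rw [norm_sub_rev] at h4
    linarith
  have hlim : Tendsto (fun σ : ℝ => M * Real.exp (-(l - ω) * σ) * ‖x‖ + C) atTop
      (𝓝 (M * 0 * ‖x‖ + C)) := by
    refine ((Tendsto.const_mul M ?_).mul_const _).add_const _
    refine Real.tendsto_exp_atBot.comp ?_
    exact tendsto_id.const_mul_atTop_of_neg (by linarith)
  rw [mul_zero, zero_mul, zero_add] at hlim
  refine ge_of_tendsto hlim ?_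
  filter_upwards [eventually_ge_atTop 0] with σ hσ using hbound σ hσ

/-- An operator that is contained in the generator and has dense range after a shift is a core. -/
theorem closure_isGeneratorOf (hT : IsC0Semigroup T) {M ω l : ℝ}
    (hM : ∀ t, 0 ≤ t → ‖T t‖ ≤ M * Real.exp (ω * t)) (hl : ω < l) {B : E →ₗ.[𝕜] E}
    (hB : ∀ x y, (x, y) ∈ B.graph → InGenerator T x y)
    (hrange : Dense {z : E | ∃ f g : E, (f, g) ∈ B.graph ∧ z = (l : 𝕜) • f - g}) :
    B.IsClosable ∧ IsGeneratorOf B.closure T := by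
  have hM0 : 0 ≤ M := by
    have := (norm_nonneg _).trans (hM 0 le_rfl); simpa using this
  have hcl := isClosed_inGenerator hT (C := M * Real.exp |ω|) fun t ht => by
    refine (hM t ht.1).trans (mul_le_mul_of_nonneg_left (Real.exp_le_exp.2 ?_) hM0)
    calc ω * t ≤ |ω| * 1 := mul_le_mul (le_abs_self _) ht.2 ht.1 (abs_nonneg _)
      _ = _ := mul_one _
  have hsub : ∀ q ∈ B.graph.topologicalClosure, InGenerator T q.1 q.2 := fun q hq =>
    hcl.closure_subset_iff.2 (fun q' hq' => hB q'.1 q'.2 hq') hq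
  have hclos : B.IsClosable := by
    refine ⟨B.graph.topologicalClosure.toLinearPMap, ?_⟩
    rw [Submodule.toLinearPMap_graph_eq]
    rintro ⟨x, y⟩ hxy hx
    have := hsub _ hxy
    dsimp only at hx this ⊢
    rw [hx] at this
    exact this.eq_zero
  refine ⟨hclos, fun x y => ?_⟩
  rw [← hclos.graph_closure_eq_closure_graph]
  refine ⟨hsub (x, y), fun h => ?_⟩
  change (x, y) ∈ closure (B.graph : Set (E × E))
  rw [Metric.mem_closure_iff]
  intro ε hε
  set K := M / (l - ω) with hK
  have hK0 : 0 ≤ K := div_nonneg hM0 (sub_pos.2 hl).le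
  -- Choose `(f, g)` in the graph of `B` with `l f - g` within `η` of `l x - y`. The resolvent
  -- estimate gives `‖x - f‖ ≤ K η`, and then `‖y - g‖ ≤ |l| K η + η`.
  set η := ε / 2 / (K + |l| * K + 1) with hη
  have hη0 : 0 < η := by positivity
  obtain ⟨_, hz, f, g, hfg, rfl⟩ := Metric.dense_iff.1 hrange ((l : 𝕜) • x - y) η hη0
  refine ⟨(f, g), hfg, ?_⟩
  rw [Metric.mem_ball, dist_comm, dist_eq_norm] at hz
  have h1 := (InGenerator.sub h (hB f g hfg)).norm_le hT hM hl
  have e1 : (l : 𝕜) • (x - f) - (y - g) = (l : 𝕜) • x - y - ((l : 𝕜) • f - g) := by module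
  rw [e1] at h1
  have h2 : ‖x - f‖ ≤ K * η := h1.trans (mul_le_mul_of_nonneg_left hz.le hK0)
  have h3 : ‖y - g‖ ≤ |l| * (K * η) + η := by
    have e2 : y - g = (l : 𝕜) • (x - f) - ((l : 𝕜) • x - y - ((l : 𝕜) • f - g)) := by module
    rw [e2]
    refine (norm_sub_le _ _).trans (add_le_add ?_ hz.le)
    rw [norm_smul, RCLike.norm_ofReal]
    exact mul_le_mul_of_nonneg_left h2 (abs_nonneg _)
  have h4 : (K + |l| * K + 1) * η = ε / 2 := by rw [hη]; field_simp
  have h5 : 0 ≤ |l| * (K * η) := by positivity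
  have h6 : 0 ≤ K * η := by positivity
  rw [Prod.dist_eq, max_lt_iff, dist_eq_norm, dist_eq_norm]
  constructor
  · dsimp only; linarith
  · dsimp only; linarith

/-- A semigroup is determined by its generator. -/
theorem IsC0Semigroup.eq_of_isGeneratorOf (hT : IsC0Semigroup T) (hS : IsC0Semigroup S)
    {B : E →ₗ.[𝕜] E} (hBT : IsGeneratorOf B T) (hBS : IsGeneratorOf B S)
    (hD : Dense (B.domain : Set E)) {M ω : ℝ}
    (hM : ∀ t, 0 ≤ t → ‖S t‖ ≤ M * Real.exp (ω * t)) {σ : ℝ} (hσ : 0 ≤ σ) : T σ = S σ := by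
  have hM0 : 0 ≤ M := by
    have := (norm_nonneg _).trans (hM 0 le_rfl); simpa using this
  set C := M * Real.exp (|ω| * σ) with hCdef
  have hC : ∀ r ∈ Icc 0 σ, ‖S r‖ ≤ C := fun r hr => by
    refine (hM r hr.1).trans (mul_le_mul_of_nonneg_left (Real.exp_le_exp.2 ?_) hM0)
    exact mul_le_mul (le_abs_self _) hr.2 hr.1 (abs_nonneg _)
  refine DFunLike.coe_injective ((T σ).continuous.ext_on hD (S σ).continuous fun x hx => ?_)
  obtain ⟨y, hxy⟩ : ∃ y, (x, y) ∈ B.graph := ⟨B ⟨x, hx⟩, B.mem_graph ⟨x, hx⟩⟩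
  have hTx : InGenerator T x y := (hBT x y).1 hxy
  -- This interpolates between `S σ x` and `T σ x`. It is constant because its right derivative
  -- vanishes: `T r x` stays in the domain of the common generator, so the derivatives of the two
  -- factors cancel.
  have hcont : ContinuousOn (fun r => S (σ - r) (T r x)) (Icc 0 σ) := by
    refine ContinuousOn.apply_of_strongly_continuous (K := fun r => S (σ - r)) (C := C)
      (fun z => ?_) (fun r hr => hC _ ⟨by linarith [hr.2], by linarith [hr.1]⟩)
      ((hT.cont x).mono Icc_subset_Ici_self)
    exact (hS.cont z).comp (continuousOn_const.sub continuousOn_id) fun r hr => sub_nonneg.2 hr.2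
  have hder : ∀ r ∈ Ico 0 σ, HasDerivWithinAt (fun r => S (σ - r) (T r x)) 0 (Ici r) r := by
    intro r hr
    have h1 : HasDerivWithinAt (fun t => T t x) (T r y) (Ici r) r := hTx.hasDerivWithinAt hT hr.1
    have h2 : InGenerator S (T r x) (T r y) :=
      (hBS _ _).1 ((hBT _ _).2 (hTx.apply hT hr.1))
    have h3 : HasDerivWithinAt (fun t => S t (T r x)) (S 0 (T r y)) (Ici 0) 0 :=
      h2.hasDerivWithinAt hS le_rfl
    rw [hS.zero, one_apply_eq_self] at h3
    rw [hasDerivWithinAt_iff_tendsto_slope, Ici_sdiff_left] at h1 h3 ⊢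
    have h4 : Tendsto (fun t => t - r) (𝓝[>] r) (𝓝[>] 0) := by
      refine tendsto_nhdsWithin_of_tendsto_nhds_of_eventually_within _ ?_ ?_
      · have : Tendsto (fun t => t - r) (𝓝 r) (𝓝 (r - r)) := (continuous_sub_right r).tendsto r
        rw [sub_self] at this
        exact this.mono_left nhdsWithin_le_nhds
      · filter_upwards [self_mem_nhdsWithin] with t ht
        exact sub_pos.2 (mem_Ioi.1 ht)
    have h5 := h1.sub (h3.comp h4)
    rw [sub_self] at h5
    refine squeeze_zero_norm' (a := fun t => C * ‖slope (fun t => T t x) r t -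
      ((slope (fun t => S t (T r x)) 0) ∘ fun t => t - r) t‖) ?_ ?_
    · filter_upwards [Ioo_mem_nhdsGT hr.2] with t ht
      have e1 : S (σ - r) (T r x) = S (σ - t) (S (t - r) (T r x)) := by
        have := hS.add (σ - t) (t - r) (sub_nonneg.2 ht.2.le) (sub_nonneg.2 ht.1.le)
        rw [sub_add_sub_cancel] at this
        exact DFunLike.congr_fun this _
      have e2 : slope (fun r => S (σ - r) (T r x)) r t = S (σ - t) (slope (fun t => T t x) r t -
          ((slope (fun t => S t (T r x)) 0) ∘ fun t => t - r) t) := by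
        simp only [slope, vsub_eq_sub, Function.comp, sub_zero, hS.zero, one_apply_eq_self]
        rw [e1, ← smul_sub, RCLike.real_smul_eq_coe_smul (K := 𝕜),
          RCLike.real_smul_eq_coe_smul (K := 𝕜), map_smul, map_sub, map_sub, map_sub]
        congr 1; abel
      rw [e2]
      exact (S (σ - t)).le_of_opNorm_le
        (hC _ ⟨sub_nonneg.2 ht.2.le, by linarith [ht.1, hr.1]⟩) _
    · simpa using h5.norm.const_mul C
  have h6 := constant_of_has_deriv_right_zero hcont hder σ ⟨hσ, le_rfl⟩
  simpa [hS.zero, hT.zero] using h6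

end Semigroups

end EvolutionSemigroup

/-! ### The evolution semigroup as a weighted shift on `E_p`. -/

namespace EvolutionSemigroup

section Shift

variable {𝕜 : Type*} [RCLike 𝕜] {X : Type*} [NormedAddCommGroup X] [NormedSpace 𝕜 X]

/-- `t ↦ U(t, t - σ) v(t - σ)` if `t - σ ∈ I`, and `0` otherwise. -/
noncomputable def propagatedShift (I : Set ℝ) (U : ℝ → ℝ → X →L[𝕜] X) (σ : ℝ) (v : ℝ → X) : ℝ → X :=
  indicator {t | t - σ ∈ I} fun t => U t (t - σ) (v (t - σ))

variable {I : Set ℝ} {U : ℝ → ℝ → X →L[𝕜] X} {σ : ℝ} {v u : ℝ → X}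

theorem propagatedShift_of_mem {t : ℝ} (h : t - σ ∈ I) :
    propagatedShift I U σ v t = U t (t - σ) (v (t - σ)) := indicator_of_mem (s := {t | t - σ ∈ I}) h _

theorem propagatedShift_of_notMem {t : ℝ} (h : t - σ ∉ I) : propagatedShift I U σ v t = 0 :=
  indicator_of_notMem (s := {t | t - σ ∈ I}) h _

theorem norm_propagatedShift_le {M ω : ℝ}
    (hb : ∀ s ∈ I, ∀ t ∈ I, s ≤ t → ‖U t s‖ ≤ M * Real.exp (ω * (t - s))) (hσ : 0 ≤ σ) {t : ℝ}
    (ht : t ∈ I) (hts : t - σ ∈ I) :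
    ‖propagatedShift I U σ v t‖ ≤ M * Real.exp (ω * σ) * ‖v (t - σ)‖ := by
  rw [propagatedShift_of_mem hts]
  have h1 := hb _ hts t ht (by linarith)
  rw [sub_sub_cancel] at h1
  exact (U t (t - σ)).le_of_opNorm_le h1 _

theorem IsEvolutionFamily.continuousOn_shift (hU : IsEvolutionFamily I U) (hσ : 0 ≤ σ) (x : X) :
    ContinuousOn (fun t => U t (t - σ) x) ({t | t - σ ∈ I} ∩ I) :=
  (hU.cont x).comp (f := fun t => (t, t - σ)) (by fun_prop) fun t ht =>
    ⟨ht.2, ht.1, sub_le_self _ hσ⟩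

theorem IsLeftOpen.sub_mem_mem_nhdsWithin [I.OrdConnected] (hI : IsLeftOpen I) (hσ : 0 ≤ σ)
    {t : ℝ} (hts : t - σ ∈ I) : {t | t - σ ∈ I} ∈ 𝓝[I] t := by
  obtain ⟨s, hs, hlt⟩ := hI.exists_lt _ hts
  filter_upwards [self_mem_nhdsWithin,
    mem_nhdsWithin_of_mem_nhds (Ioi_mem_nhds (show s + σ < t by linarith))] with r hr hr'
  exact Set.OrdConnected.out ‹_› hs hr ⟨by linarith [mem_Ioi.1 hr'], sub_le_self _ hσ⟩

/-- The only delicate points for continuity are those with `t - σ ∉ I`, where the shifted function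
is set to `0`. There `t - σ` has a neighbourhood avoiding any given compact subset of `I`, and `v`
is small off such a set. The same sets, shifted by `σ`, show vanishing at infinity. -/
theorem IsEvolutionFamily.memC0_propagatedShift [I.OrdConnected] (hU : IsEvolutionFamily I U)
    (hI : IsLeftOpen I) (hσ : 0 ≤ σ) (hv : MemC0 I v) : MemC0 I (propagatedShift I U σ v) := by
  obtain ⟨M, ω, hb⟩ := hU.bound
  set C := |M| * Real.exp (ω * σ) + 1 with hC
  have hC0 : 0 < C := by positivity
  have hle : ∀ t ∈ I, t - σ ∈ I → ‖propagatedShift I U σ v t‖ ≤ C * ‖v (t - σ)‖ := by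
    intro t ht hts
    refine (norm_propagatedShift_le hb hσ ht hts).trans
      (mul_le_mul_of_nonneg_right ?_ (norm_nonneg _))
    exact (mul_le_mul_of_nonneg_right (le_abs_self M) (Real.exp_pos _).le).trans
      (le_add_of_nonneg_right zero_le_one)
  have hsmall : ∀ ε > 0, ∃ K ⊆ I, IsCompact K ∧ ∀ t ∈ I, t - σ ∉ K →
      ‖propagatedShift I U σ v t‖ < ε := by
    intro ε hε
    obtain ⟨K, hKI, hK, h⟩ := (memC0_iff.1 hv).2 (ε / C) (by positivity)
    refine ⟨K, hKI, hK, fun t ht htK => ?_⟩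
    by_cases hts : t - σ ∈ I
    · have := h _ hts htK
      rw [lt_div_iff₀ hC0, mul_comm] at this
      exact (hle t ht hts).trans_lt this
    · rwa [propagatedShift_of_notMem hts, norm_zero]
  refine memC0_iff.2 ⟨fun t ht => ?_, fun ε hε => ?_⟩
  · by_cases hts : t - σ ∈ I
    · have h1 : ContinuousOn (fun t => U t (t - σ) (v (t - σ))) ({t | t - σ ∈ I} ∩ I) := by
        refine ContinuousOn.apply_of_strongly_continuous (K := fun t => U t (t - σ))
          (C := |M| * Real.exp (ω * σ)) (hU.continuousOn_shift hσ) (fun t ht => ?_)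
          (hv.1.comp (by fun_prop) fun t ht => ht.1)
        have := hb _ ht.1 t ht.2 (by linarith)
        rw [sub_sub_cancel] at this
        exact this.trans (mul_le_mul_of_nonneg_right (le_abs_self M) (Real.exp_pos _).le)
      have h2 := (h1 t ⟨hts, ht⟩).congr (g := propagatedShift I U σ v)
        (fun r hr => propagatedShift_of_mem hr.1) (propagatedShift_of_mem hts)
      refine h2.mono_of_mem_nhdsWithin ?_
      exact inter_mem (hI.sub_mem_mem_nhdsWithin hσ hts) self_mem_nhdsWithin
    · rw [ContinuousWithinAt, propagatedShift_of_notMem hts, Metric.tendsto_nhds]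
      intro ε hε
      obtain ⟨K, hKI, hK, h⟩ := hsmall ε hε
      have h1 : {r | r - σ ∈ Kᶜ} ∈ 𝓝 t :=
        (hK.isClosed.isOpen_compl.preimage (continuous_sub_right σ)).mem_nhds
          fun h' => hts (hKI h')
      filter_upwards [mem_nhdsWithin_of_mem_nhds h1, self_mem_nhdsWithin] with r hr hr'
      rw [dist_zero_right]
      exact h r hr' hr
  · obtain ⟨K, hKI, hK, h⟩ := hsmall ε hε
    refine ⟨I ∩ (fun t => t - σ) ⁻¹' K, inter_subset_left, ?_, fun t ht htK =>
      h t ht fun h' => htK ⟨ht, h'⟩⟩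
    rcases K.eq_empty_or_nonempty with rfl | hne
    · simp
    obtain ⟨m, hm⟩ := hK.exists_isLeast hne
    have h1 : I ∩ (fun t => t - σ) ⁻¹' K = (I ∩ Ici m) ∩ (fun t => t - σ) ⁻¹' K := by
      ext t
      refine ⟨fun ht => ⟨⟨ht.1, ?_⟩, ht.2⟩, fun ht => ⟨ht.1.1, ht.2⟩⟩
      have := hm.2 ht.2
      exact mem_Ici.2 (by linarith)
    rw [h1]
    refine IsCompact.inter_left ?_ (hI.isClosed m (hKI hm.1))
    exact (Homeomorph.subRight σ).isCompact_preimage.2 hK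

theorem memE_fn {p : ℝ≥0∞} [Fact (1 ≤ p)] (f : Ep 𝕜 X I p) : ∃ v : ℝ → X, MemE I p v ∧ fn f =ᵐ[volume.restrict I] v := by
  by_cases hp : p = ∞
  · obtain ⟨v, hv, hfv⟩ := f.2 hp
    exact ⟨v, ⟨(memLp_congr_ae hfv).1 (Lp.memLp _), fun _ => hv⟩, hfv⟩
  · exact ⟨fn f, ⟨Lp.memLp _, fun h => absurd h hp⟩, EventuallyEq.rfl⟩

variable [I.OrdConnected]

theorem measurePreserving_sub_restrict (σ : ℝ) : MeasurePreserving (fun t : ℝ => t - σ)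
    (volume.restrict {t | t - σ ∈ I}) (volume.restrict I) :=
  (measurePreserving_sub_right volume σ).restrict_preimage (Set.OrdConnected.measurableSet ‹_›)

theorem measurableSet_sub_mem (σ : ℝ) : MeasurableSet {t | t - σ ∈ I} :=
  (measurable_sub_const σ) (Set.OrdConnected.measurableSet ‹_›)

theorem ae_sub_mem {P : ℝ → Prop} (h : ∀ᵐ t ∂volume.restrict I, P t) :
    ∀ᵐ t ∂volume.restrict I, t - σ ∈ I → P (t - σ) := by
  have h1 : ∀ᵐ t ∂volume.restrict {t | t - σ ∈ I}, P (t - σ) :=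
    (measurePreserving_sub_restrict σ).quasiMeasurePreserving.ae h
  exact ae_restrict_of_ae ((ae_restrict_iff' (measurableSet_sub_mem σ)).1 h1)

theorem propagatedShift_congr (h : v =ᵐ[volume.restrict I] u) :
    propagatedShift I U σ v =ᵐ[volume.restrict I] propagatedShift I U σ u := by
  filter_upwards [ae_sub_mem (σ := σ) h] with t ht
  by_cases hts : t - σ ∈ I
  · rw [propagatedShift_of_mem hts, propagatedShift_of_mem hts, ht hts]
  · rw [propagatedShift_of_notMem hts, propagatedShift_of_notMem hts]

theorem IsEvolutionFamily.aestronglyMeasurable_propagatedShift (hU : IsEvolutionFamily I U)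
    (hσ : 0 ≤ σ) (hv : AEStronglyMeasurable v (volume.restrict I)) :
    AEStronglyMeasurable (propagatedShift I U σ v) (volume.restrict I) := by
  have hI : MeasurableSet I := Set.OrdConnected.measurableSet ‹_›
  have hS := measurableSet_sub_mem (I := I) σ
  rw [propagatedShift, aestronglyMeasurable_indicator_iff hS, Measure.restrict_restrict hS]
  refine AEStronglyMeasurable.apply_of_strongly_measurable (K := fun t => U t (t - σ))
    (fun x => (hU.continuousOn_shift hσ x).aestronglyMeasurable (hS.inter hI)) ?_
  exact (hv.comp_measurePreserving (measurePreserving_sub_restrict σ)).mono_measure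
    (Measure.restrict_mono inter_subset_left le_rfl)

theorem eLpNorm_propagatedShift_le {p : ℝ≥0∞} {M ω : ℝ}
    (hb : ∀ s ∈ I, ∀ t ∈ I, s ≤ t → ‖U t s‖ ≤ M * Real.exp (ω * (t - s))) (hσ : 0 ≤ σ)
    (hv : AEStronglyMeasurable v (volume.restrict I)) :
    eLpNorm (propagatedShift I U σ v) p (volume.restrict I) ≤
      ENNReal.ofReal (M * Real.exp (ω * σ)) * eLpNorm v p (volume.restrict I) := by
  have hI : MeasurableSet I := Set.OrdConnected.measurableSet ‹_›
  have hS := measurableSet_sub_mem (I := I) σ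
  rw [propagatedShift, eLpNorm_indicator_eq_eLpNorm_restrict hS, Measure.restrict_restrict hS,
    ← eLpNorm_comp_measurePreserving hv (measurePreserving_sub_restrict σ)]
  refine (eLpNorm_le_mul_eLpNorm_of_ae_le_mul (c := M * Real.exp (ω * σ))
    (g := v ∘ fun t => t - σ) ?_ p).trans ?_
  · filter_upwards [ae_restrict_mem (hS.inter hI)] with t ht
    have := norm_propagatedShift_le (v := v) hb hσ ht.2 ht.1
    rwa [propagatedShift_of_mem (show t - σ ∈ I from ht.1)] at this
  · gcongr
    exact inter_subset_left

theorem IsEvolutionFamily.memE_propagatedShift {p : ℝ≥0∞} (hU : IsEvolutionFamily I U)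
    (hI : IsLeftOpen I) (hσ : 0 ≤ σ) (hv : MemE I p v) : MemE I p (propagatedShift I U σ v) := by
  obtain ⟨M, ω, hb⟩ := hU.bound
  refine ⟨⟨hU.aestronglyMeasurable_propagatedShift hσ hv.1.1, ?_⟩,
    fun hp => hU.memC0_propagatedShift hI hσ (hv.2 hp)⟩
  exact (eLpNorm_propagatedShift_le hb hσ hv.1.1).trans_lt
    (ENNReal.mul_lt_top ENNReal.ofReal_lt_top hv.1.2)

variable {p : ℝ≥0∞} [Fact (1 ≤ p)] {T : ℝ → Ep 𝕜 X I p →L[𝕜] Ep 𝕜 X I p}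

theorem IsEvolutionSemigroupOf.fn_eq (hT : IsEvolutionSemigroupOf I p T U) (hσ : 0 ≤ σ)
    {f : Ep 𝕜 X I p} (hf : fn f =ᵐ[volume.restrict I] v) :
    fn (T σ f) =ᵐ[volume.restrict I] propagatedShift I U σ v := by
  refine EventuallyEq.trans ?_ (propagatedShift_congr hf)
  filter_upwards [hT σ hσ f] with t ht
  by_cases hts : t - σ ∈ I
  · rw [propagatedShift_of_mem hts, ht.1 hts]
  · rw [propagatedShift_of_notMem hts, ht.2 hts]

theorem IsEvolutionSemigroupOf.norm_le (hT : IsEvolutionSemigroupOf I p T U) {M ω : ℝ} (hM : 0 ≤ M)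
    (hb : ∀ s ∈ I, ∀ t ∈ I, s ≤ t → ‖U t s‖ ≤ M * Real.exp (ω * (t - s))) (hσ : 0 ≤ σ) :
    ‖T σ‖ ≤ M * Real.exp (ω * σ) := by
  have h0 : 0 ≤ M * Real.exp (ω * σ) := by positivity
  refine ContinuousLinearMap.opNorm_le_bound _ h0 fun f => ?_
  rw [norm_eq_eLpNorm, norm_eq_eLpNorm, eLpNorm_congr_ae (hT.fn_eq hσ EventuallyEq.rfl),
    show M * Real.exp (ω * σ) = (ENNReal.ofReal (M * Real.exp (ω * σ))).toReal from
      (ENNReal.toReal_ofReal h0).symm, ← ENNReal.toReal_mul]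
  refine ENNReal.toReal_mono (ENNReal.mul_ne_top ENNReal.ofReal_ne_top (eLpNorm_fn_ne_top f)) ?_
  exact eLpNorm_propagatedShift_le hb hσ (Lp.aestronglyMeasurable _)

theorem IsEvolutionFamily.exists_isEvolutionSemigroupOf (hU : IsEvolutionFamily I U)
    (hI : IsLeftOpen I) :
    ∃ T : ℝ → Ep 𝕜 X I p →L[𝕜] Ep 𝕜 X I p, IsEvolutionSemigroupOf I p T U := by
  obtain ⟨M, ω, hb⟩ := hU.bound
  have key : ∀ σ : ℝ, 0 ≤ σ → ∃ L : Ep 𝕜 X I p →L[𝕜] Ep 𝕜 X I p, ∀ f,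
      fn (L f) =ᵐ[volume.restrict I] propagatedShift I U σ (fn f) := by
    intro σ hσ
    have h1 : ∀ f : Ep 𝕜 X I p, ∃ g : Ep 𝕜 X I p,
        fn g =ᵐ[volume.restrict I] propagatedShift I U σ (fn f) := by
      intro f
      obtain ⟨v, hv, hfv⟩ := memE_fn f
      exact ⟨(hU.memE_propagatedShift hI hσ hv).toEp 𝕜,
        (fn_toEp _).trans (propagatedShift_congr hfv).symm⟩
    choose φ hφ using h1
    refine ⟨LinearMap.mkContinuous ⟨⟨φ, fun f g => fn_ext ?_⟩, fun c f => fn_ext ?_⟩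
      (|M| * Real.exp (ω * σ)) fun f => ?_, hφ⟩
    · refine (hφ _).trans ((propagatedShift_congr (fn_add f g)).trans
        (EventuallyEq.trans ?_ (fn_add _ _).symm))
      filter_upwards [hφ f, hφ g] with t h1 h2
      rw [Pi.add_apply, h1, h2]
      by_cases hts : t - σ ∈ I
      · simp only [propagatedShift_of_mem hts, Pi.add_apply, map_add]
      · simp only [propagatedShift_of_notMem hts, add_zero]
    · refine (hφ _).trans ((propagatedShift_congr (fn_smul c f)).trans
        (EventuallyEq.trans ?_ (fn_smul c _).symm))
      filter_upwards [hφ f] with t h1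
      rw [Pi.smul_apply]
      erw [h1]
      by_cases hts : t - σ ∈ I
      · simp only [propagatedShift_of_mem hts, Pi.smul_apply, map_smul]
      · simp only [propagatedShift_of_notMem hts, smul_zero]
    · have h0 : 0 ≤ |M| * Real.exp (ω * σ) := by positivity
      change ‖φ f‖ ≤ _
      rw [norm_eq_eLpNorm, norm_eq_eLpNorm, eLpNorm_congr_ae (hφ f)]
      conv_rhs => rw [← ENNReal.toReal_ofReal h0, ← ENNReal.toReal_mul]
      refine ENNReal.toReal_mono (ENNReal.mul_ne_top ENNReal.ofReal_ne_top (eLpNorm_fn_ne_top f)) ?_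
      refine eLpNorm_propagatedShift_le (fun s hs t ht hst => (hb s hs t ht hst).trans ?_) hσ
        (Lp.aestronglyMeasurable _)
      exact mul_le_mul_of_nonneg_right (le_abs_self M) (Real.exp_pos _).le
  choose! L hL using key
  refine ⟨L, fun σ hσ f => ?_⟩
  filter_upwards [hL σ hσ f] with t ht
  rw [ht]
  exact ⟨fun h => propagatedShift_of_mem h, fun h => propagatedShift_of_notMem h⟩

theorem IsEvolutionSemigroupOf.zero (hT : IsEvolutionSemigroupOf I p T U)
    (hU : IsEvolutionFamily I U) : T 0 = 1 := by
  refine ContinuousLinearMap.ext fun f => fn_ext ((hT.fn_eq le_rfl EventuallyEq.rfl).trans ?_)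
  filter_upwards [ae_restrict_mem (Set.OrdConnected.measurableSet (s := I) ‹_›)] with t ht
  rw [propagatedShift_of_mem (by rwa [sub_zero]), sub_zero, hU.refl t ht]
  rfl

theorem IsEvolutionSemigroupOf.add (hT : IsEvolutionSemigroupOf I p T U)
    (hU : IsEvolutionFamily I U) {s t : ℝ} (hs : 0 ≤ s) (ht : 0 ≤ t) : T (s + t) = T s ∘L T t := by
  refine ContinuousLinearMap.ext fun f => fn_ext ?_
  refine (hT.fn_eq (add_nonneg hs ht) EventuallyEq.rfl).trans (EventuallyEq.trans ?_
    (hT.fn_eq hs (hT.fn_eq ht EventuallyEq.rfl)).symm)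
  filter_upwards [ae_restrict_mem (Set.OrdConnected.measurableSet (s := I) ‹_›)] with r hr
  have e : r - (s + t) = r - s - t := by ring
  by_cases h1 : r - s - t ∈ I
  · have h2 : r - s ∈ I := Set.OrdConnected.out ‹_› h1 hr ⟨by linarith, by linarith⟩
    rw [propagatedShift_of_mem (by rwa [e]), propagatedShift_of_mem h2, propagatedShift_of_mem h1, e,
      ← hU.comp _ h1 _ h2 r hr (by linarith) (by linarith)]
    rfl
  · rw [propagatedShift_of_notMem (by rwa [e])]
    by_cases h2 : r - s ∈ I
    · rw [propagatedShift_of_mem h2, propagatedShift_of_notMem h1, map_zero]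
    · rw [propagatedShift_of_notMem h2]

end Shift

end EvolutionSemigroup

/-! ### The closure of `G_0` generates the evolution semigroup. -/

namespace EvolutionSemigroup

section Generation

variable {𝕜 : Type*} [RCLike 𝕜] {X : Type*} [NormedAddCommGroup X] [NormedSpace 𝕜 X]
  [NormedSpace ℝ X] [IsScalarTower ℝ 𝕜 X] [CompleteSpace X]
  {I : Set ℝ} [I.OrdConnected] {p : ℝ≥0∞} [Fact (1 ≤ p)] {A : ℝ → X →ₗ.[𝕜] X} {M w w' : ℝ}
  {U : ℝ → ℝ → X →L[𝕜] X} {v v' g q q' k : ℝ → X}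

/-- Pointwise Taylor estimate for the evolution semigroup on `F_p`. -/
theorem IsPropagator.norm_propagatedShift_sub_le (h : IsStableFamily I p A M w w')
    (hU : IsPropagator I A M w' U) (hv : IsFp I p A v v' g) (hq : IsFp I p A q q' k) {σ : ℝ}
    (hσ : 0 ≤ σ) (hσ1 : σ ≤ 1) {t : ℝ} (ht : t ∈ I) {B : ℝ}
    (hB : ∀ s ∈ I, t - σ ≤ s → s ≤ t →
      M * Real.exp |w'| ^ 2 * ∫ τ in s..t, (‖g τ - v' τ - q τ‖ + σ * ‖q' τ - k τ‖) ≤ B) :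
    ‖propagatedShift I U σ v t - v t - σ • q t‖ ≤ B := by
  have hM := h.kato.nonneg
  set K := M * Real.exp |w'| ^ 2 with hK
  have hK0 : 0 ≤ K := by positivity
  -- This comparison function equals `v` at time `t - σ` and `v t + σ • q t` at time `t`. Its
  -- residual is `-(g - v' - q)` plus a term of size `σ`, hence small when `q` is close to `G_0 v`.
  have hreg : ∀ s ∈ I, s ≤ t → IsRegularOn A s t (v + fun τ => (τ - (t - σ)) • q τ)
      (v' + fun τ => (1 : ℝ) • q τ + (τ - (t - σ)) • q' τ)
      (g + fun τ => (τ - (t - σ)) • k τ) := by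
    intro s hs hst
    refine (hv.isRegularOn hs ht).add ((hq.isRegularOn hs ht).smul hst
      (ρ := fun τ => τ - (t - σ)) (ρ' := fun _ => 1) continuousOn_const fun r _ => ?_)
    simp
  have hint : ∀ s ∈ I, t - σ ≤ s → s ≤ t →
      K * ∫ τ in s..t, ‖(v' + fun τ => (1 : ℝ) • q τ + (τ - (t - σ)) • q' τ) τ -
        (g + fun τ => (τ - (t - σ)) • k τ) τ‖ ≤ B := by
    intro s hs hσs hst
    refine le_trans (mul_le_mul_of_nonneg_left ?_ hK0) (hB s hs hσs hst)
    refine intervalIntegral.integral_mono_on hst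
      ((hreg s hs hst).integrable'.sub (hreg s hs hst).integrable).norm ?_ fun τ hτ => ?_
    · have i1 := hv.isRegularOn hs ht
      have i2 := hq.isRegularOn hs ht
      have i3 : IntervalIntegrable q volume s t := hq.w10.memE.intervalIntegrable hs ht
      exact ((i1.integrable.sub i1.integrable').sub i3).norm.add
        ((i2.integrable'.sub i2.integrable).norm.const_mul σ)
    · have e : (v' + fun τ => (1 : ℝ) • q τ + (τ - (t - σ)) • q' τ) τ -
          (g + fun τ => (τ - (t - σ)) • k τ) τ =
          (τ - (t - σ)) • (q' τ - k τ) - (g τ - v' τ - q τ) := by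
        simp only [Pi.add_apply, one_smul, smul_sub]; abel
      rw [e]
      refine (_root_.norm_sub_le _ _).trans ?_
      rw [add_comm, norm_smul, Real.norm_of_nonneg (by linarith [hτ.1])]
      refine add_le_add le_rfl (mul_le_mul_of_nonneg_right ?_ (norm_nonneg _))
      linarith [hτ.2]
  have hz : (v + fun τ => (τ - (t - σ)) • q τ) t = v t + σ • q t := by
    simp only [Pi.add_apply, sub_sub_cancel]
  by_cases hts : t - σ ∈ I
  · have h1 := hU (t - σ) hts t ht (by linarith) 1 (by linarith) _ _ _
      (hreg _ hts (by linarith)) (v (t - σ))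
    rw [mul_one, hz] at h1
    rw [propagatedShift_of_mem hts, sub_sub, norm_sub_rev]
    have h2 := hint _ hts le_rfl (by linarith)
    refine h1.trans (le_trans (le_of_eq ?_) h2)
    rw [← hK]
    simp
  -- When `t - σ` lies to the left of `I`, the comparison starts at a point `s` so close to the left
  -- end that `v` and `q` are negligible there. Then `t - σ ≤ s` holds by convexity of `I`, and the
  -- a priori estimate replaces the propagator inequality.
  · rw [propagatedShift_of_notMem hts, sub_sub, norm_sub_rev, sub_zero]
    refine le_of_forall_pos_le_add fun ε hε => ?_
    have hη : 0 < ε / (2 * (K + 1)) := by positivity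
    obtain ⟨K₁, hK₁I, hK₁, hv1⟩ := (memC0_iff.1 hv.w10.memC0).2 _ hη
    obtain ⟨K₂, hK₂I, hK₂, hq1⟩ := (memC0_iff.1 hq.w10.memC0).2 _ hη
    obtain ⟨s, hs, hst, hsK⟩ := h.leftOpen.exists_notMem_compact (hK₁.union hK₂)
      (union_subset hK₁I hK₂I) ht
    have hσs : t - σ ≤ s := by
      by_contra hc
      exact hts (Set.OrdConnected.out ‹_› hs ht ⟨(not_le.1 hc).le, by linarith⟩)
    have h1 := h.norm_le_mul hs ht hst (ℓ := 1) (by linarith) (hreg s hs hst)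
    rw [mul_one, hz] at h1
    have h2 := hint s hs hσs hst
    have h3 : ‖(v + fun τ => (τ - (t - σ)) • q τ) s‖ ≤ ε / (2 * (K + 1)) + ε / (2 * (K + 1)) := by
      refine (norm_add_le _ _).trans (add_le_add
        (hv1 s hs fun h' => hsK (Or.inl h')).le ?_)
      rw [norm_smul, Real.norm_of_nonneg (by linarith)]
      refine (mul_le_of_le_one_left (norm_nonneg _) (by linarith)).trans ?_
      exact (hq1 s hs fun h' => hsK (Or.inr h')).le
    have h4 : (K + 1) * (ε / (2 * (K + 1)) + ε / (2 * (K + 1))) = ε := by field_simp; ring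
    refine h1.trans ?_
    rw [mul_add]
    have h5 := mul_le_mul_of_nonneg_left h3 hK0
    linarith

/-- Taylor estimate for the evolution semigroup in `L^p`. -/
theorem IsPropagator.eLpNorm_propagatedShift_sub_le (h : IsStableFamily I p A M w w')
    (hU : IsPropagator I A M w' U) (hv : IsFp I p A v v' g) (hq : IsFp I p A q q' k) {σ : ℝ}
    (hσ : 0 ≤ σ) (hσ1 : σ ≤ 1) :
    eLpNorm (fun t => propagatedShift I U σ v t - v t - σ • q t) p (volume.restrict I) ≤
      ENNReal.ofReal σ * (ENNReal.ofReal (M * Real.exp |w'| ^ 2) *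
        (eLpNorm (fun τ => g τ - v' τ - q τ) p (volume.restrict I) +
          ENNReal.ofReal σ * eLpNorm (fun τ => q' τ - k τ) p (volume.restrict I))) := by
  have hM := h.kato.nonneg
  have hI : MeasurableSet I := Set.OrdConnected.measurableSet ‹_›
  have hp : 1 ≤ p := Fact.out
  set K := M * Real.exp |w'| ^ 2 with hK
  have hK0 : 0 ≤ K := by positivity
  set ψ : ℝ → ℝ := fun τ => ‖g τ - v' τ - q τ‖ + σ * ‖q' τ - k τ‖ with hψ
  have hψ0 : ∀ τ, 0 ≤ ψ τ := fun τ => by positivity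
  have m1 : AEStronglyMeasurable (fun τ => g τ - v' τ - q τ) (volume.restrict I) :=
    (hv.memE.1.1.sub hv.w10.memE'.1.1).sub hq.w10.memE.1.1
  have m2 : AEStronglyMeasurable (fun τ => q' τ - k τ) (volume.restrict I) :=
    hq.w10.memE'.1.1.sub hq.memE.1.1
  have mψ : AEStronglyMeasurable ψ (volume.restrict I) := m1.norm.add (m2.norm.const_mul σ)
  have m : AEStronglyMeasurable (I.indicator fun τ => K * ψ τ) volume :=
    (aestronglyMeasurable_indicator_iff hI).2 (mψ.const_mul K)
  -- The pointwise bound is a moving integral of length `σ` of the residual, extended by `0` outside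
  -- `I`. Young's inequality supplies the factor `σ` in `L^p`.
  have key := eLpNorm_movingIntegral_le hp m (σ := σ) (μ := volume.restrict I)
    (F := fun t => ‖propagatedShift I U σ v t - v t - σ • q t‖) Measure.restrict_le_self (by
      filter_upwards [ae_restrict_mem hI] with t ht
      by_cases htop : ∫⁻ τ in Ioc (t - σ) t, ‖I.indicator (fun τ => K * ψ τ) τ‖ₑ = ∞
      · rw [htop]; exact le_top
      rw [← ofReal_norm, norm_norm]
      have hle : ∀ s ∈ I, t - σ ≤ s → s ≤ t → ENNReal.ofReal (K * ∫ τ in s..t, ψ τ) ≤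
          ∫⁻ τ in Ioc (t - σ) t, ‖I.indicator (fun τ => K * ψ τ) τ‖ₑ := by
        intro s hs hσs hst
        have hsub : Ioc s t ⊆ I := Ioc_subset_Icc_self.trans (Set.OrdConnected.out ‹_› hs ht)
        have i1 := hv.isRegularOn hs ht
        have i2 := hq.isRegularOn hs ht
        have i3 : IntervalIntegrable q volume s t := hq.w10.memE.intervalIntegrable hs ht
        have i4 : IntervalIntegrable ψ volume s t :=
          ((i1.integrable.sub i1.integrable').sub i3).norm.add
            ((i2.integrable'.sub i2.integrable).norm.const_mul σ)
        have i5 : Integrable (fun τ => K * ψ τ) (volume.restrict (Ioc s t)) :=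
          ((intervalIntegrable_iff_integrableOn_Ioc_of_le hst).1 i4).const_mul K
        rw [← intervalIntegral.integral_const_mul, intervalIntegral.integral_of_le hst,
          ofReal_integral_eq_lintegral_ofReal i5
            (Eventually.of_forall fun τ => mul_nonneg hK0 (hψ0 τ))]
        refine le_trans ?_ (lintegral_mono_set (Ioc_subset_Ioc_left hσs))
        refine setLIntegral_mono_ae' measurableSet_Ioc (Eventually.of_forall fun τ hτ => ?_)
        rw [indicator_of_mem (hsub hτ), Real.enorm_of_nonneg (mul_nonneg hK0 (hψ0 τ))]
      rw [← ENNReal.ofReal_toReal htop]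
      refine ENNReal.ofReal_le_ofReal (hU.norm_propagatedShift_sub_le h hv hq hσ hσ1 ht
        fun s hs hσs hst => ?_)
      have h1 := ENNReal.toReal_mono htop (hle s hs hσs hst)
      rwa [ENNReal.toReal_ofReal (mul_nonneg hK0
        (intervalIntegral.integral_nonneg hst fun τ _ => hψ0 τ))] at h1)
  rw [eLpNorm_norm] at key
  refine key.trans ?_
  gcongr
  rw [eLpNorm_indicator_eq_eLpNorm_restrict hI]
  have e1 : (fun τ => K * ψ τ) = K • ψ := rfl
  rw [e1, eLpNorm_const_smul, Real.enorm_of_nonneg hK0]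
  gcongr
  have e2 : ψ = (fun τ => ‖g τ - v' τ - q τ‖) + σ • fun τ => ‖q' τ - k τ‖ := rfl
  rw [e2]
  refine (eLpNorm_add_le m1.norm (m2.norm.const_smul σ) hp).trans ?_
  rw [eLpNorm_const_smul, Real.enorm_of_nonneg hσ, eLpNorm_norm, eLpNorm_norm]

variable {T : ℝ → Ep 𝕜 X I p →L[𝕜] Ep 𝕜 X I p}

/-- The image `f'` of `f` need not lie in `F_p`, so a nearby `e ∈ F_p` takes its place. The error
stays small if `e` is chosen first and `σ` afterwards. -/
theorem IsPropagator.norm_evolutionSemigroup_sub_le (h : IsStableFamily I p A M w w')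
    (hU : IsPropagator I A M w' U) (hT : IsEvolutionSemigroupOf I p T U) {f f' e e' : Ep 𝕜 X I p}
    (hf : (f, f') ∈ (G0 I p A).graph) (he : (e, e') ∈ (G0 I p A).graph) {σ : ℝ}
    (hσ : 0 ≤ σ) (hσ1 : σ ≤ 1) :
    ‖T σ f - f - (σ : 𝕜) • e‖ ≤ σ * (M * Real.exp |w'| ^ 2 * (‖f' - e‖ + σ * ‖e'‖)) := by
  have hM := h.kato.nonneg
  rw [G0_graph] at hf he
  obtain ⟨v, v', g, hv, hfv, hfv'⟩ := hf
  obtain ⟨q, q', k, hq, heq, heq'⟩ := he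
  dsimp only at hfv hfv' heq heq'
  have e1 : fn (T σ f - f - (σ : 𝕜) • e) =ᵐ[volume.restrict I]
      fun t => propagatedShift I U σ v t - v t - σ • q t := by
    filter_upwards [fn_sub (T σ f - f) ((σ : 𝕜) • e), fn_sub (T σ f) f, fn_smul (σ : 𝕜) e,
      hT.fn_eq hσ hfv, hfv, heq] with t h1 h2 h3 h4 h5 h6
    rw [h1, Pi.sub_apply, h2, Pi.sub_apply, h3, Pi.smul_apply, h4, h5, h6,
      RCLike.real_smul_eq_coe_smul (K := 𝕜)]
  have e2 : fn (f' - e) =ᵐ[volume.restrict I] fun τ => g τ - v' τ - q τ := by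
    filter_upwards [fn_sub f' e, hfv', heq] with t h1 h2 h3
    rw [h1, Pi.sub_apply, h2, h3, Pi.add_apply, Pi.neg_apply]
    abel
  have e3 : eLpNorm (fun τ => q' τ - k τ) p (volume.restrict I) = ENNReal.ofReal ‖e'‖ := by
    rw [← eLpNorm_eq_ofReal_norm heq', ← eLpNorm_neg (f := -q' + k)]
    congr 1
    ext τ
    simp only [Pi.neg_apply, Pi.add_apply]
    abel
  have key := hU.eLpNorm_propagatedShift_sub_le h hv hq hσ hσ1
  rw [eLpNorm_eq_ofReal_norm e1, eLpNorm_eq_ofReal_norm e2, e3, ← ENNReal.ofReal_mul hσ,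
    ← ENNReal.ofReal_add (norm_nonneg _) (by positivity), ← ENNReal.ofReal_mul (by positivity),
    ← ENNReal.ofReal_mul hσ] at key
  exact (ENNReal.ofReal_le_ofReal_iff (by positivity)).1 key

/-- With `e = 0` the Taylor estimate gives local Lipschitz continuity of orbits starting in `F_p`.
Density of `F_p` and local boundedness of `T` extend continuity to all orbits, by uniform limits. -/
theorem IsPropagator.isC0Semigroup (h : IsStableFamily I p A M w w')
    (hU : IsPropagator I A M w' U) (hUe : IsEvolutionFamily I U)
    (hb : ∀ s ∈ I, ∀ t ∈ I, s ≤ t → ‖U t s‖ ≤ M * Real.exp ((w + w') / 2 * (t - s)))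
    (hT : IsEvolutionSemigroupOf I p T U) : IsC0Semigroup T where
  zero := hT.zero hUe
  add := fun _ _ hs ht => hT.add hUe hs ht
  cont := by
    have hM := h.kato.nonneg
    set K := M * Real.exp |w'| ^ 2 with hK
    have hK0 : 0 ≤ K := by positivity
    -- continuity at `0` on the domain
    have hC : ∀ S : ℝ, ∃ C : ℝ, 0 ≤ C ∧ ∀ σ ∈ Icc 0 S, ‖T σ‖ ≤ C := fun S =>
      ⟨M * Real.exp (|(w + w') / 2| * |S|), by positivity, fun σ hσ =>
        (hT.norm_le hM hb hσ.1).trans (mul_le_mul_of_nonneg_left (Real.exp_le_exp.2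
          (mul_le_mul (le_abs_self _) (hσ.2.trans (le_abs_self _)) hσ.1 (abs_nonneg _))) hM)⟩
    have hdom : ∀ f ∈ (G0 I p A).domain, ∀ S : ℝ, ContinuousOn (fun σ => T σ f) (Icc 0 S) := by
      intro f hf S
      obtain ⟨C, hC0, hC⟩ := hC S
      obtain ⟨f', hff'⟩ : ∃ f', (f, f') ∈ (G0 I p A).graph :=
        ⟨G0 I p A ⟨f, hf⟩, (G0 I p A).mem_graph ⟨f, hf⟩⟩
      have hstep : ∀ σ ∈ Icc 0 S, ∀ r ∈ Icc 0 S, σ ≤ r → r - σ ≤ 1 →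
          ‖T r f - T σ f‖ ≤ C * (K * ‖f'‖) * |r - σ| := by
        intro σ hσ r hr hσr hle
        have h1 : T r f = T σ (T (r - σ) f) := by
          have := hT.add hUe hσ.1 (sub_nonneg.2 hσr)
          rw [add_sub_cancel] at this
          rw [this]; rfl
        have h2 := hU.norm_evolutionSemigroup_sub_le h hT hff' (G0 I p A).graph.zero_mem
          (sub_nonneg.2 hσr) hle
        simp only [smul_zero, sub_zero, norm_zero, mul_zero,
          add_zero] at h2
        rw [h1, ← map_sub, abs_of_nonneg (sub_nonneg.2 hσr)]
        refine ((T σ).le_of_opNorm_le_of_le (hC σ hσ) h2).trans_eq ?_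
        ring
      intro σ hσ
      rw [ContinuousWithinAt, tendsto_iff_norm_sub_tendsto_zero]
      have hlim : Tendsto (fun r => C * (K * ‖f'‖) * |r - σ|) (𝓝[Icc 0 S] σ) (𝓝 0) := by
        have : Continuous fun r => C * (K * ‖f'‖) * |r - σ| := by fun_prop
        have := (this.tendsto σ).mono_left (nhdsWithin_le_nhds (s := Icc 0 S))
        simpa using this
      refine squeeze_zero_norm' ?_ hlim
      filter_upwards [self_mem_nhdsWithin, mem_nhdsWithin_of_mem_nhds
        (Metric.ball_mem_nhds σ one_pos)] with r hr hball
      rw [Metric.mem_ball, Real.dist_eq, abs_lt] at hball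
      rw [norm_norm]
      rcases le_total σ r with hσr | hσr
      · exact hstep σ hσ r hr hσr hball.2.le
      · rw [norm_sub_rev, abs_sub_comm]
        exact hstep r hr σ hσ hσr (by linarith)
    have hall : ∀ f : Ep 𝕜 X I p, ∀ S : ℝ, ContinuousOn (fun σ => T σ f) (Icc 0 S) := by
      intro f S
      obtain ⟨C, hC0, hC⟩ := hC S
      have happ : ∀ n : ℕ, ∃ e ∈ (G0 I p A).domain, ‖f - e‖ < 1 / (n + 1) := by
        intro n
        obtain ⟨e, he, he'⟩ := Metric.dense_iff.1 h.domain_dense f (1 / (n + 1)) (by positivity)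
        exact ⟨e, he', by rw [← dist_eq_norm, dist_comm]; exact he⟩
      choose e he hfe using happ
      have hu : TendstoUniformlyOn (fun n σ => T σ (e n)) (fun σ => T σ f) atTop (Icc 0 S) := by
        rw [Metric.tendstoUniformlyOn_iff]
        intro ε hε
        have hlim : Tendsto (fun n : ℕ => C * ((1 : ℝ) / (n + 1))) atTop (𝓝 (C * 0)) :=
          tendsto_one_div_add_atTop_nhds_zero_nat.const_mul C
        rw [mul_zero] at hlim
        filter_upwards [hlim.eventually (gt_mem_nhds hε)] with n hn σ hσ
        rw [dist_eq_norm, ← map_sub]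
        exact ((T σ).le_of_opNorm_le_of_le (hC σ hσ) (hfe n).le).trans_lt hn
      exact hu.continuousOn (Eventually.of_forall fun n => hdom (e n) (he n) S).frequently
    intro f σ hσ
    refine (hall f (σ + 1) σ ⟨hσ, by linarith⟩).mono_of_mem_nhdsWithin ?_
    filter_upwards [self_mem_nhdsWithin,
      mem_nhdsWithin_of_mem_nhds (Iio_mem_nhds (show σ < σ + 1 by linarith))] with r hr hr'
    exact ⟨hr, hr'.le⟩

/-- Divide the Taylor estimate by `σ`. The choice of `e` near `f'` fixes `‖e'‖`, and `σ ↓ 0` removes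
the term containing it. -/
theorem IsPropagator.inGenerator (h : IsStableFamily I p A M w w')
    (hU : IsPropagator I A M w' U) (hT : IsEvolutionSemigroupOf I p T U) {f f' : Ep 𝕜 X I p}
    (hf : (f, f') ∈ (G0 I p A).graph) : InGenerator T f f' := by
  have hM := h.kato.nonneg
  set K := M * Real.exp |w'| ^ 2 with hK
  have hK0 : 0 ≤ K := by positivity
  rw [InGenerator, Metric.tendsto_nhds]
  intro ε hε
  obtain ⟨e, he, he'⟩ := Metric.dense_iff.1 h.domain_dense f' (ε / (2 * (K + 1))) (by positivity)
  rw [Metric.mem_ball, dist_comm, dist_eq_norm] at he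
  obtain ⟨e', hee'⟩ : ∃ e', (e, e') ∈ (G0 I p A).graph :=
    ⟨G0 I p A ⟨e, he'⟩, (G0 I p A).mem_graph ⟨e, he'⟩⟩
  have hδ : 0 < ε / (2 * (K * ‖e'‖ + 1)) := by positivity
  filter_upwards [Ioo_mem_nhdsGT (lt_min hδ one_pos)] with σ hσ
  have hσ0 := hσ.1
  have hσδ := hσ.2.trans_le (min_le_left _ _)
  have h1 := hU.norm_evolutionSemigroup_sub_le h hT hf hee' hσ0.le
    (hσ.2.trans_le (min_le_right _ _)).le
  rw [← hK] at h1
  have hne : (σ : 𝕜) ≠ 0 := by exact_mod_cast hσ0.ne'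
  have e1 : ((σ⁻¹ : ℝ) : 𝕜) • (T σ f - f) - f' =
      ((σ⁻¹ : ℝ) : 𝕜) • (T σ f - f - (σ : 𝕜) • e) - (f' - e) := by
    rw [smul_sub _ (T σ f - f) _, smul_smul, RCLike.ofReal_inv, inv_mul_cancel₀ hne, one_smul]
    abel
  rw [dist_eq_norm, e1]
  refine (_root_.norm_sub_le _ _).trans_lt ?_
  rw [norm_smul, RCLike.norm_ofReal, abs_inv, abs_of_pos hσ0]
  have h2 : σ⁻¹ * ‖T σ f - f - (σ : 𝕜) • e‖ ≤ K * (‖f' - e‖ + σ * ‖e'‖) := by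
    rw [inv_mul_le_iff₀ hσ0]; exact h1
  rw [lt_div_iff₀ (by positivity)] at he hσδ
  have h3 : σ * (K * ‖e'‖) ≤ σ * (K * ‖e'‖ + 1) := by nlinarith
  nlinarith

theorem IsPropagator.closure_isGeneratorOf (h : IsStableFamily I p A M w w')
    (hU : IsPropagator I A M w' U) (hUe : IsEvolutionFamily I U)
    (hb : ∀ s ∈ I, ∀ t ∈ I, s ≤ t → ‖U t s‖ ≤ M * Real.exp ((w + w') / 2 * (t - s)))
    (hT : IsEvolutionSemigroupOf I p T U) :
    (G0 I p A).IsClosable ∧ IsGeneratorOf (G0 I p A).closure T := by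
  have hlt := h.lt
  exact EvolutionSemigroup.closure_isGeneratorOf (hU.isC0Semigroup h hUe hb hT)
    (fun t ht => hT.norm_le h.kato.nonneg hb ht) (l := w') (by linarith)
    (fun f f' hf => hU.inGenerator h hT hf) h.range_dense

/-- The evolution family is determined by the closure of `G_0`. -/
theorem IsPropagator.eq_of_generates (h : IsStableFamily I p A M w w')
    (hU : IsPropagator I A M w' U) (hUe : IsEvolutionFamily I U)
    (hb : ∀ s ∈ I, ∀ t ∈ I, s ≤ t → ‖U t s‖ ≤ M * Real.exp ((w + w') / 2 * (t - s)))
    {V : ℝ → ℝ → X →L[𝕜] X} (hV : IsEvolutionFamily I V)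
    (hVG : GeneratesEvolutionSemigroup I p (G0 I p A).closure V) :
    ∀ s ∈ I, ∀ t ∈ I, s ≤ t → V t s = U t s := by
  obtain ⟨T, hT⟩ := hUe.exists_isEvolutionSemigroupOf (p := p) h.leftOpen
  obtain ⟨S, hS0, hSG, hS⟩ := hVG
  obtain ⟨hcl, hTG⟩ := hU.closure_isGeneratorOf h hUe hb hT
  have hT0 := hU.isC0Semigroup h hUe hb hT
  have hD : Dense ((G0 I p A).closure.domain : Set (Ep 𝕜 X I p)) :=
    h.domain_dense.mono (G0 I p A).le_closure.1
  have hST : ∀ σ, 0 ≤ σ → S σ = T σ := fun σ hσ =>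
    hS0.eq_of_isGeneratorOf hT0 hSG hTG hD (fun t ht => hT.norm_le h.kato.nonneg hb ht) hσ
  -- The two semigroups coincide, so the shifts of `v` by `t - s` agree almost everywhere. Both lie
  -- in `C_0(I, X)`, hence they agree at the point `t`, where they take the values `V(t, s) v(s)`
  -- and `U(t, s) v(s)`. The values `v(s)` are dense in `X`.
  have key : ∀ v v' g : ℝ → X, IsFp I p A v v' g → ∀ s ∈ I, ∀ t ∈ I, s ≤ t →
      V t s (v s) = U t s (v s) := by
    intro v v' g hv s hs t ht hst
    have hσ : 0 ≤ t - s := sub_nonneg.2 hst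
    have h1 : propagatedShift I V (t - s) v =ᵐ[volume.restrict I] propagatedShift I U (t - s) v := by
      refine (hS.fn_eq hσ (fn_toEp hv.w10.memE)).symm.trans ?_
      rw [hST _ hσ]
      exact hT.fn_eq hσ (fn_toEp _)
    have h2 := h.leftOpen.norm_le_of_ae (C := 0)
      ((hV.memC0_propagatedShift h.leftOpen hσ hv.w10.memC0).1.sub
        (hUe.memC0_propagatedShift h.leftOpen hσ hv.w10.memC0).1) (by
        filter_upwards [h1] with r hr
        rw [Pi.sub_apply, hr, sub_self, norm_zero]) t ht
    have hts : t - (t - s) ∈ I := by rwa [sub_sub_cancel]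
    rw [norm_le_zero_iff, Pi.sub_apply, propagatedShift_of_mem hts, propagatedShift_of_mem hts,
      sub_sub_cancel] at h2
    exact sub_eq_zero.1 h2
  intro s hs t ht hst
  refine ContinuousLinearMap.ext fun x => ?_
  refine eq_of_forall_norm_sub_le_mul (C := ‖V t s‖ + ‖U t s‖) fun ε hε => ?_
  obtain ⟨v, v', g, hv, hvx⟩ := h.exists_isFp_norm_apply_sub_le hs x hε
  have e1 : V t s x - U t s x = U t s (v s - x) - V t s (v s - x) := by
    rw [map_sub, map_sub, key v v' g hv s hs t ht hst]; abel
  rw [e1]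
  refine (_root_.norm_sub_le _ _).trans ?_
  have h1 := (U t s).le_opNorm_of_le hvx
  have h2 := (V t s).le_opNorm_of_le hvx
  linarith

end Generation

end EvolutionSemigroup

/-! ### Mild solutions, truncated orbits and the kernel of the closure. -/

namespace EvolutionSemigroup

section Approximation

variable {𝕜 : Type*} [RCLike 𝕜] {X : Type*} [NormedAddCommGroup X] {I : Set ℝ} {p : ℝ≥0∞}

theorem MemC0.of_tendstoUniformlyOn {v : ℕ → ℝ → X} {u : ℝ → X} (hv : ∀ n, MemC0 I (v n))
    (h : TendstoUniformlyOn v u atTop I) : MemC0 I u := by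
  refine memC0_iff.2 ⟨h.continuousOn (Eventually.of_forall fun n => (hv n).1).frequently,
    fun ε hε => ?_⟩
  obtain ⟨n, hn⟩ := (Metric.tendstoUniformlyOn_iff.1 h (ε / 2) (half_pos hε)).exists
  obtain ⟨K, hKI, hK, h1⟩ := (memC0_iff.1 (hv n)).2 (ε / 2) (half_pos hε)
  refine ⟨K, hKI, hK, fun t ht htK => ?_⟩
  have h2 := hn t ht
  rw [dist_eq_norm] at h2
  have h3 := norm_sub_norm_le (u t) (v n t)
  linarith [h1 t ht htK]

theorem eLpNorm_indicator_Icc_ne_top {s e : ℝ} :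
    eLpNorm ((Icc s e).indicator fun _ => (1 : ℝ)) p (volume.restrict I) ≠ ∞ := by
  refine (memLp_indicator_const p measurableSet_Icc (1 : ℝ) (Or.inr ?_)).2.ne
  exact ((Measure.restrict_apply_le _ _).trans_lt (by simp)).ne

theorem tendsto_toEp [NormedSpace 𝕜 X] [Fact (1 ≤ p)] {v : ℕ → ℝ → X} {u : ℝ → X} (hv : ∀ n, MemE I p (v n)) (hu : MemE I p u)
    (h : Tendsto (fun n => eLpNorm (v n - u) p (volume.restrict I)) atTop (𝓝 0)) :
    Tendsto (fun n => (hv n).toEp 𝕜) atTop (𝓝 (hu.toEp 𝕜)) := by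
  rw [tendsto_iff_norm_sub_tendsto_zero]
  have h1 := (ENNReal.tendsto_toReal ENNReal.zero_ne_top).comp h
  refine h1.congr fun n => ?_
  rw [norm_eq_eLpNorm, Function.comp]
  congr 1
  refine eLpNorm_congr_ae ?_
  filter_upwards [fn_sub ((hv n).toEp 𝕜) (hu.toEp 𝕜), fn_toEp (𝕜 := 𝕜) (hv n),
    fn_toEp (𝕜 := 𝕜) hu] with t h1 h2 h3
  rw [h1, Pi.sub_apply, Pi.sub_apply, h2, h3]

variable [I.OrdConnected] {s e : ℝ}

theorem eLpNorm_le_of_eq_zero_off {w : ℝ → X} {ε : ℝ}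
    (hw : ∀ t ∈ I, ‖w t‖ ≤ ε) (h0 : ∀ t ∈ I, t ∉ Icc s e → w t = 0) :
    eLpNorm w p (volume.restrict I) ≤ ENNReal.ofReal ε *
      eLpNorm ((Icc s e).indicator fun _ => (1 : ℝ)) p (volume.restrict I) := by
  refine eLpNorm_le_mul_eLpNorm_of_ae_le_mul ?_ p
  filter_upwards [ae_restrict_mem (Set.OrdConnected.measurableSet (s := I) ‹_›)] with t ht
  by_cases hts : t ∈ Icc s e
  · rw [indicator_of_mem hts, norm_one, mul_one]; exact hw t ht
  · rw [indicator_of_notMem hts, h0 t ht hts]; simp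

theorem MemC0.memE_of_eq_zero_off {w : ℝ → X} (hw : MemC0 I w)
    (h0 : ∀ t ∈ I, t ∉ Icc s e → w t = 0) : MemE I p w := by
  obtain ⟨C, hC⟩ := hw.exists_bound
  refine ⟨⟨hw.1.aestronglyMeasurable (Set.OrdConnected.measurableSet ‹_›), ?_⟩, fun _ => hw⟩
  exact (eLpNorm_le_of_eq_zero_off hC h0).trans_lt
    (ENNReal.mul_lt_top ENNReal.ofReal_lt_top eLpNorm_indicator_Icc_ne_top.lt_top)

theorem tendsto_eLpNorm_of_tendstoUniformlyOn {v : ℕ → ℝ → X} {u : ℝ → X}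
    (h : TendstoUniformlyOn v u atTop I) (hv : ∀ n, ∀ t ∈ I, t ∉ Icc s e → v n t = 0)
    (hu : ∀ t ∈ I, t ∉ Icc s e → u t = 0) :
    Tendsto (fun n => eLpNorm (v n - u) p (volume.restrict I)) atTop (𝓝 0) := by
  rw [ENNReal.tendsto_nhds_zero]
  intro δ hδ
  set N := eLpNorm ((Icc s e).indicator fun _ => (1 : ℝ)) p (volume.restrict I) with hN
  have hN' : N ≠ ∞ := eLpNorm_indicator_Icc_ne_top
  have hlim : Tendsto (fun ε : ℝ => ENNReal.ofReal ε * N) (𝓝[>] 0) (𝓝 (ENNReal.ofReal 0 * N)) :=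
    (ENNReal.Tendsto.mul_const ((ENNReal.continuous_ofReal.tendsto 0).mono_left
      nhdsWithin_le_nhds) (Or.inr hN'))
  rw [ENNReal.ofReal_zero, zero_mul] at hlim
  obtain ⟨ε, hε, hε0⟩ := ((hlim.eventually (gt_mem_nhds hδ)).and self_mem_nhdsWithin).exists
  filter_upwards [Metric.tendstoUniformlyOn_iff.1 h ε hε0] with n hn
  refine (eLpNorm_le_of_eq_zero_off (s := s) (e := e) (fun t ht => ?_) fun t ht hts => ?_).trans
    hε.le
  · have := (hn t ht).le
    rwa [dist_comm, dist_eq_norm] at this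
  · rw [Pi.sub_apply, hv n t ht hts, hu t ht hts, sub_zero]

theorem eLpNorm_smul_le_of_eq_zero_off [NormedSpace ℝ X] {φ : ℝ → ℝ} {C : ℝ} {w : ℝ → X}
    (hφ : ∀ t ∈ I, ‖φ t‖ ≤ C) (h0 : ∀ t ∈ I, t ∉ Icc s e → φ t = 0) :
    eLpNorm (fun t => φ t • w t) p (volume.restrict I) ≤
      ENNReal.ofReal C * eLpNorm w p (volume.restrict (Icc s e)) := by
  refine (eLpNorm_le_mul_eLpNorm_of_ae_le_mul (c := C) (g := (Icc s e).indicator w) ?_ p).trans ?_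
  · filter_upwards [ae_restrict_mem (Set.OrdConnected.measurableSet (s := I) ‹_›)] with t ht
    by_cases hts : t ∈ Icc s e
    · rw [indicator_of_mem hts, norm_smul]
      exact mul_le_mul_of_nonneg_right (hφ t ht) (norm_nonneg _)
    · rw [indicator_of_notMem hts, h0 t ht hts]; simp
  · gcongr
    rw [eLpNorm_indicator_eq_eLpNorm_restrict measurableSet_Icc]
    exact eLpNorm_mono_measure _ (Measure.restrict_mono_measure Measure.restrict_le_self _)

end Approximation

section Derivative

variable {I : Set ℝ} {φ : ℝ → ℝ}

theorem derivWithin_eq_zero_of_eventually_eq_const {c t : ℝ} (ht : t ∈ I)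
    (h : ∀ᶠ r in 𝓝[I] t, φ r = c) : derivWithin φ I t = 0 := by
  have h1 : φ =ᶠ[𝓝[I] t] fun _ => c := h
  rw [h1.derivWithin_eq (h1.self_of_nhdsWithin ht)]
  simp

/-- The derivative within `I` is used because `(a, b]` contains its end point `b`, where cut-offs
are differentiable only from the left. The fundamental theorem needs the derivative in the interior
only. -/
theorem sub_eq_integral_derivWithin [I.OrdConnected] (hφ : ContDiffOn ℝ 1 φ I)
    (hI : UniqueDiffOn ℝ I) : ∀ r ∈ I, ∀ q ∈ I, φ q - φ r = ∫ τ in r..q, derivWithin φ I τ := by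
  have hc := hφ.continuousOn_derivWithin hI le_rfl
  have key : ∀ r ∈ I, ∀ q ∈ I, r ≤ q → φ q - φ r = ∫ τ in r..q, derivWithin φ I τ := by
    intro r hr q hq hrq
    have hsub : Icc r q ⊆ I := Set.OrdConnected.out ‹_› hr hq
    refine (intervalIntegral.integral_eq_sub_of_hasDerivAt_of_le hrq (hφ.continuousOn.mono hsub)
      (fun x hx => ?_) ?_).symm
    · exact ((hφ.differentiableOn one_ne_zero x
        (hsub (Ioo_subset_Icc_self hx))).hasDerivWithinAt).hasDerivAt
        (mem_of_superset (Icc_mem_nhds hx.1 hx.2) hsub)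
    · exact ContinuousOn.intervalIntegrable (by rw [uIcc_of_le hrq]; exact hc.mono hsub)
  intro r hr q hq
  rcases le_total r q with hrq | hrq
  · exact key r hr q hq hrq
  · rw [intervalIntegral.integral_symm, ← key q hq r hr hrq]; ring

end Derivative

section MildSolutions

variable {𝕜 : Type*} [RCLike 𝕜] {X : Type*} [NormedAddCommGroup X] [NormedSpace 𝕜 X]
  {I : Set ℝ} {U : ℝ → ℝ → X →L[𝕜] X} {s e : ℝ}

theorem IsEvolutionFamily.continuousOn_right [I.OrdConnected] (hUe : IsEvolutionFamily I U) {r t : ℝ} (hr : r ∈ I)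
    (ht : t ∈ I) {v : ℝ → X} (hv : ContinuousOn v (Icc r t)) :
    ContinuousOn (fun ρ => U t ρ (v ρ)) (Icc r t) := by
  have hsub : Icc r t ⊆ I := Set.OrdConnected.out ‹_› hr ht
  obtain ⟨B, ω, hb⟩ := hUe.bound
  refine ContinuousOn.apply_of_strongly_continuous (K := fun ρ => U t ρ)
    (C := |B| * Real.exp (|ω| * (t - r))) (fun x => ?_) (fun ρ hρ => ?_) hv
  · exact (hUe.cont x).comp (f := fun ρ => (t, ρ)) (by fun_prop) fun ρ hρ => ⟨ht, hsub hρ, hρ.2⟩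
  · refine (hb ρ (hsub hρ) t ht hρ.2).trans (mul_le_mul (le_abs_self B)
      (Real.exp_le_exp.2 ?_) (Real.exp_pos _).le (abs_nonneg _))
    exact mul_le_mul (le_abs_self ω) (by linarith [hρ.1]) (by linarith [hρ.2]) (abs_nonneg _)

variable [NormedSpace ℝ X] {p : ℝ≥0∞} {A : ℝ → X →ₗ.[𝕜] X} {M w w' : ℝ}

/-- Approximation by functions in `F_p` is approximation in the sense of mild solutions. -/
theorem isMildApprox_of_isFp {J : Set ℝ} (hJ : closure J = Icc s e) (hsub : Icc s e ⊆ I)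
    {u : ℝ → X} {v v' g : ℕ → ℝ → X} (hF : ∀ n, IsFp I p A (v n) (v' n) (g n))
    (h1 : TendstoUniformlyOn v u atTop (Icc s e))
    (h2 : Tendsto (fun n => eLpNorm (-(v' n) + g n) p (volume.restrict (Icc s e))) atTop (𝓝 0)) :
    IsMildApprox A p J u v := by
  have hJI : J ⊆ I := subset_closure.trans (hJ.trans_subset hsub)
  refine ⟨v', g, fun n => ⟨?_, ?_, fun hp => ?_, ?_⟩, ?_⟩
  · rw [hJ]; exact (hF n).w10.memC0.1.mono hsub
  · exact (hF n).w10.memE'.1.mono_measure (Measure.restrict_mono hJI le_rfl)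
  · exact ((hF n).w10.memE'.2 hp).1.mono hJI
  · rw [hJ]; exact fun r hr t ht => (hF n).w10.primitive r (hsub hr) t (hsub ht)
  · rw [hJ]
    refine ⟨fun n => ae_restrict_of_ae_restrict_of_subset hsub (hF n).apply_ae,
      fun n => (hF n).memE.1.mono_measure (Measure.restrict_mono hsub le_rfl),
      fun hp n => ((hF n).memE.2 hp).1.mono hsub, h1, h2⟩

variable [IsScalarTower ℝ 𝕜 X] [I.OrdConnected] [Fact (1 ≤ p)]

/-- Limits of approximate solutions are propagated. -/
theorem IsMildApprox.eq_propagator (h : IsStableFamily I p A M w w')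
    (hU : IsPropagator I A M w' U) (hs : s ∈ I) (he : e ∈ I) {J : Set ℝ}
    (hJ : closure J = Icc s e) (hJm : volume.restrict J = volume.restrict (Icc s e))
    {u : ℝ → X} {v : ℕ → ℝ → X} (hv : IsMildApprox A p J u v) {r t : ℝ} (hr : r ∈ Icc s e)
    (ht : t ∈ Icc s e) (hrt : r ≤ t) : u t = U t r (u r) := by
  have hM := h.kato.nonneg
  obtain ⟨v', g, hW, hgr, hg, -, hu, hlim⟩ := hv
  rw [hJ] at hgr hg hu hlim
  have hsub : Icc s e ⊆ I := Set.OrdConnected.out ‹_› hs he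
  have hse : s ≤ e := hr.1.trans hr.2
  have hp : 1 ≤ p := Fact.out
  have hW' : ∀ n, MemLp (v' n) p (volume.restrict (Icc s e)) := fun n => by
    rw [← hJm]; exact (hW n).memLp'
  have hint : ∀ f : ℝ → X, MemLp f p (volume.restrict (Icc s e)) →
      IntervalIntegrable f volume s e := fun f hf => by
    have : IntegrableOn f (uIcc s e) := by
      rw [uIcc_of_le hse]; exact hf.integrable hp
    exact this.intervalIntegrable
  have hreg : ∀ n, IsRegularOn A s e (v n) (v' n) (g n) := fun n =>
    ⟨hint _ (hW' n), hint _ (hg n), fun q hq => by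
      have := (hW n).primitive s (by rw [hJ]; exact ⟨le_rfl, hse⟩) q (by rwa [hJ])
      rw [← this]; abel, hgr n⟩
  obtain ⟨C, hC, hCi⟩ := exists_integral_norm_sub_le_eLpNorm (X := X) hp (e - s)
  set K := M * Real.exp (|w'| * (e - s)) ^ 2 with hK
  have hK0 : 0 ≤ K := by positivity
  -- In the propagator inequality with initial value `v n r` only the residual is left, and it tends
  -- to `0`.
  have hle : ∀ n, ‖v n t - U t r (v n r)‖ ≤
      K * (C * (eLpNorm (-(v' n) + g n) p (volume.restrict (Icc s e))).toReal) := by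
    intro n
    refine (hU r (hsub hr) t (hsub ht) hrt (e - s) (by linarith [hr.1, ht.2]) _ _ _
      ((hreg n).mono hr ht) (v n r)).trans (mul_le_mul_of_nonneg_left ?_ hK0)
    rw [sub_self, norm_zero, zero_add]
    refine (intervalIntegral.integral_mono_interval hr.1 hrt ht.2
      (Eventually.of_forall fun τ => norm_nonneg _)
      ((hreg n).integrable'.sub (hreg n).integrable).norm).trans ?_
    exact hCi s e hse le_rfl _ _ ((hW' n).neg.add (hg n))
  have hL : Tendsto (fun n => ‖v n t - U t r (v n r)‖) atTop (𝓝 ‖u t - U t r (u r)‖) :=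
    ((hu.tendsto_at ht).sub (((U t r).continuous.tendsto _).comp (hu.tendsto_at hr))).norm
  have hR : Tendsto (fun n => K * (C *
      (eLpNorm (-(v' n) + g n) p (volume.restrict (Icc s e))).toReal)) atTop (𝓝 (K * (C * 0))) :=
    (((ENNReal.tendsto_toReal ENNReal.zero_ne_top).comp hlim).const_mul C).const_mul K
  rw [mul_zero, mul_zero] at hR
  exact sub_eq_zero.1 (norm_le_zero_iff.1 (le_of_tendsto_of_tendsto' hL hR hle))

variable [CompleteSpace X]

/-- The orbits of the propagator are uniform limits of approximate solutions in `F_p`. -/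
theorem IsPropagator.exists_isFp_seq (h : IsStableFamily I p A M w w')
    (hU : IsPropagator I A M w' U) (hs : s ∈ I) (he : e ∈ I) (hse : s ≤ e) (x : X) :
    ∃ v v' g : ℕ → ℝ → X, (∀ n, IsFp I p A (v n) (v' n) (g n)) ∧
      TendstoUniformlyOn v (fun t => U t s x) atTop (Icc s e) ∧
      Tendsto (fun n => eLpNorm (-(v' n) + g n) p (volume.restrict (Icc s e))) atTop (𝓝 0) := by
  have hM := h.kato.nonneg
  obtain ⟨C, hC, hCi⟩ := exists_integral_norm_sub_le_eLpNorm (X := X) (p := p) Fact.out (e - s)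
  have hε : ∀ n : ℕ, (0 : ℝ) < 1 / (n + 1) := fun n => by positivity
  choose v v' g hF h1 h2 using fun n : ℕ => h.exists_isFp_approx hs he hse x (hε n)
  have hlim : Tendsto (fun n : ℕ => (1 : ℝ) / (n + 1)) atTop (𝓝 0) :=
    tendsto_one_div_add_atTop_nhds_zero_nat
  refine ⟨v, v', g, hF, ?_, ?_⟩
  · rw [Metric.tendstoUniformlyOn_iff]
    intro ε hε
    have hlim' : Tendsto (fun n : ℕ => M * Real.exp (|w'| * (e - s)) ^ 2 *
        (2 * ((C + 1) * ((1 : ℝ) / (n + 1))))) atTop (𝓝 (M * Real.exp (|w'| * (e - s)) ^ 2 *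
          (2 * ((C + 1) * 0)))) := ((hlim.const_mul (C + 1)).const_mul 2).const_mul _
    simp only [mul_zero] at hlim'
    filter_upwards [hlim'.eventually (gt_mem_nhds hε)] with n hn t ht
    rw [dist_comm, dist_eq_norm]
    refine (hU.norm_sub_le hM hs he ((hF n).isRegularOn hs he) ?_ ?_ ht).trans_lt hn
    · refine (h1 n).trans (le_mul_of_one_le_left (by positivity) (by linarith))
    · refine (hCi s e hse le_rfl _ _ (((hF n).w10.memE'.memLp_Icc hs he).neg.add
        ((hF n).memE.memLp_Icc hs he))).trans ?_
      refine mul_le_mul (by linarith) ?_ ENNReal.toReal_nonneg (by linarith)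
      exact (ENNReal.toReal_mono ENNReal.ofReal_ne_top (h2 n)).trans_eq
        (ENNReal.toReal_ofReal (by positivity))
  · refine tendsto_of_tendsto_of_tendsto_of_le_of_le tendsto_const_nhds ?_ (fun _ => zero_le) h2
    have := ENNReal.tendsto_ofReal hlim
    rwa [ENNReal.ofReal_zero] at this

/-- A truncated orbit lies in the domain of the closure, which acts as `-φ'` on it. -/
theorem IsPropagator.inDomainAndVanishesOn (h : IsStableFamily I p A M w w')
    (hU : IsPropagator I A M w' U) (hcl : (G0 I p A).IsClosable) (hI : UniqueDiffOn ℝ I)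
    (hs : s ∈ I) (he : e ∈ I) (hse : s ≤ e) {x : X} {φ : ℝ → ℝ} (hφ : ContDiffOn ℝ 1 φ I)
    (h0 : ∀ t ∈ I, t ∉ Icc s e → φ t = 0) {u : ℝ → X} (hu : ∀ t ∈ Icc s e, u t = U t s x)
    {c d : ℝ} (hcd : Icc c d ⊆ I) (h1 : ∀ t ∈ Icc c d, φ t = 1) :
    InDomainAndVanishesOn (G0 I p A).closure (fun t => φ t • u t) (Icc c d) := by
  have hsub : Icc s e ⊆ I := Set.OrdConnected.out ‹_› hs he
  set φ' := derivWithin φ I with hφ'def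
  have hφ' : ContinuousOn φ' I := hφ.continuousOn_derivWithin hI le_rfl
  have h0' : ∀ t ∈ I, t ∉ Icc s e → φ' t = 0 := by
    intro t ht hts
    refine derivWithin_eq_zero_of_eventually_eq_const (c := 0) ht ?_
    filter_upwards [self_mem_nhdsWithin,
      mem_nhdsWithin_of_mem_nhds (isClosed_Icc.isOpen_compl.mem_nhds hts)] with r hr hr'
    exact h0 r hr hr'
  have hbd : ∀ ρ : ℝ → ℝ, ContinuousOn ρ I → (∀ t ∈ I, t ∉ Icc s e → ρ t = 0) →
      ∃ C, 0 ≤ C ∧ ∀ t ∈ I, ‖ρ t‖ ≤ C := by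
    intro ρ hρ hρ0
    obtain ⟨C, hC⟩ := isCompact_Icc.exists_bound_of_continuousOn (hρ.mono hsub)
    refine ⟨|C|, abs_nonneg _, fun t ht => ?_⟩
    by_cases hts : t ∈ Icc s e
    · exact (hC t hts).trans (le_abs_self C)
    · rw [hρ0 t ht hts, norm_zero]; exact abs_nonneg _
  obtain ⟨C, hC0, hC⟩ := hbd φ hφ.continuousOn h0
  obtain ⟨C', hC0', hC'⟩ := hbd φ' hφ' h0'
  obtain ⟨v, v', g, hF, hunif, hlim⟩ := hU.exists_isFp_seq h hs he hse x
  -- The truncations `φ v_n` lie in `F_p`, and `G_0(φ v_n) = φ (-v_n' + g_n) - φ' v_n`. The first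
  -- term tends to `0` and the second to `-φ' u`. Uniform convergence suffices in every `E_p`, as
  -- all supports lie in `[s, e]`.
  have hcut := fun n => (hF n).smul_cutoff hφ' (sub_eq_integral_derivWithin hφ hI)
    hφ.continuousOn hC hC'
  have hmul : ∀ (ρ : ℝ → ℝ) (B : ℝ), 0 ≤ B → (∀ t ∈ I, ‖ρ t‖ ≤ B) →
      (∀ t ∈ I, t ∉ Icc s e → ρ t = 0) →
      TendstoUniformlyOn (fun n t => ρ t • v n t) (fun t => ρ t • u t) atTop I := by
    intro ρ B hB0 hB hρ0
    rw [Metric.tendstoUniformlyOn_iff] at hunif ⊢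
    intro ε hε
    filter_upwards [hunif (ε / (B + 1)) (by positivity)] with n hn t ht
    by_cases hts : t ∈ Icc s e
    · have h2 := hn t hts
      rw [lt_div_iff₀ (by positivity), dist_eq_norm] at h2
      rw [dist_eq_norm, ← smul_sub, norm_smul, hu t hts]
      have := mul_le_mul_of_nonneg_right (hB t ht) (norm_nonneg (U t s x - v n t))
      nlinarith [norm_nonneg (U t s x - v n t)]
    · rw [hρ0 t ht hts]; simpa using hε
  have hmE : ∀ (ρ : ℝ → ℝ) (B : ℝ), 0 ≤ B → ContinuousOn ρ I → (∀ t ∈ I, ‖ρ t‖ ≤ B) →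
      (∀ t ∈ I, t ∉ Icc s e → ρ t = 0) → MemE I p (fun t => ρ t • u t) := by
    intro ρ B hB0 hρc hB hρ0
    refine (MemC0.of_tendstoUniformlyOn (fun n => (hF n).w10.memC0.smul_bounded hρc hB)
      (hmul ρ B hB0 hB hρ0)).memE_of_eq_zero_off (s := s) (e := e) fun t ht hts => ?_
    rw [hρ0 t ht hts, zero_smul]
  have htend : ∀ (ρ : ℝ → ℝ) (B : ℝ), 0 ≤ B → (∀ t ∈ I, ‖ρ t‖ ≤ B) →
      (∀ t ∈ I, t ∉ Icc s e → ρ t = 0) → Tendsto (fun n => eLpNorm ((fun t => ρ t • v n t) -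
        fun t => ρ t • u t) p (volume.restrict I)) atTop (𝓝 0) := by
    intro ρ B hB0 hB hρ0
    refine tendsto_eLpNorm_of_tendstoUniformlyOn (hmul ρ B hB0 hB hρ0) (s := s) (e := e)
      (fun n t ht hts => ?_) fun t ht hts => ?_
    · rw [hρ0 t ht hts, zero_smul]
    · rw [hρ0 t ht hts, zero_smul]
  have mF : MemE I p (fun t => φ t • u t) := hmE φ C hC0 hφ.continuousOn hC h0
  have mH : MemE I p (fun t => (-φ' t) • u t) := hmE (fun t => -φ' t) C' hC0' hφ'.neg
    (fun t ht => by rw [norm_neg]; exact hC' t ht) fun t ht hts => by rw [h0' t ht hts, neg_zero]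
  have mHn : ∀ n, MemE I p (-(fun t => φ' t • v n t + φ t • v' n t) + fun t => φ t • g n t) := by
    intro n
    have := ((hcut n).w10.memE'.smul (-1 : 𝕜)).add (hcut n).memE
    rwa [neg_one_smul] at this
  refine ⟨mF.toEp 𝕜, mH.toEp 𝕜, ?_, fn_toEp _, ?_⟩
  · rw [← hcl.graph_closure_eq_closure_graph]
    have hlimF := tendsto_toEp (𝕜 := 𝕜) (fun n => (hcut n).w10.memE) mF (htend φ C hC0 hC h0)
    have hlimH := tendsto_toEp (𝕜 := 𝕜) mHn mH (by
      have e1 : ∀ n, (-(fun t => φ' t • v n t + φ t • v' n t) + fun t => φ t • g n t) -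
          (fun t => (-φ' t) • u t) = (fun t => φ t • (-(v' n) + g n) t) -
            ((fun t => φ' t • v n t) - fun t => φ' t • u t) := by
        intro n; ext t
        simp only [Pi.add_apply, Pi.neg_apply, Pi.sub_apply, smul_add, smul_neg, neg_smul]
        abel
      have h3 := htend φ' C' hC0' hC' h0'
      have h4 : Tendsto (fun n => ENNReal.ofReal C *
          eLpNorm (-(v' n) + g n) p (volume.restrict (Icc s e))) atTop (𝓝 (ENNReal.ofReal C * 0)) :=
        ENNReal.Tendsto.const_mul hlim (Or.inr ENNReal.ofReal_ne_top)
      have h5 := h4.add h3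
      rw [mul_zero, add_zero] at h5
      refine tendsto_of_tendsto_of_tendsto_of_le_of_le tendsto_const_nhds h5 (fun _ => zero_le)
        fun n => ?_
      dsimp only
      rw [e1 n]
      refine (eLpNorm_sub_le ?_ ?_ Fact.out).trans (add_le_add
        (eLpNorm_smul_le_of_eq_zero_off hC h0) le_rfl)
      · have := ((hF n).w10.memE'.smul (-1 : 𝕜)).add (hF n).memE
        rw [neg_one_smul] at this
        exact (this.smul_bounded hφ.continuousOn hC).1.1
      · exact ((hF n).w10.memE.smul_bounded hφ' hC').1.1.sub (hmE φ' C' hC0' hφ' hC' h0').1.1)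
    refine mem_closure_of_tendsto (hlimF.prodMk_nhds hlimH) (Eventually.of_forall fun n => ?_)
    rw [G0_graph]
    exact ⟨_, _, _, hcut n, fn_toEp (hcut n).w10.memE, fn_toEp (mHn n)⟩
  -- The end points form a null set, and at interior points `φ` is locally constant, so `φ'`
  -- vanishes.
  · have : ∀ᵐ t ∂volume.restrict (Icc c d), t ∈ Ioo c d := by
      rw [← Measure.restrict_congr_set Ioo_ae_eq_Icc]
      exact ae_restrict_mem measurableSet_Ioo
    filter_upwards [this, ae_restrict_of_ae_restrict_of_subset hcd (fn_toEp (𝕜 := 𝕜) mH)] with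
      t ht hHt
    have h3 : φ' t = 0 := by
      refine derivWithin_eq_zero_of_eventually_eq_const (c := 1) (hcd (Ioo_subset_Icc_self ht)) ?_
      filter_upwards [mem_nhdsWithin_of_mem_nhds (isOpen_Ioo.mem_nhds ht)] with r hr
      exact h1 r (Ioo_subset_Icc_self hr)
    rw [hHt, h3, neg_zero, zero_smul]
    rfl

/-- Where the closure of `G_0` annihilates a function, that function is propagated. -/
theorem IsPropagator.eq_of_closure_eq_zero (h : IsStableFamily I p A M w w')
    (hU : IsPropagator I A M w' U) (hUe : IsEvolutionFamily I U) (hcl : (G0 I p A).IsClosable)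
    (hs : s ∈ I) (he : e ∈ I) {F H : Ep 𝕜 X I p} (hFH : (F, H) ∈ (G0 I p A).closure.graph)
    {v : ℝ → X} (hv : ContinuousOn v (Icc s e)) (hFv : fn F =ᵐ[volume.restrict (Icc s e)] v)
    (hH : fn H =ᵐ[volume.restrict (Icc s e)] 0) {r t : ℝ} (hr : r ∈ Icc s e)
    (ht : t ∈ Icc s e) (hrt : r ≤ t) : v t = U t r (v r) := by
  have hM := h.kato.nonneg
  have hp : 1 ≤ p := Fact.out
  have hsub : Icc s e ⊆ I := Set.OrdConnected.out ‹_› hs he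
  have hse : s ≤ e := hr.1.trans hr.2
  rcases hrt.eq_or_lt with rfl | hlt
  · rw [hUe.refl r (hsub hr)]; rfl
  rw [← hcl.graph_closure_eq_closure_graph] at hFH
  obtain ⟨fh, hfh, hlim⟩ := mem_closure_iff_seq_limit.1
    (show (F, H) ∈ closure ((G0 I p A).graph : Set (Ep 𝕜 X I p × Ep 𝕜 X I p)) from hFH)
  rw [G0_graph] at hfh
  choose u u' g hu hfu hhu using hfh
  have hlimF : Tendsto (fun n => (fh n).1) atTop (𝓝 F) := hlim.fst_nhds
  have hlimH : Tendsto (fun n => (fh n).2) atTop (𝓝 H) := hlim.snd_nhds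
  have hres : ∀ (a : ℕ → Ep 𝕜 X I p) (b : Ep 𝕜 X I p) (a' : ℕ → ℝ → X) (b' : ℝ → X),
      Tendsto a atTop (𝓝 b) → (∀ n, fn (a n) =ᵐ[volume.restrict I] a' n) →
      fn b =ᵐ[volume.restrict (Icc s e)] b' →
      Tendsto (fun n => eLpNorm (a' n - b') p (volume.restrict (Icc s e))) atTop (𝓝 0) := by
    intro a b a' b' hab ha hb
    have h1 := ENNReal.tendsto_ofReal (tendsto_iff_norm_sub_tendsto_zero.1 hab)
    rw [ENNReal.ofReal_zero] at h1
    refine tendsto_of_tendsto_of_tendsto_of_le_of_le tendsto_const_nhds h1 (fun _ => zero_le)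
      fun n => ?_
    dsimp only
    rw [← eLpNorm_eq_ofReal_norm (f := a n - b) EventuallyEq.rfl]
    refine le_trans (le_of_eq (eLpNorm_congr_ae ?_))
      (eLpNorm_mono_measure _ (Measure.restrict_mono hsub le_rfl))
    filter_upwards [ae_restrict_of_ae_restrict_of_subset hsub (fn_sub (a n) b),
      ae_restrict_of_ae_restrict_of_subset hsub (ha n), hb] with τ h2 h3 h4
    rw [h2, Pi.sub_apply, Pi.sub_apply, h3, h4]
  have hcF := hres _ _ _ _ hlimF hfu hFv
  have hcH := hres _ _ _ _ hlimH hhu hH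
  simp only [sub_zero] at hcH
  -- Graph convergence gives only `L^p`-convergence of the functions, hence pointwise convergence
  -- along a subsequence and off a null set.
  obtain ⟨ns, hns, hae⟩ := (tendstoInMeasure_of_tendsto_eLpNorm (one_pos.trans_le hp).ne'
    (fun n => ((hu n).w10.memE.memLp_Icc hs he).1)
    (hv.aestronglyMeasurable measurableSet_Icc) hcF).exists_seq_tendsto_ae
  obtain ⟨C, hC, hCi⟩ := exists_integral_norm_sub_le_eLpNorm (X := X) hp (e - s)
  set K := M * Real.exp (|w'| * (e - s)) ^ 2 with hK
  have hK0 : 0 ≤ K := by positivity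
  have hprop : ∀ ρ ∈ Icc s e, ∀ τ ∈ Icc s e, ρ ≤ τ →
      Tendsto (fun n => ‖u n τ - U τ ρ (u n ρ)‖) atTop (𝓝 0) := by
    intro ρ hρ τ hτ hρτ
    have hR : Tendsto (fun n => K * (C *
        (eLpNorm (-(u' n) + g n) p (volume.restrict (Icc s e))).toReal)) atTop (𝓝 (K * (C * 0))) :=
      (((ENNReal.tendsto_toReal ENNReal.zero_ne_top).comp hcH).const_mul C).const_mul K
    rw [mul_zero, mul_zero] at hR
    refine squeeze_zero (fun _ => norm_nonneg _) (fun n => ?_) hR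
    have hreg := (hu n).isRegularOn hs he
    refine (hU ρ (hsub hρ) τ (hsub hτ) hρτ (e - s) (by linarith [hρ.1, hτ.2]) _ _ _
      (hreg.mono hρ hτ) (u n ρ)).trans (mul_le_mul_of_nonneg_left ?_ hK0)
    rw [sub_self, norm_zero, zero_add]
    refine (intervalIntegral.integral_mono_interval hρ.1 hρτ hτ.2
      (Eventually.of_forall fun τ => norm_nonneg _)
      (hreg.integrable'.sub hreg.integrable).norm).trans ?_
    exact hCi s e hse le_rfl _ _
      (((hu n).w10.memE'.memLp_Icc hs he).neg.add ((hu n).memE.memLp_Icc hs he))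
  -- From a starting time `ρ` at which the subsequence converges, it converges at all later times to
  -- `U(·, ρ) v(ρ)`. This limit equals `v` almost everywhere, and then everywhere by continuity.
  have hgood : ∀ ρ ∈ Icc s e, Tendsto (fun i => u (ns i) ρ) atTop (𝓝 (v ρ)) → ∀ τ ∈ Icc s e,
      ρ < τ → v τ = U τ ρ (v ρ) := by
    intro ρ hρ hconv τ hτ hρτ
    have h1 : ∀ q ∈ Icc ρ τ, Tendsto (fun i => u (ns i) q) atTop (𝓝 (U q ρ (v ρ))) := by
      intro q hq
      have h2 := tendsto_zero_iff_norm_tendsto_zero.2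
        ((hprop ρ hρ q ⟨hρ.1.trans hq.1, hq.2.trans hτ.2⟩ hq.1).comp hns.tendsto_atTop)
      have h3 := h2.add (((U q ρ).continuous.tendsto _).comp hconv)
      rw [zero_add] at h3
      exact h3.congr fun i => by simp
    have hsub' : Icc ρ τ ⊆ Icc s e := Icc_subset_Icc hρ.1 hτ.2
    refine Measure.eqOn_Icc_of_ae_eq volume hρτ.ne (f := v) (g := fun q => U q ρ (v ρ)) ?_
      (hv.mono hsub') (hU.continuousOn_left h (hsub hρ) (hsub hτ) hρτ.le _)
      (right_mem_Icc.2 hρτ.le)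
    filter_upwards [ae_restrict_of_ae_restrict_of_subset hsub' hae,
      ae_restrict_mem measurableSet_Icc] with q hq hq'
    exact tendsto_nhds_unique hq (h1 q hq')
  have hsub' : Icc r t ⊆ Icc s e := Icc_subset_Icc hr.1 ht.2
  -- The time `r` itself may be exceptional. Almost every `ρ` is not, and `ρ ↦ U(t, ρ) v(ρ)` is
  -- continuous up to `r`.
  have := Measure.eqOn_Icc_of_ae_eq volume hlt.ne (f := fun _ => v t) (g := fun ρ => U t ρ (v ρ)) (by
    have hm : ∀ᵐ ρ ∂volume.restrict (Icc r t), ρ ∈ Ioo r t := by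
      rw [← Measure.restrict_congr_set Ioo_ae_eq_Icc]
      exact ae_restrict_mem measurableSet_Ioo
    filter_upwards [ae_restrict_of_ae_restrict_of_subset hsub' hae, hm] with ρ hρ hρ'
    exact hgood ρ (hsub' (Ioo_subset_Icc_self hρ')) hρ t ht hρ'.2) continuousOn_const
    (hUe.continuousOn_right (hsub hr) (hsub ht) (hv.mono hsub')) (left_mem_Icc.2 hlt.le)
  exact this

end MildSolutions

end EvolutionSemigroup

/-! ### Invertible families on the line. -/

namespace EvolutionSemigroup

section TwoSided

variable {𝕜 : Type*} [RCLike 𝕜] {X : Type*} [NormedAddCommGroup X] [NormedSpace 𝕜 X]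
  {U : ℝ → ℝ → X →L[𝕜] X} {s : ℝ} {x : X}

theorem inverse_apply_eq {L : X →L[𝕜] X} (hL : IsUnit L) (y : X) : Ring.inverse L (L y) = y := by
  exact DFunLike.congr_fun (Ring.inverse_mul_cancel L hL) y

theorem apply_inverse_eq {L : X →L[𝕜] X} (hL : IsUnit L) (y : X) : L (Ring.inverse L y) = y := by
  exact DFunLike.congr_fun (Ring.mul_inverse_cancel L hL) y

/-- The two-sided orbit through `x` at time `s` is, on `[d, ∞)`, the forward orbit starting at `d ≤
s` with value `U(s, d)⁻¹ x`. This reduces the problem on the line to forward orbits. -/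
theorem IsEvolutionFamily.twoSided_apply_eq (hU : IsEvolutionFamily univ U)
    (hinv : IsInvertibleFamily U) {d t : ℝ} (hds : d ≤ s) (hdt : d ≤ t) (x : X) :
    twoSided U t s x = U t d (Ring.inverse (U s d) x) := by
  have hx := apply_inverse_eq (hinv d s hds) x
  set y := Ring.inverse (U s d) x
  rw [twoSided]
  split_ifs with hst
  · rw [← hU.comp d trivial s trivial t trivial hds hst, ContinuousLinearMap.comp_apply, hx]
  · have hts := (not_le.1 hst).le
    rw [← hx, ← hU.comp d trivial t trivial s trivial hdt hts, ContinuousLinearMap.comp_apply,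
      inverse_apply_eq (hinv t s hts)]

theorem eq_twoSided_of_propagated (hinv : IsInvertibleFamily U) {v : ℝ → X} (hvs : v s = x)
    (hv : ∀ r t : ℝ, r ≤ t → v t = U t r (v r)) : v = fun t => twoSided U t s x := by
  ext t
  rw [twoSided]
  split_ifs with hst
  · rw [hv s t hst, hvs]
  · have hts := (not_le.1 hst).le
    rw [← hvs, hv t s hts, inverse_apply_eq (hinv t s hts)]

theorem IsEvolutionFamily.continuous_twoSided (hU : IsEvolutionFamily univ U)
    (hinv : IsInvertibleFamily U) (s : ℝ) (x : X) : Continuous fun t => twoSided U t s x := by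
  rw [continuous_iff_continuousAt]
  intro t
  have h1 : ContinuousOn (fun r => U r (min s t - 1) (Ring.inverse (U s (min s t - 1)) x))
      (Ici (min s t - 1)) :=
    (hU.cont _).comp (f := fun r => (r, min s t - 1)) (by fun_prop) fun r hr =>
      ⟨trivial, trivial, hr⟩
  have h2 := h1.congr (g := fun t => twoSided U t s x) fun r hr =>
    hU.twoSided_apply_eq hinv (by linarith [min_le_left s t]) hr x
  exact h2.continuousAt (Ici_mem_nhds (by linarith [min_le_right s t]))

end TwoSided

/-! ### The two cases of the theorem. -/

section Final

variable {𝕜 : Type*} [RCLike 𝕜] {X : Type*} [NormedAddCommGroup X] [NormedSpace 𝕜 X]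
  [NormedSpace ℝ X] [IsScalarTower ℝ 𝕜 X] [CompleteSpace X]
  {p : ℝ≥0∞} [Fact (1 ≤ p)] {A : ℝ → X →ₗ.[𝕜] X} {M w w' : ℝ} {U : ℝ → ℝ → X →L[𝕜] X}

theorem IsPropagator.mildSolution_Ioc {a b : ℝ} (h : IsStableFamily (Ioc a b) p A M w w')
    (hU : IsPropagator (Ioc a b) A M w' U) (hUe : IsEvolutionFamily (Ioc a b) U)
    (hcl : (G0 (Ioc a b) p A).IsClosable) {s : ℝ} (hs : s ∈ Ioc a b) (hsb : s < b) (x : X) :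
    IsMildSolution A p s b x (fun t => U t s x) ∧
    (∀ v : ℝ → X, IsMildSolution A p s b x v → EqOn v (fun t => U t s x) (Icc s b)) ∧
    (∃ un : ℕ → ℝ → X, IsMildApprox A p (Ioo s b) (fun t => U t s x) un ∧
      ∀ n, ∃ v' g : ℝ → X, IsFp (Ioc a b) p A (un n) v' g) ∧
    ∀ φ : ℝ → ℝ → ℝ, (∀ ε ∈ Ioc 0 (b - s), IsStepCutoff a b s ε (φ ε)) →
      (∀ ε ∈ Ioc 0 (b - s), InDomainAndVanishesOn (G0 (Ioc a b) p A).closure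
        (fun t => φ ε t • U t s x) (Icc (s + ε) b)) ∧
      ∀ v : ℝ → X, ContinuousOn v (Icc s b) → v s = x →
        (∀ ε ∈ Ioc 0 (b - s), InDomainAndVanishesOn (G0 (Ioc a b) p A).closure
          (fun t => φ ε t • v t) (Icc (s + ε) b)) →
        EqOn v (fun t => U t s x) (Icc s b) := by
  have hb : b ∈ Ioc a b := ⟨hs.1.trans hsb, le_rfl⟩
  have hsub : Icc s b ⊆ Ioc a b := fun t ht => ⟨hs.1.trans_le ht.1, ht.2⟩
  have hJ : closure (Ioo s b) = Icc s b := closure_Ioo hsb.ne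
  have hJm : volume.restrict (Ioo s b) = volume.restrict (Icc s b) :=
    Measure.restrict_congr_set Ioo_ae_eq_Icc
  have hss : U s s x = x := by rw [hUe.refl s hs]; rfl
  have hsIcc : s ∈ Icc s b := ⟨le_rfl, hsb.le⟩
  obtain ⟨v, v', g, hF, h1, h2⟩ := hU.exists_isFp_seq h hs hb hsb.le x
  have happ := isMildApprox_of_isFp hJ hsub hF h1 h2
  refine ⟨⟨hU.continuousOn_left h hs hb hsb.le x, hss, v, happ⟩, ?_,
    ⟨v, happ, fun n => ⟨v' n, g n, hF n⟩⟩, fun φ hφ => ⟨fun ε hε => ?_, ?_⟩⟩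
  · rintro u ⟨-, rfl, un, hun⟩ t ht
    exact hun.eq_propagator h hU hs hb hJ hJm hsIcc ht ht.1
  · refine hU.inDomainAndVanishesOn h hcl (uniqueDiffOn_Ioc a b) hs hb hsb.le (hφ ε hε).contDiff
      (fun t ht hts => (hφ ε hε).eq_zero t ⟨ht.1, ?_⟩) (fun _ _ => rfl)
      ((Icc_subset_Icc_left (by linarith [hε.1])).trans hsub) (hφ ε hε).eq_one
    by_contra hc
    exact hts ⟨(not_le.1 hc).le, ht.2⟩
  · rintro u hu rfl hdom t ht
    rcases ht.1.eq_or_lt with rfl | hst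
    · exact hss.symm
    -- With `ε = ρ - s` the cut-off is `1` on `[ρ, b]`, so `u` is propagated from every `ρ > s`. The
    -- starting time `s` itself is reached by continuity of `ρ ↦ U(t, ρ) u(ρ)`.
    have key : ∀ ρ ∈ Ioo s t, u t = U t ρ (u ρ) := by
      intro ρ hρ
      have hε : ρ - s ∈ Ioc 0 (b - s) := ⟨by linarith [hρ.1], by linarith [hρ.2, ht.2]⟩
      obtain ⟨F, H, hFH, hFu, hH⟩ := hdom _ hε
      have h1 := (hφ _ hε).eq_one
      rw [add_sub_cancel] at hH h1
      have hρsub : Icc ρ b ⊆ Icc s b := Icc_subset_Icc_left hρ.1.le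
      refine hU.eq_of_closure_eq_zero h hUe hcl (hsub (hρsub ⟨le_rfl, hρ.2.le.trans ht.2⟩)) hb hFH
        (hu.mono hρsub) ?_ hH ⟨le_rfl, hρ.2.le.trans ht.2⟩ ⟨hρ.2.le, ht.2⟩ hρ.2.le
      filter_upwards [ae_restrict_of_ae_restrict_of_subset (hρsub.trans hsub) hFu,
        ae_restrict_mem measurableSet_Icc] with τ hτ hτ'
      rw [hτ, h1 τ hτ', one_smul]
    refine Measure.eqOn_Icc_of_ae_eq volume hst.ne (f := fun _ => u t)
      (g := fun ρ => U t ρ (u ρ)) ?_ continuousOn_const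
      (hUe.continuousOn_right hs (hsub ht) (hu.mono (Icc_subset_Icc_right ht.2)))
      (left_mem_Icc.2 hst.le)
    rw [← Measure.restrict_congr_set Ioo_ae_eq_Icc]
    filter_upwards [ae_restrict_mem measurableSet_Ioo] with ρ hρ using key ρ hρ

theorem IsPropagator.mildSolution_univ (h : IsStableFamily univ p A M w w')
    (hU : IsPropagator univ A M w' U) (hUe : IsEvolutionFamily univ U)
    (hcl : (G0 univ p A).IsClosable) (hinv : IsInvertibleFamily U) (s : ℝ) (x : X) :
    IsMildSolutionReal A p s x (fun t => twoSided U t s x) ∧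
    (∀ v : ℝ → X, IsMildSolutionReal A p s x v → v = fun t => twoSided U t s x) ∧
    ∀ ψ : ℝ → ℝ → ℝ, (∀ d : ℝ, |s| < d → IsPlateauCutoff d (ψ d)) →
      (∀ d : ℝ, |s| < d → InDomainAndVanishesOn (G0 univ p A).closure
        (fun t => ψ d t • twoSided U t s x) (Icc (-d) d)) ∧
      ∀ v : ℝ → X, Continuous v → v s = x →
        (∀ d : ℝ, |s| < d → InDomainAndVanishesOn (G0 univ p A).closure
          (fun t => ψ d t • v t) (Icc (-d) d)) →
        v = fun t => twoSided U t s x := by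
  have hlarge : ∀ r t : ℝ, ∃ d : ℝ, |s| < d ∧ r ∈ Icc (-d) d ∧ t ∈ Icc (-d) d := fun r t =>
    ⟨|s| + |r| + |t| + 1, by linarith [abs_nonneg r, abs_nonneg t], abs_le.1
      (by linarith [abs_nonneg s, abs_nonneg t]), abs_le.1 (by linarith [abs_nonneg s, abs_nonneg r])⟩
  have hJ : ∀ d : ℝ, closure (Icc (-d) d) = Icc (-d) d := fun d => isClosed_Icc.closure_eq
  refine ⟨⟨hUe.continuous_twoSided hinv s x, ?_, fun d hd => ?_⟩, ?_,
    fun ψ hψ => ⟨fun d hd => ?_, ?_⟩⟩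
  · change twoSided U s s x = x
    rw [twoSided, if_pos le_rfl, hUe.refl s trivial]; rfl
  · have hd' := abs_lt.1 hd
    obtain ⟨v, v', g, hF, h1, h2⟩ := hU.exists_isFp_seq h (mem_univ (-d)) (mem_univ d)
      (by linarith) (Ring.inverse (U s (-d)) x)
    refine ⟨v, isMildApprox_of_isFp (hJ d) (subset_univ _) hF (h1.congr_right fun t ht => ?_) h2⟩
    exact (hUe.twoSided_apply_eq hinv hd'.1.le ht.1 x).symm
  · rintro v ⟨-, hvs, hv⟩
    refine eq_twoSided_of_propagated hinv hvs fun r t hrt => ?_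
    obtain ⟨d, hd, hr, ht⟩ := hlarge r t
    obtain ⟨un, hun⟩ := hv d hd
    exact hun.eq_propagator h hU (mem_univ _) (mem_univ _) (hJ d) rfl hr ht hrt
  · obtain ⟨R, hR⟩ := (hψ d hd).compact.isCompact.isBounded.subset_closedBall 0
    -- `[-D, D]` contains the support of `ψ d` and the time `s`. On it the two-sided orbit is a
    -- forward orbit starting at `-D`.
    obtain ⟨D, hD, hRD, -⟩ := hlarge R 0
    have hD' := abs_lt.1 hD
    refine hU.inDomainAndVanishesOn h hcl uniqueDiffOn_univ (mem_univ (-D)) (mem_univ D)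
      (by linarith) (hψ d hd).contDiff.contDiffOn (fun t _ ht => ?_)
      (fun t ht => hUe.twoSided_apply_eq hinv hD'.1.le ht.1 x) (subset_univ _) (hψ d hd).eq_one
    by_contra hne
    have h1 := hR (subset_tsupport _ (Function.mem_support.2 hne))
    rw [mem_closedBall_zero_iff, Real.norm_eq_abs] at h1
    exact ht (abs_le.1 (h1.trans hRD.2))
  · intro v hv hvs hdom
    refine eq_twoSided_of_propagated hinv hvs fun r t hrt => ?_
    obtain ⟨d, hd, hr, ht⟩ := hlarge r t
    obtain ⟨F, H, hFH, hFv, hH⟩ := hdom d hd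
    refine hU.eq_of_closure_eq_zero h hUe hcl (mem_univ (-d)) (mem_univ d) hFH hv.continuousOn ?_ hH
      hr ht hrt
    filter_upwards [ae_restrict_of_ae_restrict_of_subset (subset_univ _) hFv,
      ae_restrict_mem measurableSet_Icc] with τ hτ hτ'
    rw [hτ, (hψ d hd).eq_one τ hτ', one_smul]

end Final

end EvolutionSemigroup

open EvolutionSemigroup in
theorem mainTheorem7 {𝕜 : Type*} [RCLike 𝕜] {X : Type*} [NormedAddCommGroup X] [NormedSpace 𝕜 X]
    [NormedSpace ℝ X] [IsScalarTower ℝ 𝕜 X] [CompleteSpace X]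
    (p : ℝ≥0∞) [Fact (1 ≤ p)] (I : Set ℝ) [I.OrdConnected]
    (hI : (∃ a b : ℝ, a < b ∧ I = Ioc a b) ∨ I = univ)
    (A : ℝ → X →ₗ.[𝕜] X) (M w w' : ℝ)
    -- `A(t)`, `t ∈ I`, are Kato-stable generators with constants `(M, w)`
    (hA : IsKatoStable I A M w)
    -- `t ↦ R(w', A(t))` is strongly continuous, where `w' > w`
    (hw : w < w')
    (hR : ∀ x : X, ContinuousOn (fun t => resolventOp (A t) (w' : 𝕜) x) I)
    -- `(w' - G_0) F_p` is dense in `E_p`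
    (hrange : Dense {h : Ep 𝕜 X I p | ∃ f g : Ep 𝕜 X I p, (f, g) ∈ (G0 I p A).graph ∧
      h = (w' : 𝕜) • f - g})
    -- `F_p` is dense in `E_p` and in `E_∞`
    (hdense : Dense ((G0 I p A).domain : Set (Ep 𝕜 X I p)))
    (hdense' : Dense {h : Ep 𝕜 X I ∞ | ∃ f ∈ (G0 I p A).domain, fn h =ᵐ[volume.restrict I] fn f}) :
    -- the closure `G` of `G_0` exists and generates an evolution semigroup, given by some `U`
    (G0 I p A).IsClosable ∧
    (∃ U : ℝ → ℝ → X →L[𝕜] X, IsEvolutionFamily I U ∧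
      GeneratesEvolutionSemigroup I p (G0 I p A).closure U) ∧
    -- for this evolution family `U`, all `s` and all `x`:
    ∀ U : ℝ → ℝ → X →L[𝕜] X, IsEvolutionFamily I U →
      GeneratesEvolutionSemigroup I p (G0 I p A).closure U →
      ∀ s ∈ I, ∀ x : X,
        -- the case `I = (a, b]`
        (∀ a b : ℝ, I = Ioc a b → s < b →
          IsMildSolution A p s b x (fun t => U t s x) ∧
          (∀ v : ℝ → X, IsMildSolution A p s b x v → EqOn v (fun t => U t s x) (Icc s b)) ∧
          -- the approximating functions may be taken in `F_p`
          (∃ un : ℕ → ℝ → X, IsMildApprox A p (Ioo s b) (fun t => U t s x) un ∧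
            ∀ n, ∃ v' g : ℝ → X, IsFp I p A (un n) v' g) ∧
          ∀ φ : ℝ → ℝ → ℝ, (∀ ε ∈ Ioc 0 (b - s), IsStepCutoff a b s ε (φ ε)) →
            (∀ ε ∈ Ioc 0 (b - s), InDomainAndVanishesOn (G0 I p A).closure
              (fun t => φ ε t • U t s x) (Icc (s + ε) b)) ∧
            ∀ v : ℝ → X, ContinuousOn v (Icc s b) → v s = x →
              (∀ ε ∈ Ioc 0 (b - s), InDomainAndVanishesOn (G0 I p A).closure
                (fun t => φ ε t • v t) (Icc (s + ε) b)) →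
              EqOn v (fun t => U t s x) (Icc s b)) ∧
        -- the case `I = ℝ` with invertible `U`
        (I = univ → IsInvertibleFamily U →
          IsMildSolutionReal A p s x (fun t => twoSided U t s x) ∧
          (∀ v : ℝ → X, IsMildSolutionReal A p s x v → v = fun t => twoSided U t s x) ∧
          ∀ ψ : ℝ → ℝ → ℝ, (∀ d : ℝ, |s| < d → IsPlateauCutoff d (ψ d)) →
            (∀ d : ℝ, |s| < d → InDomainAndVanishesOn (G0 I p A).closure
              (fun t => ψ d t • twoSided U t s x) (Icc (-d) d)) ∧
            ∀ v : ℝ → X, Continuous v → v s = x →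
              (∀ d : ℝ, |s| < d → InDomainAndVanishesOn (G0 I p A).closure
                (fun t => ψ d t • v t) (Icc (-d) d)) →
              v = fun t => twoSided U t s x) := by
  have h : IsStableFamily I p A M w w' :=
    ⟨isLeftOpen_of_Ioc_or_univ hI, hA, hw, hR, hrange, hdense, hdense'⟩
  obtain ⟨V, hV, hVb⟩ := h.exists_propagator
  have hVe := hV.isEvolutionFamily h hVb
  obtain ⟨T, hT⟩ := hVe.exists_isEvolutionSemigroupOf (p := p) h.leftOpen
  obtain ⟨hcl, hgen⟩ := hV.closure_isGeneratorOf h hVe hVb hT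
  refine ⟨hcl, ⟨V, hVe, T, hV.isC0Semigroup h hVe hVb hT, hgen, hT⟩, ?_⟩
  intro U hUe hUG s hs x
  -- Any family whose evolution semigroup is generated by the closure agrees with the constructed
  -- one for `s ≤ t` in `I`, and so inherits the propagator inequality.
  have hU : IsPropagator I A M w' U := hV.congr (hV.eq_of_generates h hVe hVb hUe hUG)
  refine ⟨fun a b hIab hsb => ?_, fun hIu hinv => ?_⟩
  · subst hIab
    exact hU.mildSolution_Ioc h hUe hcl hs hsb x
  · subst hIu
    exact hU.mildSolution_univ h hUe hcl hinv s x
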